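/- **Setting.** Fix integers $n\ge 1$, $N'>n$ and $N\ge N'+n$. Balls $B(x,r)$ are open. *Cones.* For a linearly independent finite set $X$ of unit vectors in $\mathbb{R}^{N'}$ with $\#X=d$, let $C(X)=\{tx:t\ge 0,\ x\in\operatorname{conv}X\}$ ($C(\emptyset)=\{0\}$); this is a simple cone of dimension $d$. A complex cone of dimension $d$ is a finite non-empty union $T=\bigcup_i C(X_i)$ of distinct simple cones of dimension $d$ such that $C(X)\cap C(Y)=C(X\cap Y)$ for all $X,Y\in\Omega_T:=\{Y: Y\subset X_i \text{ for some } i\}$. It is non-flat if, whenever $Y,Z_1,Z_2\in\Omega_T$, $Y=Z_1\cap Z_2$, $\#Y<d$ and $\#Z_1=\#Z_2=\#Y+1$, the supremum of the angles $\angle f_1zf_2$ over all $z\in C(Y)$ and $f_j\in C(Z_j)\setminus C(Y)$ with $\operatorname{dist}(f_j,C(Y))=|f_j-z|$ $(j=1,2)$ is less than $\pi$. *Types and spines.* For $0\le m\le n$, a set of type $m$ is a set $W=R(T\times\mathbb{R}^m\times\{0\})\subset\mathbb{R}^N$, where $T$ is a non-flat complex cone of dimension $n-m$ in $\mathbb{R}^{N'}$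 and $R$ is an isometry of $\mathbb{R}^N$. Its $k$-spine is $L^k(W)=R\big(\bigcup_{Y\in\Omega_T,\,\#Y=k-m}C(Y)\times\mathbb{R}^m\times\{0\}\big)$ for $m\le k\le n$, and $L^k(W)=\emptyset$ for $k<m$. *Blow-up limits.* Let $\mathscr{B}$ be a family of sets, each of some type in $\{0,\dots,n\}$, that is finite modulo isometries of $\mathbb{R}^N$. Let $\mathscr{A}$ be the family of all isometric images of the blow-up limits of members of $\mathscr{B}$; the blow-up limit of $W$ at $x\in W$ is the cone $\{c(y-x): y\in W\cap B(x,r),\ c\ge0\}$, which is the same for all sufficiently small $r>0$. Let $\mathscr{A}(m)$ be the family of the members of $\mathscr{A}$ that are of type $m$. *Distance.* $d_{x,r}(F_1,F_2)=\frac1r\max\{\sup_{z\in F_2\cap B(x,r)}\operatorname{dist}(z,F_1),\ \sup_{z\in F_1\cap B(x,r)}\operatorname{dist}(z,F_2)\}$ for sets $F_1,F_2\subset\mathbb{R}^N$ that meet $B(x,r)$. *Constants.* Call $(n_0,\delta_0)$ admissible for $\mathscr{B}$ if $n_0>10$, $0<\delta_0<\frac1{10}$ and, for all $0\le m\le t\le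 n-1$ and all $W\in\mathscr{A}(m)$: (a) if $x\in L^t(W)$, $W'\in\mathscr{A}(u)$ with $t+1\le u\le n$, $r>0$, and $W'$ meets $B(x,r)$, then $d_{x,r}(W,W')>\delta_0$; (b) for every open ball $B=B(y,s)$ and $n_0B:=B(y,n_0s)$: if $B\cap W\ne\emptyset$ and $n_0B\cap L^t(W)=\emptyset$, then $W\cap B=Y\cap B$ for some $Y\in\bigcup_{u=t+1}^n\mathscr{A}(u)$; and if $W\cap B\neq Y\cap B$ for every $Y\in\mathscr{A}(t+1)$, then $n_0B\cap L^t(W)\ne\emptyset$. Put $N_0=n_0/\delta_0$, $C_0=10^8(n_0+n)^{3n}N_0$, $C_1=n_0^nN_0$, $C_5=2\big(100n_0^{2n}N_0^2n+10^3n_0^{2n+1}N_0^2n^3\big)$ and $\lambda_k=1-\frac{k+1}{100n}$. *Strata.* Given a set $E\subset\mathbb{R}^N$ and $\varepsilon$, let $a_m(x,r)=\inf\{d_{x,r}(E,W): W\in\mathscr{A}(m),\ x\in L^m(W)\}$ (with $\inf\emptyset=\infty$), and let $E_m$ be the set of all $x\in E\cap B(0,2)$ for which there is $r_x>0$ such that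 $a_m(x,r)<C_0\varepsilon$ for all $0<r<r_x$. **Proposition.** Admissible pairs $(n_0,\delta_0)$ exist, and for every admissible pair $(n_0,\delta_0)$ there is $\varepsilon_0>0$, depending only on $\mathscr{B}$, $n_0$, $\delta_0$ (and the dimensions), with the following property. Let $\varepsilon<\varepsilon_0$, and let $E\subset\mathbb{R}^N$ be a closed set containing $0$ such that for all $x\in E$ and $r>0$ there is $Z(x,r)\in\mathscr{A}$ with $x\in Z(x,r)$ and $d_{x,r}(E,Z(x,r))<\varepsilon$. Let $0\le m\le n$, $x\in E_m$ and $r>0$ be such that $B(x,5n_0^nr/2)\subset B(0,2)$ and $B(x,5n_0^nr/2)\cap\bigcup_{k=0}^{m-1}E_k=\emptyset$. Then there is $T\in\mathscr{A}(m)$ such that 1. $x\in L^m(T)$ and $d_{x,r}(E,T)<14C_1\varepsilon$; 2. for every $k\in\{m,\dots,n-1\}$ (no condition if $m=n$), $\lambda_k>0$, the stratum $E_k$ meets $B(x,\lambda_kr)$, and $d_{x,\lambda_kr}(E_k,L^k(T))<C_5\varepsilon$. -/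

import Mathlib

open Set Filter Topology Metric
open scoped ENNReal

noncomputable section

namespace ConeStrata

/-- The `k`-dimensional Euclidean space. -/
abbrev Euc (k : ℕ) : Type := EuclideanSpace ℝ (Fin k)

/-! ### Simple cones and complex cones -/

section Cones

variable {V : Type*} [NormedAddCommGroup V] [InnerProductSpace ℝ V]

/-- The cone `C(X) = {t x : t ≥ 0, x ∈ conv X}`, with `C(∅) = {0}`.
(For non-empty `X` the point `0` already belongs to the second set.) -/
def simpleCone (X : Set V) : Set V :=
  insert 0 {v | ∃ t : ℝ, 0 ≤ t ∧ ∃ x ∈ convexHull ℝ X, v = t • x}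

/-- `X` consists of unit vectors and `{0} ∪ X` is affinely independent, that is, `X` is
linearly independent. Then `C(X)` is a simple cone of dimension `#X`. -/
def IsGenerating (X : Finset V) : Prop :=
  (∀ x ∈ X, ‖x‖ = 1) ∧ LinearIndepOn ℝ id (X : Set V)

/-- The family `Ω` of all subsets of the generating sets. -/
def faces (𝒳 : Finset (Finset V)) : Set (Finset V) :=
  {Y | ∃ X ∈ 𝒳, Y ⊆ X}

/-- The union of the cones `C(Y)` over the `Y ∈ Ω` with exactly `t` elements. -/
def skeleton (𝒳 : Finset (Finset V)) (t : ℕ) : Set V :=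
  {v | ∃ Y ∈ faces 𝒳, Y.card = t ∧ v ∈ simpleCone (Y : Set V)}

/-- The union of the simple cones `C(X)`, `X ∈ 𝒳`. -/
def support (𝒳 : Finset (Finset V)) : Set V :=
  {v | ∃ X ∈ 𝒳, v ∈ simpleCone (X : Set V)}

/-- The finite non-empty family `𝒳` presents its `support` as a complex cone of dimension `d`:
every `C(X)` is a simple cone of dimension `d`, and any two faces meet exactly along their
common face. -/
def IsComplexCone (d : ℕ) (𝒳 : Finset (Finset V)) : Prop :=
  𝒳.Nonempty ∧
  (∀ X ∈ 𝒳, IsGenerating X ∧ X.card = d) ∧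
  ∀ X ∈ faces 𝒳, ∀ Y ∈ faces 𝒳,
    simpleCone (X : Set V) ∩ simpleCone (Y : Set V) = simpleCone ((X : Set V) ∩ (Y : Set V))

/-- The set `∠(F₁, F₂)` of the angles `∠ f₁ z f₂`, where `z ∈ C(F₁ ∩ F₂)`,
`f_j ∈ C(F_j) \ C(F₁ ∩ F₂)` and `dist(f_j, C(F₁ ∩ F₂)) = |f_j - z|`. -/
def angleSet (F₁ F₂ : Finset V) : Set ℝ :=
  {θ | ∃ z ∈ simpleCone ((F₁ : Set V) ∩ (F₂ : Set V)),
    ∃ f₁ ∈ simpleCone (F₁ : Set V) \ simpleCone ((F₁ : Set V) ∩ (F₂ : Set V)),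
    ∃ f₂ ∈ simpleCone (F₂ : Set V) \ simpleCone ((F₁ : Set V) ∩ (F₂ : Set V)),
      infDist f₁ (simpleCone ((F₁ : Set V) ∩ (F₂ : Set V))) = dist f₁ z ∧
      infDist f₂ (simpleCone ((F₁ : Set V) ∩ (F₂ : Set V))) = dist f₂ z ∧
      θ = EuclideanGeometry.angle f₁ z f₂}

/-- The non-flat condition for a complex cone of dimension `d`. -/
def NonFlat (d : ℕ) (𝒳 : Finset (Finset V)) : Prop :=
  ∀ Y ∈ faces 𝒳, Y.card < d →
    ∀ Z₁ ∈ faces 𝒳, ∀ Z₂ ∈ faces 𝒳,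
      (Y : Set V) = (Z₁ : Set V) ∩ (Z₂ : Set V) →
      Z₁.card = Y.card + 1 → Z₂.card = Y.card + 1 →
      sSup (angleSet Z₁ Z₂) < Real.pi

end Cones

/-! ### Sets of type `m` and their spines -/

/-- The subset `S × ℝ^m × {0}` of `ℝ^N = ℝ^{N'} × ℝ^m × ℝ^{N - N' - m}`. -/
def prodPlane {N' : ℕ} (N m : ℕ) (S : Set (Euc N')) : Set (Euc N) :=
  {v | (∃ p ∈ S, ∀ (i : Fin N') (j : Fin N), (j : ℕ) = (i : ℕ) → v j = p i) ∧
    ∀ j : Fin N, N' + m ≤ (j : ℕ) → v j = 0}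

variable (n N' : ℕ) {N : ℕ}

/-- `W = R(T × ℝ^m × {0})`, where `T` is the complex cone of dimension `n - m` in `ℝ^{N'}`
presented by `𝒳`, which satisfies the non-flat condition, and `R` is an isometry. -/
def IsPresentation (m : ℕ) (W : Set (Euc N)) (𝒳 : Finset (Finset (Euc N')))
    (R : Euc N ≃ᵢ Euc N) : Prop :=
  m ≤ n ∧ IsComplexCone (n - m) 𝒳 ∧ NonFlat (n - m) 𝒳 ∧
    W = R '' prodPlane N m (support 𝒳)

/-- `W` is a set of type `m`. -/
def IsOfType (m : ℕ) (W : Set (Euc N)) : Prop :=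
  ∃ (𝒳 : Finset (Finset (Euc N'))) (R : Euc N ≃ᵢ Euc N), IsPresentation n N' m W 𝒳 R

/-- The `k`-spine `L^k(W)`. If `W = R(T × ℝ^m × {0})` is of type `m`, this is the union of the
branches `R(C(Y) × ℝ^m × {0})`, `Y ∈ Ω_T`, `#Y = k - m`, for `m ≤ k ≤ n`; it is empty for `k < m`.
(Because of the non-flat condition it does not depend on the presentation of `W`.) -/
def spine (W : Set (Euc N)) (k : ℕ) : Set (Euc N) :=
  {x | ∃ (m : ℕ) (𝒳 : Finset (Finset (Euc N'))) (R : Euc N ≃ᵢ Euc N),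
    IsPresentation n N' m W 𝒳 R ∧ m ≤ k ∧ k ≤ n ∧
      x ∈ R '' prodPlane N m (skeleton 𝒳 (k - m))}

/-! ### Blow-up limits -/

/-- The cone `{c (y - x) : y ∈ W ∩ B(x, r), c ≥ 0}`. -/
def blowUp (W : Set (Euc N)) (x : Euc N) (r : ℝ) : Set (Euc N) :=
  {v | ∃ c : ℝ, 0 ≤ c ∧ ∃ y ∈ W ∩ ball x r, v = c • (y - x)}

/-- All isometric images of the blow-up limits of the members of `𝓑` at their points, a blow-up
limit of `W` at `x` being the common value of `blowUp W x r` for all small `r > 0`. -/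
def blowUpLimits (𝓑 : Set (Set (Euc N))) : Set (Set (Euc N)) :=
  {Y | ∃ W ∈ 𝓑, ∃ x ∈ W, ∃ R : Euc N ≃ᵢ Euc N, ∀ᶠ r in 𝓝[>] (0 : ℝ), Y = R '' blowUp W x r}

/-- The members of type `m` of the family of blow-up limits. -/
def limitsOfType (𝓑 : Set (Set (Euc N))) (m : ℕ) : Set (Set (Euc N)) :=
  {W | W ∈ blowUpLimits 𝓑 ∧ IsOfType n N' m W}

/-- Up to isometries of `ℝ^N`, the family `𝓑` has only finitely many members. -/
def FiniteModIsometry (𝓑 : Set (Set (Euc N))) : Prop :=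
  ∃ F : Set (Set (Euc N)), F.Finite ∧ F ⊆ 𝓑 ∧
    ∀ W ∈ 𝓑, ∃ W' ∈ F, ∃ R : Euc N ≃ᵢ Euc N, W = R '' W'

/-! ### The normalized local distance and the two geometric constants -/

/-- The normalized local Hausdorff distance
`d_{x,r}(F₁, F₂) = (1/r) max (sup_{z ∈ F₂ ∩ B(x,r)} dist(z, F₁), sup_{z ∈ F₁ ∩ B(x,r)} dist(z, F₂))`,
with values in `[0, ∞]`. -/
def localDist (x : Euc N) (r : ℝ) (F₁ F₂ : Set (Euc N)) : ℝ≥0∞ :=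
  ((⨆ z ∈ F₂ ∩ ball x r, infEDist z F₁) ⊔ (⨆ z ∈ F₁ ∩ ball x r, infEDist z F₂)) /
    ENNReal.ofReal r

/-- `δ₀` separates different types: a set of type `m` whose `t`-spine contains `x` is, in every
ball centred at `x`, at distance more than `δ₀` from all sets of type at least `t + 1`. -/
def IsSeparating (𝓑 : Set (Set (Euc N))) (δ₀ : ℝ) : Prop :=
  ∀ m t : ℕ, m ≤ t → t < n → ∀ W ∈ limitsOfType n N' 𝓑 m, ∀ x ∈ spine n N' W t,
    ∀ u : ℕ, t + 1 ≤ u → u ≤ n → ∀ W' ∈ limitsOfType n N' 𝓑 u,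
      ∀ r : ℝ, 0 < r → (W' ∩ ball x r).Nonempty →
        ENNReal.ofReal δ₀ < localDist x r W W'

/-- `n₀` is a dilation factor such that, in a ball `B` whose dilate `n₀ B` avoids the `t`-spine
of a set `W`, the set `W` coincides with a set of type at least `t + 1` if `B` meets `W`; and `n₀ B`
meets the `t`-spine of `W` if `W` coincides in `B` with no set of type `t + 1`. -/
def IsSubstituting (𝓑 : Set (Set (Euc N))) (n₀ : ℝ) : Prop :=
  ∀ m t : ℕ, m ≤ t → t < n → ∀ W ∈ limitsOfType n N' 𝓑 m, ∀ (y : Euc N) (s : ℝ), 0 < s →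
    ((ball y s ∩ W).Nonempty → ball y (n₀ * s) ∩ spine n N' W t = ∅ →
      ∃ u : ℕ, t + 1 ≤ u ∧ u ≤ n ∧ ∃ Y ∈ limitsOfType n N' 𝓑 u, W ∩ ball y s = Y ∩ ball y s) ∧
    ((∀ Y ∈ limitsOfType n N' 𝓑 (t + 1), W ∩ ball y s ≠ Y ∩ ball y s) →
      (ball y (n₀ * s) ∩ spine n N' W t).Nonempty)

/-- The admissible pairs of geometric constants of the family `𝓑`. -/
def Admissible (𝓑 : Set (Set (Euc N))) (n₀ δ₀ : ℝ) : Prop :=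
  10 < n₀ ∧ 0 < δ₀ ∧ δ₀ < 1 / 10 ∧ IsSeparating n N' 𝓑 δ₀ ∧ IsSubstituting n N' 𝓑 n₀

/-! ### The constants, the numbers `a_m(x, r)` and the strata -/

/-- `N₀ = n₀ / δ₀`. -/
def constN₀ (n₀ δ₀ : ℝ) : ℝ := n₀ / δ₀

/-- `C₀ = 10⁸ (n₀ + n)^{3n} N₀`. -/
def constC₀ (n : ℕ) (n₀ δ₀ : ℝ) : ℝ := 10 ^ 8 * (n₀ + n) ^ (3 * n) * constN₀ n₀ δ₀

/-- `C₁ = n₀^n N₀`. -/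
def constC₁ (n : ℕ) (n₀ δ₀ : ℝ) : ℝ := n₀ ^ n * constN₀ n₀ δ₀

/-- `C₅ = 2 (100 n₀^{2n} N₀² n + 10³ n₀^{2n+1} N₀² n³)`. -/
def constC₅ (n : ℕ) (n₀ δ₀ : ℝ) : ℝ :=
  2 * (100 * n₀ ^ (2 * n) * constN₀ n₀ δ₀ ^ 2 * n
    + 10 ^ 3 * n₀ ^ (2 * n + 1) * constN₀ n₀ δ₀ ^ 2 * (n : ℝ) ^ 3)

/-- `λ_k = 1 - (k + 1) / (100 n)`. -/
def scale (n k : ℕ) : ℝ := 1 - ((k : ℝ) + 1) / (100 * (n : ℝ))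

/-- `a_m(x, r)`, the infimum of `d_{x,r}(E, W)` over the blow-up limits `W` of type `m` whose
`m`-spine contains `x`. -/
def approxNumber (𝓑 : Set (Set (Euc N))) (E : Set (Euc N)) (m : ℕ) (x : Euc N) (r : ℝ) : ℝ≥0∞ :=
  ⨅ W ∈ {W | W ∈ limitsOfType n N' 𝓑 m ∧ x ∈ spine n N' W m}, localDist x r E W

/-- The stratum `E_m`: the points `x ∈ E ∩ B(0, 2)` such that `a_m(x, r) < C₀ ε` for all small
`r > 0`. -/
def stratum (𝓑 : Set (Set (Euc N))) (n₀ δ₀ ε : ℝ) (E : Set (Euc N)) (m : ℕ) : Set (Euc N) :=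
  {x | x ∈ E ∩ ball 0 2 ∧ ∃ rx : ℝ, 0 < rx ∧ ∀ r : ℝ, 0 < r → r < rx →
    approxNumber n N' 𝓑 E m x r < ENNReal.ofReal (constC₀ n n₀ δ₀ * ε)}

/-- `E` is closed, contains the origin, and at each of its points and at each scale it is
`ε`-close to a blow-up limit of `𝓑` through that point. -/
def IsApproximable (𝓑 : Set (Set (Euc N))) (ε : ℝ) (E : Set (Euc N)) : Prop :=
  IsClosed E ∧ (0 : Euc N) ∈ E ∧
    ∀ x ∈ E, ∀ r : ℝ, 0 < r →
      ∃ Z ∈ blowUpLimits 𝓑, x ∈ Z ∧ localDist x r E Z < ENNReal.ofReal ε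

end ConeStrata

end

open ConeStrata

set_option linter.unusedSectionVars false

namespace ConeStrata

/-! ### Simple cones: coordinates, relative interiors, closedness -/

section SimpleCones

open scoped Classical

variable {V : Type*} [NormedAddCommGroup V] [InnerProductSpace ℝ V]

/-! Types and spines have an intrinsic description. Near a point whose carrier (the face with the
point in its relative interior) is `F`, a set `p + P + T` is a translate of `P + span F` plus the
link of `F` in `T`, and links inherit the cone axioms and non-flatness (`IsCylinder.isTangent`,
`IsCylinder.isCylinder_tangentCone`). A non-flat cone has no translational symmetry, since one would
put two opposite rays into a one-dimensional link. So `P` is exactly the space of translations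
preserving the set, the type is its dimension, and by `mem_spine` the `t`-spine consists of the
points whose tangent cone has type at most `t`. Spines are therefore local and independent of the
presentation, and the family of blow-up limits is closed under taking tangent cones.

Admissible constants come from compactness and from finiteness modulo isometries. Away from its
lowest spine a model coincides locally with a set of the next type. A Lebesgue number on the unit
sphere of `Pᗮ` makes this uniform, and iteration over the types gives `n₀`. If no `δ₀` existed,
counterexamples in normal form (finitely many models, bounded base points, rotations) would converge
along an ultrafilter to two models that coincide near a point at which their tangent types differ.

The quantitative part rests on `exists_spine_near`: an approximation error `η` around a point of a
`t`-spine, viewed at radius about `η / δ₀`, forces the `t`-spine of the other set to pass within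
about `N₀ η`. Iterated over scales shrinking by 4, this turns a spine point of an approximating set
into a point of `E` that is centered at all small scales. A centered point of least index in a ball
lies in the stratum of that index.

In a ball free of lower strata, `E` is consequently close to a set of type at least `m`. A coarse
approximation by a set of type `m` at a much smaller scale forces this type to be `m` and puts `x`
near the spine, so that a small translation gives the error `13 C₁ ε`. As `13 C₁ ≤ C₀`, the output
can serve as the next input, and the estimate climbs from arbitrarily small scales up to `r`. Strata
and spines are then compared in both directions: a stratum point is first moved to one isolated from
lower strata, while a spine point produces a stratum point of some index at most `k`, from which one
climbs to index exactly `k`. -/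

theorem mem_simpleCone_finset {X : Finset V} {v : V} :
    v ∈ simpleCone (X : Set V) ↔
      ∃ c : V → ℝ, (∀ x ∈ X, 0 ≤ c x) ∧ ∑ x ∈ X, c x • x = v := by
  constructor
  · rintro (rfl | ⟨t, ht, y, hy, rfl⟩)
    · exact ⟨0, by simp, by simp⟩
    · obtain ⟨w, hw, -, rfl⟩ := Finset.mem_convexHull'.1 hy
      exact ⟨fun x => t * w x, fun x hx => mul_nonneg ht (hw x hx), by
        simp [Finset.smul_sum, mul_smul]⟩
  · rintro ⟨c, hc, rfl⟩
    by_cases hs : ∑ x ∈ X, c x = 0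
    · have h0 := (Finset.sum_eq_zero_iff_of_nonneg hc).1 hs
      left
      exact Finset.sum_eq_zero fun x hx => by simp [h0 x hx]
    · right
      have hpos : 0 < ∑ x ∈ X, c x := lt_of_le_of_ne (Finset.sum_nonneg hc) (Ne.symm hs)
      refine ⟨∑ x ∈ X, c x, hpos.le, ∑ x ∈ X, (c x / ∑ x ∈ X, c x) • x,
        Finset.mem_convexHull'.2 ⟨fun x => c x / ∑ x ∈ X, c x,
          fun x hx => div_nonneg (hc x hx) hpos.le, ?_, rfl⟩, ?_⟩
      · rw [← Finset.sum_div, div_self hs]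
      · rw [Finset.smul_sum]
        refine Finset.sum_congr rfl fun x _ => ?_
        rw [smul_smul, mul_div_cancel₀ _ hs]

theorem simpleCone_mono {X Y : Set V} (h : X ⊆ Y) : simpleCone X ⊆ simpleCone Y := by
  rintro v (rfl | ⟨t, ht, y, hy, rfl⟩)
  · exact Or.inl rfl
  · exact Or.inr ⟨t, ht, y, convexHull_mono h hy, rfl⟩

theorem zero_mem_simpleCone (X : Set V) : (0 : V) ∈ simpleCone X := Or.inl rfl

theorem smul_mem_simpleCone {X : Set V} {v : V} (hv : v ∈ simpleCone X) {t : ℝ} (ht : 0 ≤ t) :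
    t • v ∈ simpleCone X := by
  rcases hv with rfl | ⟨s, hs, y, hy, rfl⟩
  · simp [zero_mem_simpleCone]
  · exact Or.inr ⟨t * s, mul_nonneg ht hs, y, hy, by rw [mul_smul]⟩

theorem add_mem_simpleCone {X : Finset V} {v w : V} (hv : v ∈ simpleCone (X : Set V))
    (hw : w ∈ simpleCone (X : Set V)) : v + w ∈ simpleCone (X : Set V) := by
  obtain ⟨c, hc, rfl⟩ := mem_simpleCone_finset.1 hv
  obtain ⟨e, he, rfl⟩ := mem_simpleCone_finset.1 hw
  exact mem_simpleCone_finset.2 ⟨fun x => c x + e x, fun x hx => add_nonneg (hc x hx) (he x hx), by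
    simp [add_smul, Finset.sum_add_distrib]⟩

theorem mem_simpleCone_of_mem {X : Finset V} {x : V} (hx : x ∈ X) :
    x ∈ simpleCone (X : Set V) :=
  Or.inr ⟨1, zero_le_one, x, subset_convexHull ℝ _ hx, (one_smul ℝ x).symm⟩

theorem simpleCone_subset_span (X : Finset V) :
    simpleCone (X : Set V) ⊆ Submodule.span ℝ (X : Set V) := by
  intro v hv
  obtain ⟨c, -, rfl⟩ := mem_simpleCone_finset.1 hv
  exact Submodule.sum_mem _ fun x hx => Submodule.smul_mem _ _ (Submodule.subset_span hx)

/-- The relative interior of `C(Y)`. -/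
def openCone (Y : Finset V) : Set V :=
  {v | ∃ c : V → ℝ, (∀ y ∈ Y, 0 < c y) ∧ ∑ y ∈ Y, c y • y = v}

theorem openCone_subset (Y : Finset V) : openCone Y ⊆ simpleCone (Y : Set V) := by
  rintro v ⟨c, hc, rfl⟩
  exact mem_simpleCone_finset.2 ⟨c, fun y hy => (hc y hy).le, rfl⟩

theorem sum_mem_openCone (Y : Finset V) : ∑ y ∈ Y, y ∈ openCone Y :=
  ⟨fun _ => 1, fun _ _ => one_pos, by simp⟩

theorem exists_mem_openCone {X : Finset V} {v : V} (hv : v ∈ simpleCone (X : Set V)) :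
    ∃ Y ⊆ X, v ∈ openCone Y := by
  obtain ⟨c, hc, rfl⟩ := mem_simpleCone_finset.1 hv
  refine ⟨X.filter (fun x => 0 < c x), Finset.filter_subset _ _, c, fun y hy =>
    (Finset.mem_filter.1 hy).2, ?_⟩
  refine Finset.sum_subset (Finset.filter_subset _ _) fun x hx hx' => ?_
  have : c x = 0 := le_antisymm (not_lt.1 fun h => hx' (Finset.mem_filter.2 ⟨hx, h⟩)) (hc x hx)
  simp [this]

theorem IsGenerating.subset {X Y : Finset V} (hX : IsGenerating X) (h : Y ⊆ X) :
    IsGenerating Y :=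
  ⟨fun x hx => hX.1 x (h hx), hX.2.mono (by exact_mod_cast h)⟩

theorem IsGenerating.exists_linearMap {X : Finset V} (hX : IsGenerating X) (c : V → ℝ) :
    ∃ φ : V →ₗ[ℝ] ℝ, ∀ x ∈ X, φ x = c x := by
  let b := Module.Basis.extend hX.2
  refine ⟨b.constr ℝ (fun i => c i), fun x hx => ?_⟩
  have hx' : x ∈ hX.2.extend (subset_univ _) := hX.2.subset_extend _ hx
  have : b ⟨x, hx'⟩ = x := by simp [b]
  calc b.constr ℝ (fun i => c i) x = b.constr ℝ (fun i => c i) (b ⟨x, hx'⟩) := by rw [this]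
    _ = c x := by rw [Module.Basis.constr_basis]

/-- The coordinate functionals of a linearly independent set. -/
theorem IsGenerating.exists_coord {X : Finset V} (hX : IsGenerating X) (y : V) :
    ∃ φ : V →ₗ[ℝ] ℝ, ∀ c : V → ℝ, y ∈ X → φ (∑ x ∈ X, c x • x) = c y := by
  obtain ⟨φ, hφ⟩ := hX.exists_linearMap (fun x => if x = y then 1 else 0)
  refine ⟨φ, fun c hy => ?_⟩
  rw [map_sum, Finset.sum_eq_single y]
  · simp [hφ y hy]
  · intro x hx hxy
    simp [hφ x hx, hxy]
  · exact fun h => absurd hy h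

theorem IsGenerating.coeff_unique {X : Finset V} (hX : IsGenerating X) {c e : V → ℝ}
    (h : ∑ x ∈ X, c x • x = ∑ x ∈ X, e x • x) {y : V} (hy : y ∈ X) : c y = e y := by
  obtain ⟨φ, hφ⟩ := hX.exists_coord y
  rw [← hφ c hy, ← hφ e hy, h]

theorem faces_subset {𝒳 : Finset (Finset V)} {X Y : Finset V} (hX : X ∈ faces 𝒳) (h : Y ⊆ X) :
    Y ∈ faces 𝒳 := by
  obtain ⟨Z, hZ, hXZ⟩ := hX
  exact ⟨Z, hZ, h.trans hXZ⟩

theorem mem_faces {𝒳 : Finset (Finset V)} {X : Finset V} (hX : X ∈ 𝒳) : X ∈ faces 𝒳 :=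
  ⟨X, hX, Finset.Subset.refl _⟩

theorem IsComplexCone.isGenerating {d : ℕ} {𝒳 : Finset (Finset V)} (h : IsComplexCone d 𝒳)
    {Y : Finset V} (hY : Y ∈ faces 𝒳) : IsGenerating Y := by
  obtain ⟨X, hX, hYX⟩ := hY
  exact (h.2.1 X hX).1.subset hYX

theorem IsComplexCone.inter {d : ℕ} {𝒳 : Finset (Finset V)} (h : IsComplexCone d 𝒳)
    {X Y : Finset V} (hX : X ∈ faces 𝒳) (hY : Y ∈ faces 𝒳) {v : V}
    (h1 : v ∈ simpleCone (X : Set V)) (h2 : v ∈ simpleCone (Y : Set V)) :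
    v ∈ simpleCone ((X ∩ Y : Finset V) : Set V) := by
  rw [Finset.coe_inter, ← h.2.2 X hX Y hY]
  exact ⟨h1, h2⟩

/-- Coefficients are unique, so a vertex of `Y` outside `X` would have both a positive and a zero
coefficient. -/
theorem IsGenerating.subset_of_mem_openCone {X Y : Finset V} (hY : IsGenerating Y) {b : V}
    (hb : b ∈ openCone Y) (hb' : b ∈ simpleCone ((X ∩ Y : Finset V) : Set V)) : Y ⊆ X := by
  obtain ⟨c, hc, rfl⟩ := hb
  obtain ⟨e, he, hce⟩ := mem_simpleCone_finset.1 hb'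
  intro y hy
  by_contra hyX
  have h1 : ∑ x ∈ Y, c x • x = ∑ x ∈ Y, (if x ∈ X then e x else 0) • x := by
    rw [← hce]
    symm
    rw [← Finset.sum_subset (Finset.inter_subset_right : X ∩ Y ⊆ Y)]
    · refine Finset.sum_congr rfl fun x hx => ?_
      rw [if_pos (Finset.mem_inter.1 hx).1]
    · intro x hx hx'
      rw [if_neg fun h => hx' (Finset.mem_inter.2 ⟨h, hx⟩), zero_smul]
  have := hY.coeff_unique h1 hy
  rw [if_neg hyX] at this
  exact (hc y hy).ne' this

theorem IsComplexCone.carrier_subset {d : ℕ} {𝒳 : Finset (Finset V)} (h : IsComplexCone d 𝒳)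
    {X Y : Finset V} (hX : X ∈ faces 𝒳) (hY : Y ∈ faces 𝒳) {b : V}
    (hb : b ∈ openCone Y) (hbX : b ∈ simpleCone (X : Set V)) : Y ⊆ X :=
  (h.isGenerating hY).subset_of_mem_openCone hb (h.inter hX hY hbX (openCone_subset Y hb))

theorem IsComplexCone.card_le {d : ℕ} {𝒳 : Finset (Finset V)} (h : IsComplexCone d 𝒳)
    {Y : Finset V} (hY : Y ∈ faces 𝒳) : Y.card ≤ d := by
  obtain ⟨X, hX, hYX⟩ := hY
  rw [← (h.2.1 X hX).2]
  exact Finset.card_le_card hYX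

/-- A point of `C(Z) + span Y` is moved into `C(Z)` by large multiples of a point in the relative
interior of `C(Y)`, if `Y ⊆ Z`. -/
theorem exists_add_smul_mem {Y Z : Finset V} (hYZ : Y ⊆ Z) {w q u : V}
    (hw : w ∈ openCone Y) (hq : q ∈ simpleCone (Z : Set V))
    (hu : u ∈ Submodule.span ℝ (Y : Set V)) :
    ∃ l₀ : ℝ, ∀ l : ℝ, l₀ ≤ l → q + u + l • w ∈ simpleCone (Z : Set V) := by
  obtain ⟨c, hc, rfl⟩ := hw
  obtain ⟨e, -, rfl⟩ := Submodule.mem_span_finset.1 hu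
  have : ∃ l₀ : ℝ, ∀ y ∈ Y, ∀ l : ℝ, l₀ ≤ l → 0 ≤ e y + l * c y := by
    -- The sum bounds each quotient `|e y| / c y`, so one value of `l₀` makes all coefficients
    -- nonnegative.
    refine ⟨∑ y ∈ Y, |e y| / c y, fun y hy l hl => ?_⟩
    have h1 : |e y| / c y ≤ l := le_trans
      (Finset.single_le_sum (f := fun y => |e y| / c y)
        (fun i hi => div_nonneg (abs_nonneg _) (hc i hi).le) hy) hl
    rw [div_le_iff₀ (hc y hy)] at h1
    linarith [neg_abs_le (e y)]
  obtain ⟨l₀, hl₀⟩ := this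
  refine ⟨l₀, fun l hl => ?_⟩
  rw [add_assoc]
  refine add_mem_simpleCone hq (simpleCone_mono (by exact_mod_cast hYZ : (Y : Set V) ⊆ Z) ?_)
  refine mem_simpleCone_finset.2 ⟨fun y => e y + l * c y, fun y hy => hl₀ y hy l hl, ?_⟩
  simp [add_smul, Finset.sum_add_distrib, Finset.smul_sum, mul_smul]

/-- The cone is cut out of the closed subspace `span X` by the inequalities `0 ≤ φ y` for the
coordinate functionals. -/
theorem IsGenerating.isClosed_simpleCone [FiniteDimensional ℝ V] {X : Finset V}
    (hX : IsGenerating X) : IsClosed (simpleCone (X : Set V)) := by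
  choose φ hφ using fun y => hX.exists_coord y
  have : simpleCone (X : Set V) =
      (Submodule.span ℝ (X : Set V) : Set V) ∩ ⋂ y ∈ X, {v | 0 ≤ φ y v} := by
    ext v
    constructor
    · intro hv
      refine ⟨simpleCone_subset_span X hv, ?_⟩
      obtain ⟨c, hc, rfl⟩ := mem_simpleCone_finset.1 hv
      simp only [mem_iInter, mem_ofPred_eq]
      intro y hy
      rw [hφ y c hy]
      exact hc y hy
    · rintro ⟨h1, h2⟩
      obtain ⟨c, -, rfl⟩ := Submodule.mem_span_finset.1 h1
      refine mem_simpleCone_finset.2 ⟨c, fun y hy => ?_, rfl⟩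
      simp only [mem_iInter, mem_ofPred_eq] at h2
      have := h2 y hy
      rwa [hφ y c hy] at this
  rw [this]
  refine (Submodule.closed_of_finiteDimensional _).inter
    (isClosed_biInter fun y _ => isClosed_le continuous_const ?_)
  exact LinearMap.continuous_of_finiteDimensional (φ y)

theorem finite_faces (𝒳 : Finset (Finset V)) : (faces 𝒳).Finite := by
  refine (𝒳.biUnion Finset.powerset).finite_toSet.subset ?_
  rintro Y ⟨X, hX, hYX⟩
  simp only [Finset.coe_biUnion, mem_iUnion]
  exact ⟨X, hX, by simpa using hYX⟩

theorem IsComplexCone.isClosed_skeleton [FiniteDimensional ℝ V] {d : ℕ}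
    {𝒳 : Finset (Finset V)} (h : IsComplexCone d 𝒳) (k : ℕ) : IsClosed (skeleton 𝒳 k) := by
  have : skeleton 𝒳 k = ⋃ Y ∈ {Y | Y ∈ faces 𝒳 ∧ Y.card = k}, simpleCone (Y : Set V) := by
    ext v
    simp [skeleton, and_assoc]
  rw [this]
  exact ((finite_faces 𝒳).subset fun Y hY => hY.1).isClosed_biUnion
    fun Y hY => (h.isGenerating hY.1).isClosed_simpleCone

theorem IsComplexCone.isClosed_support [FiniteDimensional ℝ V] {d : ℕ}
    {𝒳 : Finset (Finset V)} (h : IsComplexCone d 𝒳) : IsClosed (support 𝒳) := by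
  have : support 𝒳 = ⋃ Y ∈ (𝒳 : Set (Finset V)), simpleCone (Y : Set V) := by
    ext v
    simp [support]
  rw [this]
  exact 𝒳.finite_toSet.isClosed_biUnion fun Y hY => (h.2.1 Y hY).1.isClosed_simpleCone

end SimpleCones

/-! ### Links of faces inherit the cone axioms and non-flatness -/

section Links

open scoped Classical

variable {V : Type*} [NormedAddCommGroup V] [InnerProductSpace ℝ V]

theorem simpleCone_subset_of_closed {X : Finset V} {S : Set V} (h0 : 0 ∈ S)
    (hadd : ∀ v ∈ S, ∀ w ∈ S, v + w ∈ S) (hsmul : ∀ v ∈ S, ∀ t : ℝ, 0 ≤ t → t • v ∈ S)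
    (hX : ∀ x ∈ X, x ∈ S) : simpleCone (X : Set V) ⊆ S := by
  intro v hv
  obtain ⟨c, hc, rfl⟩ := mem_simpleCone_finset.1 hv
  exact Finset.sum_induction _ (· ∈ S) (fun a b ha hb => hadd a ha b hb) h0
    fun x hx => hsmul x (hX x hx) _ (hc x hx)

/-- The orthogonal projection with kernel `span Y`. -/
noncomputable def perp (Y : Finset V) : V →L[ℝ] V :=
  (Submodule.span ℝ (Y : Set V))ᗮ.starProjection

theorem perp_mem (Y : Finset V) (v : V) : perp Y v ∈ (Submodule.span ℝ (Y : Set V))ᗮ :=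
  Submodule.starProjection_apply_mem _ _

theorem perp_eq_zero {Y : Finset V} {v : V} :
    perp Y v = 0 ↔ v ∈ Submodule.span ℝ (Y : Set V) := by
  rw [perp, Submodule.starProjection_apply_eq_zero_iff, Submodule.orthogonal_orthogonal]

theorem perp_eq_self {Y : Finset V} {v : V} :
    perp Y v = v ↔ v ∈ (Submodule.span ℝ (Y : Set V))ᗮ :=
  Submodule.starProjection_eq_self_iff

theorem sub_perp_mem (Y : Finset V) (v : V) : v - perp Y v ∈ Submodule.span ℝ (Y : Set V) := by
  rw [← perp_eq_zero, map_sub, perp_eq_self.2 (perp_mem Y v), sub_self]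

theorem norm_perp_le (Y : Finset V) (v : V) : ‖perp Y v‖ ≤ ‖v‖ :=
  Submodule.norm_starProjection_apply_le _ _

theorem perp_smul_of_mem_openCone {Y : Finset V} {w : V} (hw : w ∈ openCone Y) (l : ℝ) :
    perp Y (l • w) = 0 :=
  perp_eq_zero.2 (Submodule.smul_mem _ _ (simpleCone_subset_span Y (openCone_subset Y hw)))

/-- The normalized projection of `x`. -/
noncomputable def unitPerp (Y : Finset V) (x : V) : V := ‖perp Y x‖⁻¹ • perp Y x

theorem norm_smul_unitPerp (Y : Finset V) (x : V) : ‖perp Y x‖ • unitPerp Y x = perp Y x := by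
  rw [unitPerp, smul_smul]
  by_cases h : perp Y x = 0
  · simp [h]
  · rw [mul_inv_cancel₀ (norm_ne_zero_iff.2 h), one_smul]

/-- The normalized projection of the vertices of `Z` that do not belong to `Y`. -/
noncomputable def linkFace (Y Z : Finset V) : Finset V := (Z \ Y).image (unitPerp Y)

/-- The link of the face `Y`. -/
noncomputable def link (𝒳 : Finset (Finset V)) (Y : Finset V) : Finset (Finset V) :=
  (𝒳.filter (Y ⊆ ·)).image (linkFace Y)

/-- Vertices in `Y` project to zero and the others to nonnegative multiples of link vertices; both
sides are closed under sums and nonnegative multiples. -/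
theorem mem_simpleCone_linkFace {Y Z : Finset V} {v : V} :
    v ∈ simpleCone (linkFace Y Z : Set V) ↔ ∃ q ∈ simpleCone (Z : Set V), perp Y q = v := by
  constructor
  · have key : simpleCone (linkFace Y Z : Set V) ⊆
        {v | ∃ q ∈ simpleCone (Z : Set V), perp Y q = v} := by
      refine simpleCone_subset_of_closed ?_ ?_ ?_ ?_
      · exact ⟨0, zero_mem_simpleCone _, map_zero _⟩
      · rintro _ ⟨q, hq, rfl⟩ _ ⟨q', hq', rfl⟩
        exact ⟨q + q', add_mem_simpleCone hq hq', map_add _ _ _⟩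
      · rintro _ ⟨q, hq, rfl⟩ t ht
        exact ⟨t • q, smul_mem_simpleCone hq ht, map_smul _ _ _⟩
      · intro x hx
        obtain ⟨z, hz, rfl⟩ := Finset.mem_image.1 hx
        refine ⟨‖perp Y z‖⁻¹ • z, smul_mem_simpleCone
          (mem_simpleCone_of_mem (Finset.mem_sdiff.1 hz).1) (by positivity), ?_⟩
        rw [map_smul, unitPerp]
    exact fun h => key h
  · rintro ⟨q, hq, rfl⟩
    have key : simpleCone (Z : Set V) ⊆ {q | perp Y q ∈ simpleCone (linkFace Y Z : Set V)} := by
      refine simpleCone_subset_of_closed ?_ ?_ ?_ ?_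
      · simp [zero_mem_simpleCone]
      · intro v hv w hw
        simp only [mem_ofPred_eq, map_add] at *
        exact add_mem_simpleCone hv hw
      · intro v hv t ht
        simp only [mem_ofPred_eq, map_smul] at *
        exact smul_mem_simpleCone hv ht
      · intro x hx
        simp only [mem_ofPred_eq]
        by_cases hxY : x ∈ Y
        · rw [perp_eq_zero.2 (Submodule.subset_span hxY)]
          exact zero_mem_simpleCone _
        · rw [← norm_smul_unitPerp]
          exact smul_mem_simpleCone (mem_simpleCone_of_mem
            (Finset.mem_image_of_mem _ (Finset.mem_sdiff.2 ⟨hx, hxY⟩))) (norm_nonneg _)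
    exact key hq

theorem linkFace_mono {Y Z Z' : Finset V} (h : Z ⊆ Z') : linkFace Y Z ⊆ linkFace Y Z' :=
  Finset.image_subset_image (Finset.sdiff_subset_sdiff h (Finset.Subset.refl _))

theorem mem_faces_link {𝒳 : Finset (Finset V)} {Y F : Finset V} :
    F ∈ faces (link 𝒳 Y) ↔ ∃ Z ∈ faces 𝒳, Y ⊆ Z ∧ F = linkFace Y Z := by
  constructor
  · rintro ⟨G, hG, hFG⟩
    obtain ⟨X, hX, rfl⟩ := Finset.mem_image.1 hG
    rw [Finset.mem_filter] at hX
    obtain ⟨A, hA, rfl⟩ := Finset.subset_image_iff.1 hFG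
    have hA' : (A : Finset V) ⊆ X \ Y := by exact_mod_cast hA
    refine ⟨Y ∪ A, ⟨X, hX.1, Finset.union_subset hX.2 (hA'.trans Finset.sdiff_subset)⟩,
      Finset.subset_union_left, ?_⟩
    congr 1
    ext a
    simp only [Finset.mem_sdiff, Finset.mem_union]
    exact ⟨fun h => ⟨Or.inr h, (Finset.mem_sdiff.1 (hA' h)).2⟩, fun h => h.1.resolve_left h.2⟩
  · rintro ⟨Z, ⟨X, hX, hZX⟩, hYZ, rfl⟩
    exact ⟨linkFace Y X, Finset.mem_image_of_mem _ (Finset.mem_filter.2 ⟨hX, hYZ.trans hZX⟩),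
      linkFace_mono hZX⟩

/-- Two lifts of `v` to `C(Z₁)` and `C(Z₂)` differ by an element of `span Y`. After adding a large
multiple of a relative interior point of `C(Y)`, one and the same lift lies in both cones, and the
intersection axiom of `𝒳` applies to it. -/
theorem IsComplexCone.linkFace_inter {d : ℕ} {𝒳 : Finset (Finset V)} (h : IsComplexCone d 𝒳)
    {Y Z₁ Z₂ : Finset V} (h₁ : Z₁ ∈ faces 𝒳) (h₂ : Z₂ ∈ faces 𝒳) (hY₁ : Y ⊆ Z₁) (hY₂ : Y ⊆ Z₂)
    {v : V} (hv₁ : v ∈ simpleCone (linkFace Y Z₁ : Set V))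
    (hv₂ : v ∈ simpleCone (linkFace Y Z₂ : Set V)) :
    v ∈ simpleCone (linkFace Y (Z₁ ∩ Z₂) : Set V) := by
  obtain ⟨q₁, hq₁, rfl⟩ := mem_simpleCone_linkFace.1 hv₁
  obtain ⟨q₂, hq₂, hq⟩ := mem_simpleCone_linkFace.1 hv₂
  have hw := sum_mem_openCone Y
  have hu : q₁ - q₂ ∈ Submodule.span ℝ (Y : Set V) := by
    rw [← perp_eq_zero, map_sub, hq, sub_self]
  obtain ⟨l₁, hl₁⟩ := exists_add_smul_mem hY₁ hw hq₁ (Submodule.zero_mem _)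
  obtain ⟨l₂, hl₂⟩ := exists_add_smul_mem hY₂ hw hq₂ hu
  have e₁ := hl₁ _ (le_max_left l₁ l₂)
  have e₂ := hl₂ _ (le_max_right l₁ l₂)
  rw [add_zero] at e₁
  rw [add_sub_cancel] at e₂
  rw [mem_simpleCone_linkFace]
  exact ⟨_, h.inter h₁ h₂ e₁ e₂, by rw [map_add, perp_smul_of_mem_openCone hw, add_zero]⟩

theorem linkFace_self (Y : Finset V) : linkFace Y Y = ∅ := by simp [linkFace]

theorem simpleCone_empty : simpleCone (∅ : Set V) = {0} := by
  ext v
  simp [simpleCone]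

theorem IsGenerating.perp_ne_zero {Y Z : Finset V} (hZ : IsGenerating Z) (hYZ : Y ⊆ Z) {x : V}
    (hx : x ∈ Z \ Y) : perp Y x ≠ 0 := by
  rw [Finset.mem_sdiff] at hx
  intro h
  rw [perp_eq_zero] at h
  obtain ⟨c, -, hc⟩ := Submodule.mem_span_finset.1 h
  have h1 : ∑ z ∈ Z, (if z ∈ Y then c z else 0) • z =
      ∑ z ∈ Z, (if z = x then (1 : ℝ) else 0) • z := by
    symm
    rw [Finset.sum_eq_single_of_mem x hx.1 (fun b _ hb => by rw [if_neg hb, zero_smul]),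
      ← Finset.sum_subset hYZ (fun z _ hz => by rw [if_neg hz, zero_smul]), if_pos rfl, one_smul]
    refine hc.symm.trans ?_
    exact Finset.sum_congr rfl fun z hz => by rw [if_pos hz]
  have := hZ.coeff_unique h1 hx.1
  simp [hx.2] at this

theorem IsGenerating.norm_unitPerp {Y Z : Finset V} (hZ : IsGenerating Z) (hYZ : Y ⊆ Z) {x : V}
    (hx : x ∈ Z \ Y) : ‖unitPerp Y x‖ = 1 := by
  rw [unitPerp, norm_smul, norm_inv, norm_norm,
    inv_mul_cancel₀ (norm_ne_zero_iff.2 (hZ.perp_ne_zero hYZ hx))]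

/-- For distinct vertices the faces `Y ∪ {x₁}` and `Y ∪ {x₂}` meet in `Y`, whose link cone is `{0}`
and contains no unit vector. The two vertices may come from different faces, as is needed for
intersections in the link. -/
theorem IsComplexCone.unitPerp_injOn {d : ℕ} {𝒳 : Finset (Finset V)} (h : IsComplexCone d 𝒳)
    {Y Z₁ Z₂ : Finset V} (h₁ : Z₁ ∈ faces 𝒳) (h₂ : Z₂ ∈ faces 𝒳) (hY₁ : Y ⊆ Z₁) (hY₂ : Y ⊆ Z₂)
    {x₁ x₂ : V} (hx₁ : x₁ ∈ Z₁ \ Y) (hx₂ : x₂ ∈ Z₂ \ Y) (hx : unitPerp Y x₁ = unitPerp Y x₂) :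
    x₁ = x₂ := by
  by_contra hne
  have m₁ := Finset.mem_sdiff.1 hx₁
  have m₂ := Finset.mem_sdiff.1 hx₂
  have hv := h.linkFace_inter (faces_subset h₁ (Finset.insert_subset m₁.1 hY₁))
    (faces_subset h₂ (Finset.insert_subset m₂.1 hY₂)) (Finset.subset_insert _ _)
    (Finset.subset_insert _ _) (v := unitPerp Y x₁)
    (mem_simpleCone_of_mem (Finset.mem_image_of_mem _ (by simp [m₁.2])))
    (by rw [hx]; exact mem_simpleCone_of_mem (Finset.mem_image_of_mem _ (by simp [m₂.2])))
  have : insert x₁ Y ∩ insert x₂ Y = Y := by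
    ext a
    simp only [Finset.mem_inter, Finset.mem_insert]
    constructor
    · rintro ⟨rfl | h, rfl | h'⟩ <;> first | assumption | exact absurd rfl hne
    · exact fun h => ⟨Or.inr h, Or.inr h⟩
  rw [this, linkFace_self, Finset.coe_empty, simpleCone_empty, mem_singleton_iff] at hv
  have h1 := (h.isGenerating h₁).norm_unitPerp hY₁ hx₁
  rw [hv, norm_zero] at h1
  exact zero_ne_one h1

theorem IsComplexCone.card_linkFace {d : ℕ} {𝒳 : Finset (Finset V)} (h : IsComplexCone d 𝒳)
    {Y Z : Finset V} (hZ : Z ∈ faces 𝒳) (hYZ : Y ⊆ Z) :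
    (linkFace Y Z).card = Z.card - Y.card := by
  rw [linkFace, Finset.card_image_of_injOn, Finset.card_sdiff_of_subset hYZ]
  intro a ha b hb hab
  exact h.unitPerp_injOn hZ hZ hYZ hYZ ha hb hab

theorem IsComplexCone.linkFace_inter_eq {d : ℕ} {𝒳 : Finset (Finset V)} (h : IsComplexCone d 𝒳)
    {Y Z₁ Z₂ : Finset V} (h₁ : Z₁ ∈ faces 𝒳) (h₂ : Z₂ ∈ faces 𝒳) (hY₁ : Y ⊆ Z₁)
    (hY₂ : Y ⊆ Z₂) : linkFace Y (Z₁ ∩ Z₂) = linkFace Y Z₁ ∩ linkFace Y Z₂ := by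
  ext v
  simp only [linkFace, Finset.mem_image, Finset.mem_inter]
  constructor
  · rintro ⟨x, hx, rfl⟩
    rw [Finset.mem_sdiff, Finset.mem_inter] at hx
    exact ⟨⟨x, Finset.mem_sdiff.2 ⟨hx.1.1, hx.2⟩, rfl⟩,
      ⟨x, Finset.mem_sdiff.2 ⟨hx.1.2, hx.2⟩, rfl⟩⟩
  · rintro ⟨⟨x, hx, rfl⟩, ⟨x', hx', he⟩⟩
    obtain rfl := h.unitPerp_injOn h₂ h₁ hY₂ hY₁ hx' hx he
    rw [Finset.mem_sdiff] at hx hx'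
    exact ⟨x', Finset.mem_sdiff.2 ⟨Finset.mem_inter.2 ⟨hx.1, hx'.1⟩, hx.2⟩, rfl⟩

theorem IsComplexCone.isGenerating_linkFace {d : ℕ} {𝒳 : Finset (Finset V)}
    (h : IsComplexCone d 𝒳) {Y Z : Finset V} (hZ : Z ∈ faces 𝒳) (hYZ : Y ⊆ Z) :
    IsGenerating (linkFace Y Z) := by
  have hZ' := h.isGenerating hZ
  refine ⟨fun x hx => ?_, ?_⟩
  · obtain ⟨z, hz, rfl⟩ := Finset.mem_image.1 hx
    exact hZ'.norm_unitPerp hYZ hz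
  · rw [linearIndepOn_finset_iff]
    intro f hf v hv
    obtain ⟨z, hz, rfl⟩ := Finset.mem_image.1 hv
    rw [linkFace, Finset.sum_image (fun a ha b hb hab =>
      h.unitPerp_injOn hZ hZ hYZ hYZ ha hb hab)] at hf
    simp only [id] at hf
    have h1 : perp Y (∑ x ∈ Z \ Y, (f (unitPerp Y x) * ‖perp Y x‖⁻¹) • x) = 0 := by
      rw [map_sum, ← hf]
      refine Finset.sum_congr rfl fun x _ => ?_
      rw [map_smul, unitPerp, mul_smul]
    rw [perp_eq_zero] at h1
    obtain ⟨c, -, hc⟩ := Submodule.mem_span_finset.1 h1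
    have h2 : ∑ x ∈ Z, (if x ∈ Y then c x else 0) • x =
        ∑ x ∈ Z, (if x ∈ Y then 0 else f (unitPerp Y x) * ‖perp Y x‖⁻¹) • x := by
      rw [← Finset.sum_subset hYZ (fun z _ hz => by simp [hz]),
        ← Finset.sum_subset (Finset.sdiff_subset : Z \ Y ⊆ Z) (fun z hz hz' => by
          rw [Finset.mem_sdiff, not_and, not_not] at hz'
          simp [hz' hz])]
      calc ∑ x ∈ Y, (if x ∈ Y then c x else 0) • x = ∑ x ∈ Y, c x • x :=
            Finset.sum_congr rfl fun x hx => by simp [hx]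
        _ = _ := hc
        _ = _ := Finset.sum_congr rfl fun x hx => by simp [(Finset.mem_sdiff.1 hx).2]
    have h3 := hZ'.coeff_unique h2 (Finset.mem_sdiff.1 hz).1
    simp only [(Finset.mem_sdiff.1 hz).2, if_false] at h3
    have h4 := inv_ne_zero (norm_ne_zero_iff.2 (hZ'.perp_ne_zero hYZ hz))
    exact (mul_eq_zero.1 h3.symm).resolve_right h4

theorem IsComplexCone.link {d : ℕ} {𝒳 : Finset (Finset V)} (h : IsComplexCone d 𝒳)
    {Y : Finset V} (hY : Y ∈ faces 𝒳) : IsComplexCone (d - Y.card) (link 𝒳 Y) := by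
  refine ⟨?_, ?_, ?_⟩
  · obtain ⟨X, hX, hYX⟩ := hY
    exact ⟨linkFace Y X, Finset.mem_image_of_mem _ (Finset.mem_filter.2 ⟨hX, hYX⟩)⟩
  · intro F hF
    obtain ⟨X, hX, rfl⟩ := Finset.mem_image.1 hF
    rw [Finset.mem_filter] at hX
    refine ⟨h.isGenerating_linkFace (mem_faces hX.1) hX.2, ?_⟩
    rw [h.card_linkFace (mem_faces hX.1) hX.2, (h.2.1 X hX.1).2]
  · intro F₁ hF₁ F₂ hF₂
    obtain ⟨Z₁, h₁, hY₁, rfl⟩ := mem_faces_link.1 hF₁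
    obtain ⟨Z₂, h₂, hY₂, rfl⟩ := mem_faces_link.1 hF₂
    rw [← Finset.coe_inter, ← h.linkFace_inter_eq h₁ h₂ hY₁ hY₂]
    apply Subset.antisymm
    · rintro v ⟨hv₁, hv₂⟩
      exact h.linkFace_inter h₁ h₂ hY₁ hY₂ hv₁ hv₂
    · intro v hv
      exact ⟨simpleCone_mono (by exact_mod_cast linkFace_mono Finset.inter_subset_left) hv,
        simpleCone_mono (by exact_mod_cast linkFace_mono Finset.inter_subset_right) hv⟩

theorem bddAbove_angleSet (Z₁ Z₂ : Finset V) : BddAbove (angleSet Z₁ Z₂) := by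
  refine ⟨Real.pi, ?_⟩
  rintro θ ⟨z, -, f₁, -, f₂, -, -, -, rfl⟩
  exact EuclideanGeometry.angle_le_pi _ _ _

/-- A configuration in the link is translated by a large multiple of a relative interior point of
`C(Y)` into the original faces. Translation keeps the angle, and `z` remains a nearest point because
`perp Y` does not increase distances. -/
theorem IsComplexCone.angleSet_linkFace_subset {d : ℕ} {𝒳 : Finset (Finset V)}
    (h : IsComplexCone d 𝒳) {Y Z₁ Z₂ : Finset V} (h₁ : Z₁ ∈ faces 𝒳) (h₂ : Z₂ ∈ faces 𝒳)
    (hY₁ : Y ⊆ Z₁) (hY₂ : Y ⊆ Z₂) :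
    angleSet (linkFace Y Z₁) (linkFace Y Z₂) ⊆ angleSet Z₁ Z₂ := by
  rintro θ ⟨z, hz, f₁, ⟨hf₁, hf₁'⟩, f₂, ⟨hf₂, hf₂'⟩, hd₁, hd₂, rfl⟩
  have hY := Finset.subset_inter hY₁ hY₂
  simp only [← Finset.coe_inter, ← h.linkFace_inter_eq h₁ h₂ hY₁ hY₂] at hz hf₁' hf₂' hd₁ hd₂
  have hw := sum_mem_openCone Y
  set w := ∑ y ∈ Y, y
  have hmem : ∀ Z : Finset V, Y ⊆ Z → ∀ v, v ∈ simpleCone (linkFace Y Z : Set V) →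
      perp Y v = v ∧ ∃ l₀ : ℝ, ∀ l, l₀ ≤ l → v + l • w ∈ simpleCone (Z : Set V) := by
    intro Z hYZ v hv
    obtain ⟨q, hq, rfl⟩ := mem_simpleCone_linkFace.1 hv
    obtain ⟨l₀, hl₀⟩ := exists_add_smul_mem hYZ hw hq
      (Submodule.neg_mem _ (sub_perp_mem Y q))
    refine ⟨perp_eq_self.2 (perp_mem _ _), l₀, fun l hl => ?_⟩
    have := hl₀ l hl
    rwa [neg_sub, add_sub_cancel] at this
  obtain ⟨pz, lz, hlz⟩ := hmem _ hY z hz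
  obtain ⟨p₁, l₁, hl₁⟩ := hmem _ hY₁ f₁ hf₁
  obtain ⟨p₂, l₂, hl₂⟩ := hmem _ hY₂ f₂ hf₂
  obtain ⟨l, hle, hle₁, hle₂⟩ : ∃ l, lz ≤ l ∧ l₁ ≤ l ∧ l₂ ≤ l :=
    ⟨max lz (max l₁ l₂), le_max_left _ _, (le_max_left _ _).trans (le_max_right _ _),
      (le_max_right _ _).trans (le_max_right _ _)⟩
  have hnot : ∀ f, perp Y f = f → f ∉ simpleCone (linkFace Y (Z₁ ∩ Z₂) : Set V) →
      f + l • w ∉ simpleCone ((Z₁ ∩ Z₂ : Finset V) : Set V) := by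
    intro f hf hfn hmem
    apply hfn
    rw [mem_simpleCone_linkFace]
    exact ⟨_, hmem, by rw [map_add, perp_smul_of_mem_openCone hw, add_zero, hf]⟩
  have hdist : ∀ f, perp Y f = f →
      infDist f (simpleCone (linkFace Y (Z₁ ∩ Z₂) : Set V)) = dist f z →
      infDist (f + l • w) (simpleCone ((Z₁ ∩ Z₂ : Finset V) : Set V)) =
        dist (f + l • w) (z + l • w) := by
    intro f hf hfd
    refine le_antisymm (infDist_le_dist_of_mem (hlz l hle)) ?_
    rw [dist_add_right, ← hfd]
    refine (le_infDist ⟨0, zero_mem_simpleCone _⟩).2 fun c hc => ?_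
    have hpc : perp Y c ∈ simpleCone (linkFace Y (Z₁ ∩ Z₂) : Set V) :=
      mem_simpleCone_linkFace.2 ⟨c, hc, rfl⟩
    refine (infDist_le_dist_of_mem hpc).trans ?_
    have : f - perp Y c = perp Y (f + l • w - c) := by
      rw [map_sub, map_add, perp_smul_of_mem_openCone hw, add_zero, hf]
    rw [dist_eq_norm, dist_eq_norm, this]
    exact norm_perp_le _ _
  refine ⟨z + l • w, ?_, f₁ + l • w, ⟨hl₁ l hle₁, ?_⟩, f₂ + l • w, ⟨hl₂ l hle₂, ?_⟩, ?_, ?_, ?_⟩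
  all_goals try simp only [← Finset.coe_inter]
  · exact hlz l hle
  · exact hnot _ p₁ hf₁'
  · exact hnot _ p₂ hf₂'
  · exact hdist _ p₁ hd₁
  · exact hdist _ p₂ hd₂
  · simp [EuclideanGeometry.angle]

theorem NonFlat.link {d : ℕ} {𝒳 : Finset (Finset V)} (h : IsComplexCone d 𝒳)
    (hn : NonFlat d 𝒳) {Y : Finset V} : NonFlat (d - Y.card) (link 𝒳 Y) := by
  intro F hF hFd F₁ hF₁ F₂ hF₂ hF₁₂ hc₁ hc₂
  obtain ⟨Z, hZ, hYZ, rfl⟩ := mem_faces_link.1 hF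
  obtain ⟨Z₁, h₁, hY₁, rfl⟩ := mem_faces_link.1 hF₁
  obtain ⟨Z₂, h₂, hY₂, rfl⟩ := mem_faces_link.1 hF₂
  have hY := Finset.subset_inter hY₁ hY₂
  have h12 : Z₁ ∩ Z₂ ∈ faces 𝒳 := faces_subset h₁ Finset.inter_subset_left
  have hZ' : linkFace Y Z = linkFace Y (Z₁ ∩ Z₂) := by
    rw [h.linkFace_inter_eq h₁ h₂ hY₁ hY₂]
    exact_mod_cast hF₁₂
  rw [hZ', h.card_linkFace h12 hY] at hc₁ hc₂ hFd
  rw [h.card_linkFace h₁ hY₁] at hc₁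
  rw [h.card_linkFace h₂ hY₂] at hc₂
  have c := Finset.card_le_card hY
  have c₁ := Finset.card_le_card hY₁
  have c₂ := Finset.card_le_card hY₂
  have hlt := hn (Z₁ ∩ Z₂) h12 (by omega) Z₁ h₁ Z₂ h₂ (by rw [Finset.coe_inter]) (by omega)
    (by omega)
  rcases (angleSet (linkFace Y Z₁) (linkFace Y Z₂)).eq_empty_or_nonempty with he | he
  · rw [he, Real.sSup_empty]
    exact Real.pi_pos
  · exact (csSup_le_csSup (bddAbove_angleSet _ _) he
      (h.angleSet_linkFace_subset h₁ h₂ hY₁ hY₂)).trans_lt hlt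

end Links

/-! ### Local structure of cones and cylinders; absence of translational symmetry -/

section Tangents

open scoped Classical

variable {V : Type*} [NormedAddCommGroup V] [InnerProductSpace ℝ V]

theorem zero_mem_support {𝒳 : Finset (Finset V)} (h : 𝒳.Nonempty) : (0 : V) ∈ support 𝒳 := by
  obtain ⟨X, hX⟩ := h
  exact ⟨X, hX, zero_mem_simpleCone _⟩

theorem smul_mem_support {𝒳 : Finset (Finset V)} {v : V} (hv : v ∈ support 𝒳) {t : ℝ}
    (ht : 0 ≤ t) : t • v ∈ support 𝒳 := by
  obtain ⟨X, hX, hv⟩ := hv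
  exact ⟨X, hX, smul_mem_simpleCone hv ht⟩

theorem support_subset {𝒳 : Finset (Finset V)} {S : Submodule ℝ V}
    (h : ∀ X ∈ 𝒳, ∀ x ∈ X, x ∈ S) : support 𝒳 ⊆ S := by
  rintro v ⟨X, hX, hv⟩
  exact Submodule.span_le.2 (h X hX) (simpleCone_subset_span X hv)

theorem exists_carrier {𝒳 : Finset (Finset V)} {v : V} (hv : v ∈ support 𝒳) :
    ∃ F ∈ faces 𝒳, v ∈ openCone F := by
  obtain ⟨X, hX, hv⟩ := hv
  obtain ⟨F, hF, hvF⟩ := exists_mem_openCone hv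
  exact ⟨F, ⟨X, hX, hF⟩, hvF⟩

/-- The union of the sets `C(X) + span F` over the `X ∈ 𝒳` that contain `F`. -/
def starCone (𝒳 : Finset (Finset V)) (F : Finset V) : Set V :=
  {w | ∃ X ∈ 𝒳, F ⊆ X ∧ ∃ u ∈ Submodule.span ℝ (F : Set V), ∃ q ∈ simpleCone (X : Set V), w = u + q}

theorem mem_support_link {𝒳 : Finset (Finset V)} {F : Finset V} {v : V} :
    v ∈ support (link 𝒳 F) ↔ ∃ X ∈ 𝒳, F ⊆ X ∧ ∃ q ∈ simpleCone (X : Set V), perp F q = v := by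
  constructor
  · rintro ⟨G, hG, hv⟩
    obtain ⟨X, hX, rfl⟩ := Finset.mem_image.1 hG
    rw [Finset.mem_filter] at hX
    exact ⟨X, hX.1, hX.2, mem_simpleCone_linkFace.1 hv⟩
  · rintro ⟨X, hX, hFX, hv⟩
    exact ⟨linkFace F X, Finset.mem_image_of_mem _ (Finset.mem_filter.2 ⟨hX, hFX⟩),
      mem_simpleCone_linkFace.2 hv⟩

theorem perp_mem_support_link {𝒳 : Finset (Finset V)} {F : Finset V} {w : V}
    (hw : w ∈ starCone 𝒳 F) : perp F w ∈ support (link 𝒳 F) := by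
  obtain ⟨X, hX, hFX, u, hu, q, hq, rfl⟩ := hw
  rw [mem_support_link]
  exact ⟨X, hX, hFX, q, hq, by rw [map_add, perp_eq_zero.2 hu, zero_add]⟩

theorem smul_mem_starCone {𝒳 : Finset (Finset V)} {F : Finset V} {w : V}
    (hw : w ∈ starCone 𝒳 F) {t : ℝ} (ht : 0 ≤ t) : t • w ∈ starCone 𝒳 F := by
  obtain ⟨X, hX, hFX, u, hu, q, hq, rfl⟩ := hw
  exact ⟨X, hX, hFX, t • u, Submodule.smul_mem _ _ hu, t • q, smul_mem_simpleCone hq ht,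
    smul_add _ _ _⟩

variable [FiniteDimensional ℝ V]

/-- Coordinates indexed by `F` are positive at `b` and remain so nearby; the other coordinates come
from `q` alone and are nonnegative. -/
theorem IsGenerating.eventually_add_mem {X F : Finset V} (hX : IsGenerating X) (hFX : F ⊆ X)
    {b : V} (hb : b ∈ openCone F) :
    ∀ᶠ w in 𝓝 (0 : V), ∀ u ∈ Submodule.span ℝ (F : Set V), ∀ q ∈ simpleCone (X : Set V),
      w = u + q → b + w ∈ simpleCone (X : Set V) := by
  choose φ hφ using fun y => hX.exists_coord y
  obtain ⟨c, hc, rfl⟩ := hb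
  have hval : ∀ (e : V → ℝ) (x : V), x ∈ X → φ x (∑ y ∈ F, e y • y) = if x ∈ F then e x else 0 := by
    intro e x hx
    have : ∑ y ∈ F, e y • y = ∑ y ∈ X, (if y ∈ F then e y else 0) • y := by
      rw [← Finset.sum_subset hFX (fun z _ hz => by rw [if_neg hz, zero_smul])]
      exact Finset.sum_congr rfl fun z hz => by rw [if_pos hz]
    rw [this, hφ x _ hx]
  have hev : ∀ᶠ w in 𝓝 (0 : V), ∀ y ∈ F, 0 < φ y (∑ y ∈ F, c y • y + w) := by
    refine (Finset.eventually_all F).2 fun y hy => ?_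
    have hcont : Continuous fun w => φ y (∑ y ∈ F, c y • y + w) :=
      (LinearMap.continuous_of_finiteDimensional (φ y)).comp (continuous_const.add continuous_id)
    refine hcont.continuousAt.eventually (lt_mem_nhds ?_)
    simp only [add_zero]
    rw [hval c y (hFX hy), if_pos hy]
    exact hc y hy
  filter_upwards [hev] with w hw u hu q hq hwuq
  obtain ⟨e, -, rfl⟩ := Submodule.mem_span_finset.1 hu
  obtain ⟨f, hf, rfl⟩ := mem_simpleCone_finset.1 hq
  have hspan : ∑ y ∈ F, c y • y + w ∈ Submodule.span ℝ (X : Set V) := by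
    rw [hwuq]
    refine Submodule.add_mem _ ?_ (Submodule.add_mem _ ?_ ?_)
    · exact Submodule.sum_mem _ fun x hx =>
        Submodule.smul_mem _ _ (Submodule.subset_span (hFX hx))
    · exact Submodule.sum_mem _ fun x hx =>
        Submodule.smul_mem _ _ (Submodule.subset_span (hFX hx))
    · exact Submodule.sum_mem _ fun x hx => Submodule.smul_mem _ _ (Submodule.subset_span hx)
  obtain ⟨g, -, hg⟩ := Submodule.mem_span_finset.1 hspan
  refine mem_simpleCone_finset.2 ⟨g, fun x hx => ?_, hg⟩
  rw [← hφ x g hx, hg]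
  by_cases hxF : x ∈ F
  · exact (hw x hxF).le
  · rw [hwuq, map_add, map_add, hval c x hx, hval e x hx, hφ x f hx, if_neg hxF, if_neg hxF]
    simpa using hf x hx

/-- A closed cone `C(X)` with `F ⊄ X` misses `b`, by `carrier_subset`, hence a neighbourhood of `b`.
Only the cones containing the face `F` matter near `b`. -/
theorem IsComplexCone.eventually_mem_support {d : ℕ} {𝒳 : Finset (Finset V)}
    (h : IsComplexCone d 𝒳) {F : Finset V} (hF : F ∈ faces 𝒳) {b : V} (hb : b ∈ openCone F) :
    ∀ᶠ w in 𝓝 (0 : V), b + w ∈ support 𝒳 ↔ w ∈ starCone 𝒳 F := by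
  have h1 : ∀ᶠ w in 𝓝 (0 : V), ∀ X ∈ 𝒳, ¬ F ⊆ X → b + w ∉ simpleCone (X : Set V) := by
    refine (Finset.eventually_all 𝒳).2 fun X hX => ?_
    by_cases hFX : F ⊆ X
    · exact Eventually.of_forall fun w hw => absurd hFX hw
    · have hopen := (h.2.1 X hX).1.isClosed_simpleCone.isOpen_compl
      have hcont : ContinuousAt (fun w : V => b + w) 0 :=
        (continuous_const.add continuous_id).continuousAt
      have := hcont.eventually (hopen.mem_nhds (x := b + 0) (by
        rw [add_zero]
        exact fun hbX => hFX (h.carrier_subset (mem_faces hX) hF hb hbX)))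
      filter_upwards [this] with w hw _
      exact hw
  have h2 : ∀ᶠ w in 𝓝 (0 : V), ∀ X ∈ 𝒳, F ⊆ X → ∀ u ∈ Submodule.span ℝ (F : Set V),
      ∀ q ∈ simpleCone (X : Set V), w = u + q → b + w ∈ simpleCone (X : Set V) := by
    refine (Finset.eventually_all 𝒳).2 fun X hX => ?_
    by_cases hFX : F ⊆ X
    · filter_upwards [(h.2.1 X hX).1.eventually_add_mem hFX hb] with w hw _
      exact hw
    · exact Eventually.of_forall fun w hw => absurd hw hFX
  filter_upwards [h1, h2] with w hw1 hw2
  constructor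
  · rintro ⟨X, hX, hbw⟩
    have hFX : F ⊆ X := by
      by_contra hFX
      exact hw1 X hX hFX hbw
    exact ⟨X, hX, hFX, -b, Submodule.neg_mem _ (simpleCone_subset_span F (openCone_subset F hb)),
      b + w, hbw, by abel⟩
  · rintro ⟨X, hX, hFX, u, hu, q, hq, hw⟩
    exact ⟨X, hX, hw2 X hX hFX u hu q hq hw⟩

/-- A non-flat complex cone is not invariant under any non-trivial translation. -/
theorem NonFlat.eq_zero_of_invariant {d : ℕ} {𝒳 : Finset (Finset V)} (h : IsComplexCone d 𝒳)
    (hn : NonFlat d 𝒳) {v : V} (hv : ∀ w, w ∈ support 𝒳 ↔ w + v ∈ support 𝒳) : v = 0 := by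
  have h0 := zero_mem_support h.1
  -- The support is a cone, so invariance under `v` passes to all positive multiples of `v`.
  have hscale : ∀ (w : V) (t : ℝ), 0 < t → (w ∈ support 𝒳 ↔ w + t • v ∈ support 𝒳) := by
    have hs : ∀ (w : V) (t : ℝ), 0 < t → (t • w ∈ support 𝒳 ↔ w ∈ support 𝒳) := fun w t ht =>
      ⟨fun hw => by simpa [smul_smul, inv_mul_cancel₀ ht.ne'] using
        smul_mem_support hw (inv_pos.2 ht).le, fun hw => smul_mem_support hw ht.le⟩
    intro w t ht
    rw [← hs w t⁻¹ (inv_pos.2 ht), hv, ← hs (t⁻¹ • w + v) t ht, smul_add, smul_smul,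
      mul_inv_cancel₀ ht.ne', one_smul]
  -- At every face of codimension one, `v` must be tangent to the face. Otherwise the
  -- one-dimensional link contains the rays of `perp F v` and of its negative, which form the angle
  -- `π`.
  have key : ∀ F ∈ faces 𝒳, F.card + 1 = d → v ∈ Submodule.span ℝ (F : Set V) := by
    intro F hF hFd
    have hmem : ∀ s : ℝ, (s = 1 ∨ s = -1) → s • v ∈ starCone 𝒳 F := by
      intro s hs
      have hb := sum_mem_openCone F
      set b := ∑ y ∈ F, y
      have hbT : b ∈ support 𝒳 := by
        obtain ⟨X, hX, hFX⟩ := hF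
        exact ⟨X, hX, simpleCone_mono (by exact_mod_cast hFX) (openCone_subset F hb)⟩
      have hev := h.eventually_mem_support hF hb
      have htend : Tendsto (fun t : ℝ => t • s • v) (𝓝[>] 0) (𝓝 0) := by
        have : ContinuousAt (fun t : ℝ => t • s • v) 0 := by fun_prop
        simpa using this.tendsto.mono_left nhdsWithin_le_nhds
      obtain ⟨t, ht, ht0⟩ := ((htend.eventually hev).and self_mem_nhdsWithin).exists
      have ht0 : 0 < t := ht0
      have h1 : b + t • s • v ∈ support 𝒳 := by
        rcases hs with rfl | rfl
        · rw [one_smul, ← hscale b t ht0]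
          exact hbT
        · rw [hscale _ t ht0]
          simpa using hbT
      have h2 := smul_mem_starCone (ht.1 h1) (inv_pos.2 ht0).le
      rwa [smul_smul, inv_mul_cancel₀ ht0.ne', one_smul] at h2
    by_contra hvF
    have he : perp F v ≠ 0 := fun h' => hvF (perp_eq_zero.1 h')
    have hl := h.link hF
    have hnl := hn.link h (Y := F)
    rw [show d - F.card = 1 by omega] at hl hnl
    obtain ⟨G, hG, hvG⟩ := perp_mem_support_link (hmem 1 (Or.inl rfl))
    obtain ⟨G', hG', hvG'⟩ := perp_mem_support_link (hmem (-1) (Or.inr rfl))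
    obtain ⟨g, rfl⟩ := Finset.card_eq_one.1 (hl.2.1 G hG).2
    obtain ⟨g', rfl⟩ := Finset.card_eq_one.1 (hl.2.1 G' hG').2
    obtain ⟨c, hc, hcv⟩ := mem_simpleCone_finset.1 hvG
    obtain ⟨c', hc', hcv'⟩ := mem_simpleCone_finset.1 hvG'
    rw [Finset.sum_singleton] at hcv hcv'
    have hc := hc g (Finset.mem_singleton_self g)
    have hc' := hc' g' (Finset.mem_singleton_self g')
    have ng : ‖g‖ = 1 := (hl.2.1 _ hG).1.1 g (Finset.mem_singleton_self g)
    have ng' : ‖g'‖ = 1 := (hl.2.1 _ hG').1.1 g' (Finset.mem_singleton_self g')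
    rw [one_smul] at hcv
    rw [neg_smul, one_smul, map_neg, ← hcv] at hcv'
    have hcc : c' g' = c g := by
      have := congrArg norm hcv'
      rwa [norm_smul, norm_neg, norm_smul, ng, ng', mul_one, mul_one, Real.norm_of_nonneg hc,
        Real.norm_of_nonneg hc'] at this
    have hcne : c g ≠ 0 := by
      intro h0
      rw [h0, zero_smul] at hcv
      exact he hcv.symm
    have hgg : g' = -g := by
      rw [hcc, ← smul_neg] at hcv'
      exact smul_right_injective V hcne hcv'
    have gne : g ≠ 0 := fun h0 => by rw [h0, norm_zero] at ng; exact zero_ne_one ng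
    have g'ne : g' ≠ 0 := fun h0 => by rw [h0, norm_zero] at ng'; exact zero_ne_one ng'
    have hne : g ≠ g' := by
      rw [hgg]
      intro hg
      apply gne
      have h2 : (2 : ℝ) • g = 0 := by rw [two_smul]; nth_rewrite 1 [hg]; exact neg_add_cancel g
      exact (smul_eq_zero.1 h2).resolve_left two_ne_zero
    have hint : ((({g} : Finset V) : Set V) ∩ (({g'} : Finset V) : Set V)) = ∅ := by
      simp [Ne.symm hne]
    have hlt := hnl ∅ ⟨{g}, hG, Finset.empty_subset _⟩ (by simp) {g} (mem_faces hG) {g'}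
      (mem_faces hG') (by rw [hint]; simp) (by simp) (by simp)
    have hpi : Real.pi ∈ angleSet ({g} : Finset V) {g'} := by
      rw [angleSet, hint, simpleCone_empty]
      refine ⟨0, rfl, g, ⟨mem_simpleCone_of_mem (Finset.mem_singleton_self g), gne⟩,
        g', ⟨mem_simpleCone_of_mem (Finset.mem_singleton_self g'), g'ne⟩, infDist_singleton,
        infDist_singleton, ?_⟩
      rw [EuclideanGeometry.angle, hgg]
      simp [InnerProductGeometry.angle_self_neg_of_nonzero gne]
    exact absurd (le_csSup (bddAbove_angleSet _ _) hpi) (not_le.2 hlt)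
  -- Now `v` lies in some `C(X)` and in the span of every `X.erase x`, so each of its coefficients
  -- vanishes.
  have hvT : v ∈ support 𝒳 := by simpa using (hv 0).1 h0
  obtain ⟨X, hX, hvX⟩ := hvT
  obtain ⟨c, -, hc⟩ := mem_simpleCone_finset.1 hvX
  rw [← hc]
  refine Finset.sum_eq_zero fun x hx => ?_
  have hsub : X.erase x ⊆ X := Finset.erase_subset _ _
  have hm := key (X.erase x) ⟨X, hX, hsub⟩ (by
    rw [Finset.card_erase_add_one hx, (h.2.1 X hX).2])
  obtain ⟨e, -, he⟩ := Submodule.mem_span_finset.1 hm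
  have h1 : ∑ y ∈ X, c y • y = ∑ y ∈ X, (if y = x then 0 else e y) • y := by
    rw [hc, ← he, ← Finset.sum_subset hsub (fun z hz hz' => by
      rw [Finset.mem_erase, not_and'] at hz'
      rw [if_pos (not_not.1 (hz' hz)), zero_smul])]
    exact Finset.sum_congr rfl fun z hz => by rw [if_neg (Finset.ne_of_mem_erase hz)]
  have := (h.2.1 X hX).1.coeff_unique h1 hx
  rw [this, if_pos rfl, zero_smul]

/-- The set `p + P + T`. -/
def cylinder (p : V) (P : Submodule ℝ V) (T : Set V) : Set V :=
  {v | ∃ a ∈ P, ∃ b ∈ T, v = p + a + b}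

theorem mem_cylinder {p : V} {P : Submodule ℝ V} {T : Set V} (hT : T ⊆ Pᗮ) {v : V} :
    v ∈ cylinder p P T ↔ Pᗮ.starProjection (v - p) ∈ T := by
  constructor
  · rintro ⟨a, ha, b, hb, rfl⟩
    have : p + a + b - p = a + b := by abel
    rw [this, map_add, Submodule.starProjection_eq_self_iff.2 (hT hb),
      (Submodule.starProjection_apply_eq_zero_iff Pᗮ).2 (by
        rwa [Submodule.orthogonal_orthogonal]), zero_add]
    exact hb
  · intro h
    refine ⟨(v - p) - Pᗮ.starProjection (v - p), ?_, _, h, by abel⟩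
    have := Submodule.sub_starProjection_mem_orthogonal (K := Pᗮ) (v - p)
    rwa [Submodule.orthogonal_orthogonal] at this

theorem isClosed_cylinder {p : V} {P : Submodule ℝ V} {T : Set V} (hT : T ⊆ Pᗮ)
    (hc : IsClosed T) : IsClosed (cylinder p P T) := by
  have : cylinder p P T = (fun v => Pᗮ.starProjection (v - p)) ⁻¹' T := by
    ext v
    exact mem_cylinder hT
  rw [this]
  exact hc.preimage (by fun_prop)

/-- `W` coincides near `x` with `x + K`, where `K` is a cone. -/
structure IsTangent (W : Set V) (x : V) (K : Set V) : Prop where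
  smul_mem : ∀ v ∈ K, ∀ t : ℝ, 0 < t → t • v ∈ K
  zero_mem : (0 : V) ∈ K
  eventually : ∀ᶠ v in 𝓝 (0 : V), x + v ∈ W ↔ v ∈ K

/-- `W = p + P + T`, where `P` is a subspace of dimension `m` and `T` is the complex cone of
dimension `n - m` presented by `𝒳`, which is non-flat and contained in a subspace of dimension at
most `N'` orthogonal to `P`. -/
structure IsCylinder (n N' m : ℕ) (W : Set V) (p : V) (P : Submodule ℝ V)
    (𝒳 : Finset (Finset V)) : Prop where
  le : m ≤ n
  cone : IsComplexCone (n - m) 𝒳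
  nonFlat : NonFlat (n - m) 𝒳
  finrank_eq : Module.finrank ℝ P = m
  exists_subspace : ∃ S : Submodule ℝ V, Module.finrank ℝ S ≤ N' ∧ S ≤ Pᗮ ∧
    ∀ X ∈ 𝒳, ∀ x ∈ X, x ∈ S
  eq_cylinder : W = cylinder p P (support 𝒳)

variable {n N' m : ℕ} {W : Set V} {p : V} {P : Submodule ℝ V} {𝒳 : Finset (Finset V)}

theorem IsCylinder.support_subset (h : IsCylinder n N' m W p P 𝒳) : support 𝒳 ⊆ Pᗮ := by
  obtain ⟨S, -, hSP, hS⟩ := h.exists_subspace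
  exact (ConeStrata.support_subset hS).trans hSP

theorem IsCylinder.face_subset (h : IsCylinder n N' m W p P 𝒳) {F : Finset V}
    (hF : F ∈ faces 𝒳) : ∀ x ∈ F, x ∈ Pᗮ := by
  obtain ⟨S, -, hSP, hS⟩ := h.exists_subspace
  obtain ⟨X, hX, hFX⟩ := hF
  exact fun x hx => hSP (hS X hX x (hFX hx))

theorem skeleton_subset_support (k : ℕ) : skeleton 𝒳 k ⊆ support 𝒳 := by
  rintro v ⟨Y, ⟨X, hX, hYX⟩, -, hv⟩
  exact ⟨X, hX, simpleCone_mono (by exact_mod_cast hYX) hv⟩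

theorem IsCylinder.isClosed (h : IsCylinder n N' m W p P 𝒳) : IsClosed W := by
  rw [h.eq_cylinder]
  exact isClosed_cylinder h.support_subset h.cone.isClosed_support

/-- This recovers `P` from the set `W` alone, and with it the type as a dimension. The projection to
`Pᗮ` of an invariant translation leaves the non-flat cone invariant, so it is zero. -/
theorem IsCylinder.mem_of_invariant (h : IsCylinder n N' m W p P 𝒳) {v : V} :
    (∀ w, w ∈ W ↔ w + v ∈ W) ↔ v ∈ P := by
  constructor
  · intro hv
    have h0 : Pᗮ.starProjection v = 0 := by
      refine h.nonFlat.eq_zero_of_invariant h.cone fun w => ?_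
      by_cases hw : w ∈ Pᗮ
      · have h1 := hv (p + w)
        rw [h.eq_cylinder, mem_cylinder h.support_subset, mem_cylinder h.support_subset] at h1
        have e1 : p + w - p = w := by abel
        have e2 : p + w + v - p = w + v := by abel
        rwa [e1, e2, map_add, Submodule.starProjection_eq_self_iff.2 hw] at h1
      -- For `w` outside `Pᗮ` neither `w` nor its translate lies in the cone, so the equivalence is
      -- vacuous.
      · constructor
        · exact fun h' => absurd (h.support_subset h') hw
        · intro h'
          have := Submodule.sub_mem _ (h.support_subset h')
            (Submodule.starProjection_apply_mem Pᗮ v)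
          rw [add_sub_cancel_right] at this
          exact absurd this hw
    rwa [Submodule.starProjection_apply_eq_zero_iff, Submodule.orthogonal_orthogonal] at h0
  · intro hv w
    rw [h.eq_cylinder, mem_cylinder h.support_subset, mem_cylinder h.support_subset]
    have e : w + v - p = (w - p) + v := by abel
    rw [e, map_add, (Submodule.starProjection_apply_eq_zero_iff Pᗮ (v := v)).2
      (by rwa [Submodule.orthogonal_orthogonal]), add_zero]

theorem cylinder_starCone (P : Submodule ℝ V) (𝒳 : Finset (Finset V)) (F : Finset V) :
    cylinder 0 P (starCone 𝒳 F) =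
      cylinder 0 (P ⊔ Submodule.span ℝ (F : Set V)) (support (link 𝒳 F)) := by
  ext v
  constructor
  · rintro ⟨a, ha, b, hb, rfl⟩
    refine ⟨a + (b - perp F b), Submodule.add_mem_sup ha (sub_perp_mem F b), perp F b,
      perp_mem_support_link hb, by abel⟩
  · rintro ⟨a, ha, b, hb, rfl⟩
    obtain ⟨X, hX, hFX, q, hq, rfl⟩ := mem_support_link.1 hb
    obtain ⟨a₁, ha₁, u, hu, rfl⟩ := Submodule.mem_sup.1 ha
    exact ⟨a₁, ha₁, u - (q - perp F q) + q,
      ⟨X, hX, hFX, _, Submodule.sub_mem _ hu (sub_perp_mem F q), q, hq, rfl⟩, by abel⟩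

/-- The tangent cone of `p + P + T` at the points `p + a + b`, with `a ∈ P` and `b` in the relative
interior of `C(F)`. -/
def tangentCone (P : Submodule ℝ V) (𝒳 : Finset (Finset V)) (F : Finset V) : Set V :=
  cylinder 0 (P ⊔ Submodule.span ℝ (F : Set V)) (support (link 𝒳 F))

/-- Directions in `P` split off, and the orthogonal projection to `Pᗮ` reduces the claim to the
local form of the cone at `b`. -/
theorem IsCylinder.isTangent (h : IsCylinder n N' m W p P 𝒳) {a b : V} (ha : a ∈ P)
    {F : Finset V} (hF : F ∈ faces 𝒳) (hb : b ∈ openCone F) :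
    IsTangent W (p + a + b) (tangentCone P 𝒳 F) := by
  have hFP := h.face_subset hF
  have hspan : Submodule.span ℝ (F : Set V) ≤ Pᗮ := Submodule.span_le.2 hFP
  have hbP : b ∈ Pᗮ := hspan (simpleCone_subset_span F (openCone_subset F hb))
  have hstar : starCone 𝒳 F ⊆ Pᗮ := by
    rintro w ⟨X, hX, hFX, u, hu, q, hq, rfl⟩
    exact Submodule.add_mem _ (hspan hu) (h.support_subset ⟨X, hX, hq⟩)
  rw [tangentCone, ← cylinder_starCone]
  refine ⟨?_, ?_, ?_⟩
  · rintro v ⟨a, ha, b, hb, rfl⟩ t ht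
    exact ⟨t • a, Submodule.smul_mem _ _ ha, t • b, smul_mem_starCone hb ht.le, by
      simp [smul_add]⟩
  · refine ⟨0, Submodule.zero_mem _, 0, ?_, by simp⟩
    obtain ⟨X, hX, hFX⟩ := hF
    exact ⟨X, hX, hFX, 0, Submodule.zero_mem _, 0, zero_mem_simpleCone _, by simp⟩
  · have hev := h.cone.eventually_mem_support hF hb
    have hcont : Tendsto (fun v : V => Pᗮ.starProjection v) (𝓝 0) (𝓝 0) := by
      have := Pᗮ.starProjection.continuous.tendsto 0
      rwa [map_zero] at this
    filter_upwards [hcont.eventually hev] with v hv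
    rw [h.eq_cylinder, mem_cylinder h.support_subset, mem_cylinder hstar, sub_zero, ← hv]
    have e : p + a + b + v - p = a + (b + v) := by abel
    rw [e, map_add, map_add, Submodule.starProjection_eq_self_iff.2 hbP,
      (Submodule.starProjection_apply_eq_zero_iff Pᗮ).2 (by rwa [Submodule.orthogonal_orthogonal]),
      zero_add]

/-- The span of `F` is orthogonal to `P` and has dimension `#F`, so the type rises by exactly `#F`.
The link stays in the part of `S` orthogonal to `F`, which preserves the bound `N'`. -/
theorem IsCylinder.isCylinder_tangentCone (h : IsCylinder n N' m W p P 𝒳)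
    {F : Finset V} (hF : F ∈ faces 𝒳) :
    IsCylinder n N' (m + F.card) (tangentCone P 𝒳 F) 0 (P ⊔ Submodule.span ℝ (F : Set V))
      (link 𝒳 F) := by
  have hcard := h.cone.card_le hF
  have hle := h.le
  have hspan : Submodule.span ℝ (F : Set V) ≤ Pᗮ := Submodule.span_le.2 (h.face_subset hF)
  have hsub : n - (m + F.card) = n - m - F.card := by omega
  refine ⟨by omega, ?_, ?_, ?_, ?_, rfl⟩
  · rw [hsub]
    exact h.cone.link hF
  · rw [hsub]
    exact h.nonFlat.link h.cone
  · have hdisj : P ⊓ Submodule.span ℝ (F : Set V) = ⊥ := by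
      rw [eq_bot_iff]
      exact (inf_le_inf_left P hspan).trans (Submodule.inf_orthogonal_eq_bot P).le
    have h1 := Submodule.finrank_sup_add_finrank_inf_eq P (Submodule.span ℝ (F : Set V))
    rw [hdisj, finrank_bot, add_zero, h.finrank_eq] at h1
    rw [h1, finrank_span_finset_eq_card]
    exact (h.cone.isGenerating hF).2
  · obtain ⟨S, hS, hSP, hXS⟩ := h.exists_subspace
    refine ⟨S ⊓ (Submodule.span ℝ (F : Set V))ᗮ,
      (Submodule.finrank_mono inf_le_left).trans hS, ?_, ?_⟩
    · rw [← Submodule.inf_orthogonal]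
      exact inf_le_inf_right _ hSP
    · intro G hG x hx
      obtain ⟨X, hX, rfl⟩ := Finset.mem_image.1 hG
      obtain ⟨z, hz, rfl⟩ := Finset.mem_image.1 hx
      rw [Finset.mem_filter] at hX
      have hFS : Submodule.span ℝ (F : Set V) ≤ S :=
        Submodule.span_le.2 fun y hy => hXS X hX.1 y (hX.2 hy)
      refine ⟨?_, Submodule.smul_mem _ _ (perp_mem F z)⟩
      refine Submodule.smul_mem _ _ ?_
      have := Submodule.sub_mem _ (hXS X hX.1 z (Finset.mem_sdiff.1 hz).1)
        (hFS (sub_perp_mem F z))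
      rwa [sub_sub_cancel] at this

end Tangents

/-! ### Transport of cones along linear isometries -/

section Transport

open scoped Classical

variable {V₁ V₂ : Type*} [NormedAddCommGroup V₁] [InnerProductSpace ℝ V₁]
  [NormedAddCommGroup V₂] [InnerProductSpace ℝ V₂] (J : V₁ →ₗᵢ[ℝ] V₂)

/-- The image of a family of finite sets. -/
noncomputable def imageFamily (𝒳 : Finset (Finset V₁)) : Finset (Finset V₂) :=
  𝒳.image (Finset.image J)

theorem simpleCone_image (X : Set V₁) : simpleCone (J '' X) = J '' simpleCone X := by
  have hc : convexHull ℝ (J '' X) = J '' convexHull ℝ X :=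
    (LinearMap.image_convexHull J.toLinearMap X).symm
  ext v
  constructor
  · rintro (rfl | ⟨t, ht, y, hy, rfl⟩)
    · exact ⟨0, zero_mem_simpleCone _, map_zero J⟩
    · rw [hc] at hy
      obtain ⟨y, hy, rfl⟩ := hy
      exact ⟨t • y, Or.inr ⟨t, ht, y, hy, rfl⟩, map_smul J t y⟩
  · rintro ⟨_, rfl | ⟨t, ht, y, hy, rfl⟩, rfl⟩
    · rw [map_zero]
      exact zero_mem_simpleCone _
    · rw [map_smul]
      exact Or.inr ⟨t, ht, J y, by rw [hc]; exact mem_image_of_mem _ hy, rfl⟩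

theorem mem_faces_imageFamily {𝒳 : Finset (Finset V₁)} {F : Finset V₂} :
    F ∈ faces (imageFamily J 𝒳) ↔ ∃ G ∈ faces 𝒳, F = G.image J := by
  constructor
  · rintro ⟨X, hX, hF⟩
    obtain ⟨Z, hZ, rfl⟩ := Finset.mem_image.1 hX
    obtain ⟨A, hA, rfl⟩ := Finset.subset_image_iff.1 hF
    exact ⟨A, ⟨Z, hZ, by exact_mod_cast hA⟩, rfl⟩
  · rintro ⟨G, ⟨X, hX, hG⟩, rfl⟩
    exact ⟨X.image J, Finset.mem_image_of_mem _ hX, Finset.image_subset_image hG⟩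

theorem coe_image_inter (F₁ F₂ : Finset V₁) :
    ((F₁.image J : Finset V₂) : Set V₂) ∩ ((F₂.image J : Finset V₂) : Set V₂) =
      J '' ((F₁ : Set V₁) ∩ F₂) := by
  rw [Finset.coe_image, Finset.coe_image, image_inter J.injective]

theorem isGenerating_image {X : Finset V₁} : IsGenerating (X.image J) ↔ IsGenerating X := by
  unfold IsGenerating
  refine and_congr ?_ ?_
  · simp
  · rw [linearIndepOn_finset_iff, linearIndepOn_finset_iff]
    have hsum : ∀ f : V₂ → ℝ, ∑ i ∈ X.image J, f i • id i = J (∑ i ∈ X, f (J i) • id i) := by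
      intro f
      rw [Finset.sum_image (fun a _ b _ hab => J.injective hab)]
      simp
    constructor
    · intro h f hf x hx
      have := h (fun v => f (Function.invFun J v)) (by
        rw [hsum]
        simp only [Function.leftInverse_invFun J.injective _]
        rw [hf, map_zero]) (J x) (Finset.mem_image_of_mem _ hx)
      rwa [Function.leftInverse_invFun J.injective] at this
    · intro h f hf x hx
      obtain ⟨y, hy, rfl⟩ := Finset.mem_image.1 hx
      rw [hsum, ← map_zero J] at hf
      exact h (fun v => f (J v)) (J.injective hf) y hy

theorem isComplexCone_imageFamily {d : ℕ} {𝒳 : Finset (Finset V₁)} :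
    IsComplexCone d (imageFamily J 𝒳) ↔ IsComplexCone d 𝒳 := by
  unfold IsComplexCone
  refine and_congr ?_ (and_congr ?_ ?_)
  · simp [imageFamily]
  · simp only [imageFamily, Finset.forall_mem_image, isGenerating_image,
      Finset.card_image_of_injective _ J.injective]
  · have key : ∀ X Y : Finset V₁,
        (simpleCone ((X.image J : Finset V₂) : Set V₂) ∩ simpleCone ((Y.image J : Finset V₂) : Set V₂) =
          simpleCone (((X.image J : Finset V₂) : Set V₂) ∩ ((Y.image J : Finset V₂) : Set V₂))) ↔
        simpleCone (X : Set V₁) ∩ simpleCone (Y : Set V₁) = simpleCone ((X : Set V₁) ∩ Y) := by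
      intro X Y
      rw [coe_image_inter, Finset.coe_image, Finset.coe_image, simpleCone_image, simpleCone_image,
        simpleCone_image, ← image_inter J.injective]
      exact (image_injective.2 J.injective).eq_iff
    constructor
    · intro h X hX Y hY
      exact (key X Y).1 (h _ ((mem_faces_imageFamily J).2 ⟨X, hX, rfl⟩) _
        ((mem_faces_imageFamily J).2 ⟨Y, hY, rfl⟩))
    · intro h X hX Y hY
      obtain ⟨X', hX', rfl⟩ := (mem_faces_imageFamily J).1 hX
      obtain ⟨Y', hY', rfl⟩ := (mem_faces_imageFamily J).1 hY
      exact (key X' Y').2 (h X' hX' Y' hY')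

theorem angleSet_image (F₁ F₂ : Finset V₁) :
    angleSet (F₁.image J) (F₂.image J) = angleSet F₁ F₂ := by
  have hangle : ∀ a b c : V₁, EuclideanGeometry.angle (J a) (J b) (J c) =
      EuclideanGeometry.angle a b c := by
    intro a b c
    simp only [EuclideanGeometry.angle, vsub_eq_sub, ← map_sub, LinearIsometry.angle_map]
  unfold angleSet
  rw [coe_image_inter, Finset.coe_image, Finset.coe_image, simpleCone_image, simpleCone_image,
    simpleCone_image]
  have hmem : ∀ (S : Set V₁) (v : V₁), J v ∈ J '' S ↔ v ∈ S := fun S v =>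
    J.injective.mem_set_image
  ext θ
  constructor
  · rintro ⟨_, ⟨z, hz, rfl⟩, _, ⟨⟨f₁, hf₁, rfl⟩, hf₁'⟩, _, ⟨⟨f₂, hf₂, rfl⟩, hf₂'⟩, h₁, h₂, rfl⟩
    rw [infDist_image J.isometry, J.isometry.dist_eq] at h₁ h₂
    exact ⟨z, hz, f₁, ⟨hf₁, fun h => hf₁' (mem_image_of_mem _ h)⟩, f₂,
      ⟨hf₂, fun h => hf₂' (mem_image_of_mem _ h)⟩, h₁, h₂, hangle _ _ _⟩
  · rintro ⟨z, hz, f₁, ⟨hf₁, hf₁'⟩, f₂, ⟨hf₂, hf₂'⟩, h₁, h₂, rfl⟩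
    refine ⟨J z, mem_image_of_mem _ hz, J f₁, ⟨mem_image_of_mem _ hf₁, ?_⟩, J f₂,
      ⟨mem_image_of_mem _ hf₂, ?_⟩, ?_, ?_, (hangle _ _ _).symm⟩
    · rwa [hmem]
    · rwa [hmem]
    · rwa [infDist_image J.isometry, J.isometry.dist_eq]
    · rwa [infDist_image J.isometry, J.isometry.dist_eq]

theorem nonFlat_imageFamily {d : ℕ} {𝒳 : Finset (Finset V₁)} :
    NonFlat d (imageFamily J 𝒳) ↔ NonFlat d 𝒳 := by
  have hcoe : ∀ A B C : Finset V₁, (((A.image J : Finset V₂) : Set V₂) =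
      ((B.image J : Finset V₂) : Set V₂) ∩ ((C.image J : Finset V₂) : Set V₂)) ↔
      (A : Set V₁) = (B : Set V₁) ∩ C := by
    intro A B C
    rw [coe_image_inter, Finset.coe_image]
    exact (image_injective.2 J.injective).eq_iff
  have hcard : ∀ A : Finset V₁, (A.image J).card = A.card := fun A =>
    Finset.card_image_of_injective _ J.injective
  constructor
  · intro h Y hY hYd Z₁ h₁ Z₂ h₂ hYZ hc₁ hc₂
    have := h (Y.image J) ((mem_faces_imageFamily J).2 ⟨Y, hY, rfl⟩) (by rwa [hcard])
      (Z₁.image J) ((mem_faces_imageFamily J).2 ⟨Z₁, h₁, rfl⟩)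
      (Z₂.image J) ((mem_faces_imageFamily J).2 ⟨Z₂, h₂, rfl⟩) ((hcoe _ _ _).2 hYZ)
      (by rw [hcard, hcard, hc₁]) (by rw [hcard, hcard, hc₂])
    rwa [angleSet_image] at this
  · intro h Y hY hYd Z₁ h₁ Z₂ h₂ hYZ hc₁ hc₂
    obtain ⟨Y', hY', rfl⟩ := (mem_faces_imageFamily J).1 hY
    obtain ⟨Z₁', h₁', rfl⟩ := (mem_faces_imageFamily J).1 h₁
    obtain ⟨Z₂', h₂', rfl⟩ := (mem_faces_imageFamily J).1 h₂
    rw [hcard] at hYd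
    rw [hcard, hcard] at hc₁ hc₂
    rw [angleSet_image]
    exact h Y' hY' hYd Z₁' h₁' Z₂' h₂' ((hcoe _ _ _).1 hYZ) hc₁ hc₂

theorem skeleton_imageFamily (𝒳 : Finset (Finset V₁)) (k : ℕ) :
    skeleton (imageFamily J 𝒳) k = J '' skeleton 𝒳 k := by
  ext v
  constructor
  · rintro ⟨Y, hY, hk, hv⟩
    obtain ⟨Y', hY', rfl⟩ := (mem_faces_imageFamily J).1 hY
    rw [Finset.card_image_of_injective _ J.injective] at hk
    rw [Finset.coe_image, simpleCone_image] at hv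
    obtain ⟨w, hw, rfl⟩ := hv
    exact ⟨w, ⟨Y', hY', hk, hw⟩, rfl⟩
  · rintro ⟨v, ⟨Y, hY, hk, hv⟩, rfl⟩
    refine ⟨Y.image J, (mem_faces_imageFamily J).2 ⟨Y, hY, rfl⟩, ?_, ?_⟩
    · rwa [Finset.card_image_of_injective _ J.injective]
    · rw [Finset.coe_image, simpleCone_image]
      exact mem_image_of_mem _ hv

theorem support_imageFamily (𝒳 : Finset (Finset V₁)) :
    support (imageFamily J 𝒳) = J '' support 𝒳 := by
  ext v
  constructor
  · rintro ⟨Y, hY, hv⟩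
    obtain ⟨Y', hY', rfl⟩ := Finset.mem_image.1 hY
    rw [Finset.coe_image, simpleCone_image] at hv
    obtain ⟨w, hw, rfl⟩ := hv
    exact ⟨w, ⟨Y', hY', hw⟩, rfl⟩
  · rintro ⟨v, ⟨Y, hY, hv⟩, rfl⟩
    refine ⟨Y.image J, Finset.mem_image_of_mem _ hY, ?_⟩
    rw [Finset.coe_image, simpleCone_image]
    exact mem_image_of_mem _ hv

theorem exists_of_mem_imageFamily {𝒳 : Finset (Finset V₁)} {X : Finset V₂} {x : V₂}
    (hX : X ∈ imageFamily J 𝒳) (hx : x ∈ X) : ∃ y, J y = x := by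
  obtain ⟨Y, hY, rfl⟩ := Finset.mem_image.1 hX
  obtain ⟨y, hy, rfl⟩ := Finset.mem_image.1 hx
  exact ⟨y, rfl⟩

theorem exists_imageFamily_eq {𝒴 : Finset (Finset V₂)}
    (h : ∀ X ∈ 𝒴, ∀ x ∈ X, ∃ y, J y = x) : ∃ 𝒳, imageFamily J 𝒳 = 𝒴 := by
  refine ⟨𝒴.image fun X => X.preimage J J.injective.injOn, ?_⟩
  rw [imageFamily, Finset.image_image]
  conv_rhs => rw [← Finset.image_id (s := 𝒴)]
  refine Finset.image_congr fun X hX => ?_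
  simp only [Function.comp, id]
  rw [Finset.image_preimage, Finset.filter_true_of_mem]
  exact fun x hx => h X hX x hx

end Transport

/-! ### Passage between coordinate presentations and cylinders -/

section Coordinates

variable {N k : ℕ}

/-- The embedding of `ℝ^k` in `ℝ^N` along an injection of the coordinates. -/
noncomputable def coordEmbedding (e : Fin k ↪ Fin N) : Euc k →ₗᵢ[ℝ] Euc N where
  toFun p := WithLp.toLp 2 (Function.extend e p 0)
  map_add' p q := by
    ext j
    by_cases hj : ∃ i, e i = j
    · obtain ⟨i, rfl⟩ := hj
      simp [e.injective.extend_apply]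
    · simp [Function.extend_apply' _ _ _ hj]
  map_smul' c p := by
    ext j
    by_cases hj : ∃ i, e i = j
    · obtain ⟨i, rfl⟩ := hj
      simp [e.injective.extend_apply]
    · simp [Function.extend_apply' _ _ _ hj]
  norm_map' p := by
    rw [EuclideanSpace.norm_eq, EuclideanSpace.norm_eq]
    congr 1
    symm
    refine Fintype.sum_of_injective e e.injective _ _ (fun j hj => ?_) (fun i => ?_)
    · have hj' : ¬ ∃ i, e i = j := hj
      simp [Function.extend_apply' _ _ _ hj']
    · simp [e.injective.extend_apply]

theorem coordEmbedding_apply (e : Fin k ↪ Fin N) (p : Euc k) (i : Fin k) :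
    coordEmbedding e p (e i) = p i :=
  e.injective.extend_apply _ _ _

theorem coordEmbedding_apply_of_notMem (e : Fin k ↪ Fin N) (p : Euc k) {j : Fin N}
    (hj : ¬ ∃ i, e i = j) : coordEmbedding e p j = 0 :=
  Function.extend_apply' _ _ _ hj

theorem coordEmbedding_single (e : Fin k ↪ Fin N) (i : Fin k) :
    coordEmbedding e (EuclideanSpace.single i 1) = EuclideanSpace.single (e i) 1 := by
  ext j
  by_cases hj : ∃ i, e i = j
  · obtain ⟨i', rfl⟩ := hj
    rw [coordEmbedding_apply]
    simp [e.injective.eq_iff]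
  · rw [coordEmbedding_apply_of_notMem e _ hj]
    have : j ≠ e i := fun h => hj ⟨i, h.symm⟩
    simp [this]

theorem inner_coordEmbedding {l : ℕ} (e : Fin k ↪ Fin N) (f : Fin l ↪ Fin N)
    (h : ∀ i j, e i ≠ f j) (p : Euc k) (q : Euc l) :
    inner ℝ (coordEmbedding e p) (coordEmbedding f q) = 0 := by
  rw [PiLp.inner_apply]
  refine Finset.sum_eq_zero fun j _ => ?_
  by_cases hj : ∃ i, e i = j
  · obtain ⟨i, rfl⟩ := hj
    rw [coordEmbedding_apply_of_notMem f _ (fun ⟨i', hi'⟩ => h i i' hi'.symm), inner_zero_right]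
  · rw [coordEmbedding_apply_of_notMem e _ hj, inner_zero_left]

variable {N' m : ℕ}

/-- The first `N'` coordinates. -/
def firstCoords (h : N' + m ≤ N) : Fin N' ↪ Fin N :=
  ⟨fun i => ⟨i, by omega⟩, fun a b hab => by simpa [Fin.ext_iff] using hab⟩

/-- The `m` coordinates that follow the first `N'` coordinates. -/
def nextCoords (h : N' + m ≤ N) : Fin m ↪ Fin N :=
  ⟨fun i => ⟨N' + i, by omega⟩, fun a b hab => by simpa [Fin.ext_iff] using hab⟩

theorem firstCoords_ne_nextCoords (h : N' + m ≤ N) (i : Fin N') (j : Fin m) :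
    firstCoords h i ≠ nextCoords h j := by
  have h1 : (firstCoords h i : ℕ) = i := rfl
  have h2 : (nextCoords h j : ℕ) = N' + j := rfl
  rw [ne_eq, Fin.ext_iff]
  omega

theorem mem_prodPlane (h : N' + m ≤ N) {S : Set (Euc N')} {v : Euc N} :
    v ∈ prodPlane N m S ↔ ∃ p ∈ S, ∃ q : Euc m,
      v = coordEmbedding (nextCoords h) q + coordEmbedding (firstCoords h) p := by
  constructor
  · rintro ⟨⟨p, hp, hvp⟩, hv⟩
    refine ⟨p, hp, WithLp.toLp 2 fun i => v (nextCoords h i), ?_⟩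
    ext j
    rw [PiLp.add_apply]
    by_cases h1 : (j : ℕ) < N'
    · have hj : firstCoords h ⟨j, h1⟩ = j := rfl
      rw [coordEmbedding_apply_of_notMem, zero_add, hvp ⟨j, h1⟩ j rfl]
      · conv_rhs => rw [← hj]
        rw [coordEmbedding_apply]
      · rintro ⟨i, hi⟩
        exact firstCoords_ne_nextCoords h ⟨j, h1⟩ i (by rw [hj, hi])
    · rw [coordEmbedding_apply_of_notMem (firstCoords h), add_zero]
      · by_cases h2 : (j : ℕ) < N' + m
        · have hj : nextCoords h ⟨j - N', by omega⟩ = j := by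
            ext
            change N' + ((j : ℕ) - N') = j
            omega
          conv_rhs => rw [← hj]
          rw [coordEmbedding_apply]
          simp only [hj]
        · rw [hv j (not_lt.1 h2), coordEmbedding_apply_of_notMem]
          rintro ⟨i, rfl⟩
          have : (nextCoords h i : ℕ) = N' + i := rfl
          omega
      · rintro ⟨i, rfl⟩
        exact h1 i.2
  · rintro ⟨p, hp, q, rfl⟩
    refine ⟨⟨p, hp, fun i j hij => ?_⟩, fun j hj => ?_⟩
    · have hj : firstCoords h i = j := Fin.ext hij.symm
      rw [PiLp.add_apply, ← hj, coordEmbedding_apply, coordEmbedding_apply_of_notMem, zero_add]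
      rintro ⟨i', hi'⟩
      exact firstCoords_ne_nextCoords h i i' hi'.symm
    · rw [PiLp.add_apply, coordEmbedding_apply_of_notMem, coordEmbedding_apply_of_notMem, add_zero]
      · rintro ⟨i, rfl⟩
        have : (firstCoords h i : ℕ) = i := rfl
        omega
      · rintro ⟨i, rfl⟩
        have : (nextCoords h i : ℕ) = N' + i := rfl
        omega

/-- By the Mazur–Ulam theorem an isometry is affine. -/
theorem exists_linearIsometryEquiv (R : Euc N ≃ᵢ Euc N) :
    ∃ (A : Euc N ≃ₗᵢ[ℝ] Euc N) (b : Euc N), ∀ x, R x = b + A x := by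
  refine ⟨R.toRealAffineIsometryEquiv.linearIsometryEquiv, R 0, fun x => ?_⟩
  have := R.toRealAffineIsometryEquiv.map_vadd (0 : Euc N) x
  simp only [vadd_eq_add, add_zero] at this
  rw [add_comm]
  exact this

variable {n : ℕ} {W : Set (Euc N)}

theorem image_prodPlane (h : N' + m ≤ N) {R : Euc N ≃ᵢ Euc N} {A : Euc N ≃ₗᵢ[ℝ] Euc N}
    {b : Euc N} (hR : ∀ x, R x = b + A x) (S : Set (Euc N')) :
    R '' prodPlane N m S = cylinder b
      (LinearMap.range (A.toLinearIsometry.comp (coordEmbedding (nextCoords h))).toLinearMap)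
      (A.toLinearIsometry.comp (coordEmbedding (firstCoords h)) '' S) := by
  ext v
  constructor
  · rintro ⟨w, hw, rfl⟩
    obtain ⟨p, hp, q, rfl⟩ := (mem_prodPlane h).1 hw
    refine ⟨_, ⟨q, rfl⟩, _, ⟨p, hp, rfl⟩, ?_⟩
    rw [hR, map_add, add_assoc]
    rfl
  · rintro ⟨_, ⟨q, rfl⟩, _, ⟨p, hp, rfl⟩, rfl⟩
    refine ⟨_, (mem_prodPlane h).2 ⟨p, hp, q, rfl⟩, ?_⟩
    rw [hR, map_add, add_assoc]
    rfl

theorem IsPresentation.exists_isCylinder (h : N' + m ≤ N) {𝒳 : Finset (Finset (Euc N'))}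
    {R : Euc N ≃ᵢ Euc N} (hW : IsPresentation n N' m W 𝒳 R) :
    ∃ p P 𝒴, IsCylinder n N' m W p P 𝒴 ∧
      ∀ k, R '' prodPlane N m (skeleton 𝒳 k) = cylinder p P (skeleton 𝒴 k) := by
  obtain ⟨A, b, hR⟩ := exists_linearIsometryEquiv R
  obtain ⟨hm, hc, hn, hWR⟩ := hW
  set J := A.toLinearIsometry.comp (coordEmbedding (firstCoords h)) with hJ
  set Q := A.toLinearIsometry.comp (coordEmbedding (nextCoords h)) with hQ
  refine ⟨b, LinearMap.range Q.toLinearMap, imageFamily J 𝒳, ⟨hm,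
    (isComplexCone_imageFamily J).2 hc, (nonFlat_imageFamily J).2 hn, ?_, ?_, ?_⟩, fun k => ?_⟩
  · rw [LinearMap.finrank_range_of_inj Q.injective, finrank_euclideanSpace_fin]
  · refine ⟨LinearMap.range J.toLinearMap, ?_, ?_, ?_⟩
    · rw [LinearMap.finrank_range_of_inj J.injective, finrank_euclideanSpace_fin]
    · rintro _ ⟨p, rfl⟩
      rw [Submodule.mem_orthogonal]
      rintro _ ⟨q, rfl⟩
      have h1 : inner ℝ (A (coordEmbedding (nextCoords h) q))
          (A (coordEmbedding (firstCoords h) p)) = 0 := by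
        rw [LinearIsometryEquiv.inner_map_map]
        exact inner_coordEmbedding _ _ (fun i j => (firstCoords_ne_nextCoords h j i).symm) q p
      exact h1
    · intro X hX x hx
      obtain ⟨y, rfl⟩ := exists_of_mem_imageFamily J hX hx
      exact ⟨y, rfl⟩
  · rw [hWR, image_prodPlane h hR, support_imageFamily]
  · rw [image_prodPlane h hR, skeleton_imageFamily]

/-- Orthonormal bases of `S` and `P` are placed at the coordinate positions reserved for the cone
and for the plane, and completed to an orthonormal basis of the whole space. -/
theorem exists_linearIsometryEquiv_of_orthogonal (h : N' + m ≤ N) {P S : Submodule ℝ (Euc N)}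
    (hP : Module.finrank ℝ P = m) (hS : Module.finrank ℝ S ≤ N') (hSP : S ≤ Pᗮ) :
    ∃ A : Euc N ≃ₗᵢ[ℝ] Euc N,
      LinearMap.range (A.toLinearIsometry.comp (coordEmbedding (nextCoords h))).toLinearMap = P ∧
      S ≤ LinearMap.range
        (A.toLinearIsometry.comp (coordEmbedding (firstCoords h))).toLinearMap := by
  let bS := stdOrthonormalBasis ℝ S
  let bP := (stdOrthonormalBasis ℝ P).reindex (finCongr hP)
  let s := Module.finrank ℝ S
  have hs : s ≤ N' := hS
  let v : Fin N → Euc N := fun j => if h1 : (j : ℕ) < s then (bS ⟨j, h1⟩ : Euc N) else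
    if h2 : N' ≤ (j : ℕ) ∧ (j : ℕ) < N' + m then (bP ⟨j - N', by omega⟩ : Euc N) else 0
  let I : Set (Fin N) := {j | (j : ℕ) < s ∨ (N' ≤ (j : ℕ) ∧ (j : ℕ) < N' + m)}
  have hv1 : ∀ (j : Fin N) (h1 : (j : ℕ) < s), v j = (bS ⟨j, h1⟩ : Euc N) := fun j h1 => dif_pos h1
  have hv2 : ∀ (j : Fin N) (h2 : N' ≤ (j : ℕ) ∧ (j : ℕ) < N' + m),
      v j = (bP ⟨j - N', by omega⟩ : Euc N) := fun j h2 => by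
    simp only [v]
    rw [dif_neg (by omega), dif_pos h2]
  have iS : ∀ i j, inner ℝ (bS i : Euc N) (bS j) = if i = j then (1 : ℝ) else 0 := fun i j => by
    have := orthonormal_iff_ite.1 bS.orthonormal i j
    rwa [Submodule.coe_inner] at this
  have iP : ∀ i j, inner ℝ (bP i : Euc N) (bP j) = if i = j then (1 : ℝ) else 0 := fun i j => by
    have := orthonormal_iff_ite.1 bP.orthonormal i j
    rwa [Submodule.coe_inner] at this
  have iPS : ∀ i j, inner ℝ (bP i : Euc N) (bS j : Euc N) = 0 := fun i j =>
    (Submodule.mem_orthogonal P _).1 (hSP (bS j).2) _ (bP i).2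
  have horth : Orthonormal ℝ (I.domRestrict v) := by
    rw [orthonormal_iff_ite]
    rintro ⟨i, hi⟩ ⟨j, hj⟩
    change inner ℝ (v i) (v j) = _
    rcases hi with hi | hi <;> rcases hj with hj | hj
    · rw [hv1 i hi, hv1 j hj, iS]
      simp [Fin.ext_iff]
    · rw [hv1 i hi, hv2 j hj, real_inner_comm, iPS, if_neg]
      simp only [Subtype.mk.injEq, Fin.ext_iff]
      omega
    · rw [hv2 i hi, hv1 j hj, iPS, if_neg]
      simp only [Subtype.mk.injEq, Fin.ext_iff]
      omega
    · rw [hv2 i hi, hv2 j hj, iP]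
      simp only [Subtype.mk.injEq, Fin.ext_iff]
      congr 1
      rw [eq_iff_iff]
      omega
  obtain ⟨b, hb⟩ := horth.exists_orthonormalBasis_extension_of_card_eq (by simp)
  have hA : ∀ j, b.repr.symm (EuclideanSpace.single j 1) = b j := fun j => by simp
  refine ⟨b.repr.symm, ?_, ?_⟩
  · symm
    refine Submodule.eq_of_le_of_finrank_eq ?_ ?_
    · intro x hx
      have hx' : (⟨x, hx⟩ : P) = ∑ i, inner ℝ (bP i) (⟨x, hx⟩ : P) • bP i :=
        (bP.sum_repr' ⟨x, hx⟩).symm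
      have : x = ∑ i, inner ℝ (bP i) (⟨x, hx⟩ : P) • (bP i : Euc N) := by
        simpa using congrArg Subtype.val hx'
      rw [this]
      refine Submodule.sum_mem _ fun i _ => Submodule.smul_mem _ _ ?_
      refine ⟨EuclideanSpace.single i 1, ?_⟩
      change b.repr.symm (coordEmbedding (nextCoords h) (EuclideanSpace.single i 1)) = _
      have hni : ((nextCoords h i : Fin N) : ℕ) = N' + i := rfl
      have hI : N' ≤ ((nextCoords h i : Fin N) : ℕ) ∧ ((nextCoords h i : Fin N) : ℕ) < N' + m := by
        omega
      rw [coordEmbedding_single, hA, hb _ (Or.inr hI), hv2 _ hI]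
      congr 2
      ext
      simp only [hni]
      omega
    · rw [hP, LinearMap.finrank_range_of_inj (LinearIsometry.injective _),
        finrank_euclideanSpace_fin]
  · intro x hx
    have hx' : (⟨x, hx⟩ : S) = ∑ i, inner ℝ (bS i) (⟨x, hx⟩ : S) • bS i :=
      (bS.sum_repr' ⟨x, hx⟩).symm
    have : x = ∑ i, inner ℝ (bS i) (⟨x, hx⟩ : S) • (bS i : Euc N) := by
      simpa using congrArg Subtype.val hx'
    rw [this]
    refine Submodule.sum_mem _ fun i _ => Submodule.smul_mem _ _ ?_
    have hi : (i : ℕ) < N' := i.2.trans_le hs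
    refine ⟨EuclideanSpace.single ⟨i, hi⟩ 1, ?_⟩
    change b.repr.symm (coordEmbedding (firstCoords h) (EuclideanSpace.single ⟨i, hi⟩ 1)) = _
    have hI : ((firstCoords h ⟨i, hi⟩ : Fin N) : ℕ) < s := i.2
    rw [coordEmbedding_single, hA, hb _ (Or.inl hI), hv1 _ hI]
    rfl

/-- The cone spans at most `N'` dimensions orthogonal to `P`, so a rotation moves it into the first
`N'` coordinates and `P` into the next `m`. -/
theorem IsCylinder.isOfType (h : N' + m ≤ N) {p : Euc N} {P : Submodule ℝ (Euc N)}
    {𝒴 : Finset (Finset (Euc N))} (hW : IsCylinder n N' m W p P 𝒴) : IsOfType n N' m W := by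
  obtain ⟨S, hS, hSP, hYS⟩ := hW.exists_subspace
  obtain ⟨A, hAP, hAS⟩ := exists_linearIsometryEquiv_of_orthogonal h hW.finrank_eq hS hSP
  set J := A.toLinearIsometry.comp (coordEmbedding (firstCoords h)) with hJ
  let R : Euc N ≃ᵢ Euc N := A.toIsometryEquiv.trans (IsometryEquiv.addLeft p)
  have hR : ∀ x, R x = p + A x := fun x => rfl
  obtain ⟨𝒳, hX⟩ := exists_imageFamily_eq J (𝒴 := 𝒴) fun X hX x hx => hAS (hYS X hX x hx)
  have hc := hW.cone
  have hn := hW.nonFlat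
  rw [← hX, isComplexCone_imageFamily] at hc
  rw [← hX, nonFlat_imageFamily] at hn
  refine ⟨𝒳, R, hW.le, hc, hn, ?_⟩
  rw [image_prodPlane h hR, hAP, ← support_imageFamily, hX]
  exact hW.eq_cylinder

end Coordinates

/-! ### Tangent cones: uniqueness, homogeneity, iteration -/

section TangentCones

variable {V : Type*} [NormedAddCommGroup V] [InnerProductSpace ℝ V]

theorem IsTangent.smul_mem_iff {W : Set V} {x : V} {K : Set V} (h : IsTangent W x K) {v : V}
    {t : ℝ} (ht : 0 < t) : t • v ∈ K ↔ v ∈ K :=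
  ⟨fun hv => by simpa [smul_smul, inv_mul_cancel₀ ht.ne'] using h.smul_mem _ hv _ (inv_pos.2 ht),
    fun hv => h.smul_mem _ hv _ ht⟩

theorem IsTangent.mem {W : Set V} {x : V} {K : Set V} (h : IsTangent W x K) : x ∈ W := by
  have := h.eventually.self_of_nhds
  rw [add_zero] at this
  exact this.2 h.zero_mem

theorem tendsto_smul_nhdsGT_zero (v : V) : Tendsto (fun t : ℝ => t • v) (𝓝[>] 0) (𝓝 0) := by
  have : ContinuousAt (fun t : ℝ => t • v) 0 := by fun_prop
  simpa using this.tendsto.mono_left nhdsWithin_le_nhds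

theorem IsTangent.unique {W : Set V} {x : V} {K K' : Set V} (h : IsTangent W x K)
    (h' : IsTangent W x K') : K = K' := by
  ext v
  obtain ⟨t, ⟨ht, ht'⟩, h0⟩ := (((tendsto_smul_nhdsGT_zero v).eventually
    (h.eventually.and h'.eventually)).and self_mem_nhdsWithin).exists
  have h0 : 0 < t := h0
  rw [← h.smul_mem_iff h0, ← h'.smul_mem_iff h0, ← ht, ht']

theorem IsTangent.congr {W W' : Set V} {x x' : V} {K : Set V} (h : IsTangent W x K)
    (hW : ∀ᶠ v in 𝓝 (0 : V), x + v ∈ W ↔ x' + v ∈ W') : IsTangent W' x' K :=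
  ⟨h.smul_mem, h.zero_mem, by
    filter_upwards [h.eventually, hW] with v h1 h2
    rw [← h2, h1]⟩

theorem IsTangent.isTangent_smul_iff {W : Set V} {x : V} {K : Set V} (h : IsTangent W x K) {k : V}
    {t : ℝ} (ht : 0 < t) {L : Set V} : IsTangent K (t • k) L ↔ IsTangent K k L := by
  have key : ∀ (k : V) (t : ℝ), 0 < t → IsTangent K k L → IsTangent K (t • k) L := by
    intro k t ht hL
    refine ⟨hL.smul_mem, hL.zero_mem, ?_⟩
    have htend : Tendsto (fun v : V => t⁻¹ • v) (𝓝 0) (𝓝 0) := by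
      have : ContinuousAt (fun v : V => t⁻¹ • v) 0 := by fun_prop
      simpa using this.tendsto
    filter_upwards [htend.eventually hL.eventually] with v hv
    rw [hL.smul_mem_iff (inv_pos.2 ht)] at hv
    rw [← hv, ← h.smul_mem_iff ht (v := k + t⁻¹ • v), smul_add, smul_smul, mul_inv_cancel₀ ht.ne', one_smul]
  refine ⟨fun hL => ?_, key k t ht⟩
  have := key _ t⁻¹ (inv_pos.2 ht) hL
  rwa [smul_smul, inv_mul_cancel₀ ht.ne', one_smul] at this

/-- Near `x + t k` the set `W` is `x + K`, and a dilation carries `t k` to `k`. Thus a tangent cone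
of a tangent cone already occurs as a tangent cone of `W`. -/
theorem IsTangent.eventually_isTangent {W : Set V} {x : V} {K : Set V} (h : IsTangent W x K)
    (k : V) : ∀ᶠ t in 𝓝[>] (0 : ℝ), ∀ L, IsTangent W (x + t • k) L ↔ IsTangent K k L := by
  have h1 := (tendsto_smul_nhdsGT_zero k).eventually h.eventually.eventually_nhds
  filter_upwards [h1, self_mem_nhdsWithin] with t ht ht0 L
  have ht0 : 0 < t := ht0
  rw [← h.isTangent_smul_iff ht0]
  have htend : Tendsto (fun v : V => t • k + v) (𝓝 0) (𝓝 (t • k)) := by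
    have : ContinuousAt (fun v : V => t • k + v) 0 := by fun_prop
    simpa using this.tendsto
  have h2 : ∀ᶠ v in 𝓝 (0 : V), x + t • k + v ∈ W ↔ t • k + v ∈ K := by
    filter_upwards [htend.eventually ht] with v hv
    rw [add_assoc, hv]
  refine ⟨fun hL => hL.congr h2, fun hL => hL.congr ?_⟩
  filter_upwards [h2] with v hv
  rw [hv]

theorem IsTangent.image {W : Set V} {x : V} {K : Set V} (h : IsTangent W x K) {R : V ≃ᵢ V}
    {A : V ≃ₗᵢ[ℝ] V} {b : V} (hR : ∀ x, R x = b + A x) :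
    IsTangent (R '' W) (R x) (A '' K) := by
  refine ⟨?_, ⟨0, h.zero_mem, map_zero A⟩, ?_⟩
  · rintro _ ⟨v, hv, rfl⟩ t ht
    exact ⟨t • v, h.smul_mem v hv t ht, map_smul A t v⟩
  · have htend : Tendsto (fun v : V => A.symm v) (𝓝 0) (𝓝 0) := by
      have := A.symm.continuous.tendsto 0
      rwa [map_zero] at this
    filter_upwards [htend.eventually h.eventually] with v hv
    have e1 : R x + v = R (x + A.symm v) := by
      rw [hR, hR, map_add, A.apply_symm_apply, add_assoc]
    have e2 : v ∈ A '' K ↔ A.symm v ∈ K := by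
      constructor
      · rintro ⟨w, hw, rfl⟩
        rwa [A.symm_apply_apply]
      · exact fun hw => ⟨_, hw, A.apply_symm_apply v⟩
    rw [e1, R.injective.mem_set_image, e2, hv]

end TangentCones

/-! ### Intrinsic description of types and spines -/

section Types

variable {n N' N : ℕ} {m k t : ℕ} {W K : Set (Euc N)} {x : Euc N}

theorem IsOfType.le (h : IsOfType n N' m W) : m ≤ n := by
  obtain ⟨_, _, h, _⟩ := h
  exact h

theorem IsOfType.image (h : IsOfType n N' m W) (R : Euc N ≃ᵢ Euc N) :
    IsOfType n N' m (R '' W) := by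
  obtain ⟨𝒳, R₀, hm, hc, hn, rfl⟩ := h
  exact ⟨𝒳, R₀.trans R, hm, hc, hn, by rw [← image_comp]; rfl⟩

theorem image_symm_image (R : Euc N ≃ᵢ Euc N) (W : Set (Euc N)) : R.symm '' (R '' W) = W := by
  rw [← image_comp]
  simp

theorem image_spine_subset (R : Euc N ≃ᵢ Euc N) : R '' spine n N' W t ⊆ spine n N' (R '' W) t := by
  rintro _ ⟨x, ⟨m, 𝒳, R₀, ⟨hm, hc, hn, rfl⟩, hmt, htn, hx⟩, rfl⟩
  refine ⟨m, 𝒳, R₀.trans R, ⟨hm, hc, hn, by rw [← image_comp]; rfl⟩, hmt, htn, ?_⟩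
  obtain ⟨y, hy, rfl⟩ := hx
  exact ⟨y, hy, rfl⟩

theorem spine_image (R : Euc N ≃ᵢ Euc N) : spine n N' (R '' W) t = R '' spine n N' W t := by
  apply Subset.antisymm _ (image_spine_subset R)
  intro x hx
  refine ⟨R.symm x, ?_, R.apply_symm_apply x⟩
  have := image_spine_subset R.symm (mem_image_of_mem R.symm hx)
  rwa [image_symm_image] at this

theorem IsOfType.exists_isCylinder (hN : N' + n ≤ N) (h : IsOfType n N' m W) :
    ∃ p P 𝒴, IsCylinder n N' m W p P 𝒴 := by
  have hm := h.le
  obtain ⟨𝒳, R, h⟩ := h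
  obtain ⟨p, P, 𝒴, h, -⟩ := h.exists_isCylinder (by omega)
  exact ⟨p, P, 𝒴, h⟩

/-- Both numbers are the dimension of the space of translations that preserve `W`. -/
theorem IsOfType.unique (hN : N' + n ≤ N) (h : IsOfType n N' m W) (h' : IsOfType n N' k W) :
    m = k := by
  obtain ⟨p, P, 𝒴, h⟩ := h.exists_isCylinder hN
  obtain ⟨p', P', 𝒴', h'⟩ := h'.exists_isCylinder hN
  have : P = P' := by
    ext v
    rw [← h.mem_of_invariant, ← h'.mem_of_invariant]
  rw [← h.finrank_eq, ← h'.finrank_eq, this]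

theorem IsOfType.isClosed (hN : N' + n ≤ N) (h : IsOfType n N' m W) : IsClosed W := by
  obtain ⟨p, P, 𝒴, h⟩ := h.exists_isCylinder hN
  exact h.isClosed

theorem IsCylinder.exists_carrier {p : Euc N} {P : Submodule ℝ (Euc N)}
    {𝒴 : Finset (Finset (Euc N))} (h : IsCylinder n N' m W p P 𝒴) (hx : x ∈ W) :
    ∃ a ∈ P, ∃ F ∈ faces 𝒴, ∃ b ∈ openCone F, x = p + a + b := by
  rw [h.eq_cylinder] at hx
  obtain ⟨a, ha, b, hb, rfl⟩ := hx
  obtain ⟨F, hF, hbF⟩ := ConeStrata.exists_carrier hb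
  exact ⟨a, ha, F, hF, b, hbF, rfl⟩

/-- The tangent cone of `W` at `x` is of type `k`. -/
def IsTangentType (n N' : ℕ) (W : Set (Euc N)) (x : Euc N) (k : ℕ) : Prop :=
  ∃ K, IsTangent W x K ∧ IsOfType n N' k K

theorem IsTangentType.unique (hN : N' + n ≤ N) (h : IsTangentType n N' W x m)
    (h' : IsTangentType n N' W x k) : m = k := by
  obtain ⟨K, hK, hm⟩ := h
  obtain ⟨K', hK', hk⟩ := h'
  rw [hK'.unique hK] at hk
  exact hm.unique hN hk

theorem IsCylinder.isOfType_tangentCone (hN : N' + n ≤ N) {p : Euc N}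
    {P : Submodule ℝ (Euc N)} {𝒴 : Finset (Finset (Euc N))} (h : IsCylinder n N' m W p P 𝒴)
    {F : Finset (Euc N)} (hF : F ∈ faces 𝒴) :
    IsOfType n N' (m + F.card) (tangentCone P 𝒴 F) := by
  have h1 := h.isCylinder_tangentCone hF
  have := h1.le
  exact h1.isOfType (by omega)

theorem IsCylinder.isTangentType (hN : N' + n ≤ N) {p : Euc N} {P : Submodule ℝ (Euc N)}
    {𝒴 : Finset (Finset (Euc N))} (h : IsCylinder n N' m W p P 𝒴) {a b : Euc N} (ha : a ∈ P)
    {F : Finset (Euc N)} (hF : F ∈ faces 𝒴) (hb : b ∈ openCone F) :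
    IsTangentType n N' W (p + a + b) (m + F.card) :=
  ⟨_, h.isTangent ha hF hb, h.isOfType_tangentCone hN hF⟩

/-- The tangent type at a point with carrier `F` is `m + #F`, so it measures the least skeleton that
contains the point. -/
theorem IsCylinder.mem_cylinder_skeleton (hN : N' + n ≤ N) {p : Euc N} {P : Submodule ℝ (Euc N)}
    {𝒴 : Finset (Finset (Euc N))} (h : IsCylinder n N' m W p P 𝒴) (hk : m + k ≤ n) :
    x ∈ cylinder p P (skeleton 𝒴 k) ↔ ∃ l ≤ m + k, IsTangentType n N' W x l := by
  constructor
  · rintro ⟨a, ha, b, ⟨Y, hY, hYk, hb⟩, rfl⟩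
    obtain ⟨F, hFY, hbF⟩ := exists_mem_openCone hb
    have := Finset.card_le_card hFY
    exact ⟨m + F.card, by omega, h.isTangentType hN ha (faces_subset hY hFY) hbF⟩
  · rintro ⟨l, hl, hx⟩
    have hxW : x ∈ W := by
      obtain ⟨K, hK, -⟩ := hx
      exact hK.mem
    obtain ⟨a, ha, F, hF, b, hb, rfl⟩ := h.exists_carrier hxW
    have hlF := hx.unique hN (h.isTangentType hN ha hF hb)
    obtain ⟨X, hX, hFX⟩ := hF
    have hcard := (h.cone.2.1 X hX).2
    -- The skeleton asks for faces with exactly `k` elements, so the carrier is enlarged inside a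
    -- generating set.
    obtain ⟨Y, hFY, hYX, hY⟩ := Finset.exists_subsuperset_card_eq hFX
      (show F.card ≤ k by omega) (show k ≤ X.card by omega)
    exact ⟨a, ha, b, ⟨Y, ⟨X, hX, hYX⟩, hY,
      simpleCone_mono (by exact_mod_cast hFY) (openCone_subset F hb)⟩, rfl⟩

theorem IsCylinder.le_of_isTangentType (hN : N' + n ≤ N) {p : Euc N} {P : Submodule ℝ (Euc N)}
    {𝒴 : Finset (Finset (Euc N))} (h : IsCylinder n N' m W p P 𝒴)
    (hx : IsTangentType n N' W x k) : m ≤ k := by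
  have hxW : x ∈ W := by
    obtain ⟨K, hK, -⟩ := hx
    exact hK.mem
  obtain ⟨a, ha, F, hF, b, hb, rfl⟩ := h.exists_carrier hxW
  have := hx.unique hN (h.isTangentType hN ha hF hb)
  omega

/-- The right-hand side mentions no presentation and depends only on germs of `W`; the independence
and locality of spines are deduced from this. -/
theorem mem_spine (hN : N' + n ≤ N) (hW : IsOfType n N' m W) :
    x ∈ spine n N' W t ↔ t ≤ n ∧ ∃ k ≤ t, IsTangentType n N' W x k := by
  constructor
  · rintro ⟨m', 𝒳, R, hR, hm't, htn, hx⟩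
    have hm' := hR.1
    obtain ⟨p, P, 𝒴, h, hs⟩ := hR.exists_isCylinder (by omega)
    rw [hs, h.mem_cylinder_skeleton hN (by omega)] at hx
    rw [Nat.add_sub_cancel' hm't] at hx
    exact ⟨htn, hx⟩
  · rintro ⟨htn, k, hkt, hx⟩
    have hm := hW.le
    obtain ⟨𝒳, R, hR⟩ := hW
    obtain ⟨p, P, 𝒴, h, hs⟩ := hR.exists_isCylinder (by omega)
    have hmk := h.le_of_isTangentType hN hx
    refine ⟨m, 𝒳, R, hR, by omega, htn, ?_⟩
    rw [hs, h.mem_cylinder_skeleton hN (by omega)]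
    exact ⟨k, by omega, hx⟩

theorem isOfType_of_mem_spine (hx : x ∈ spine n N' W t) : ∃ m, IsOfType n N' m W := by
  obtain ⟨m, 𝒳, R, hR, -⟩ := hx
  exact ⟨m, 𝒳, R, hR⟩

theorem spine_mono (hN : N' + n ≤ N) {s : ℕ} (hst : s ≤ t) (htn : t ≤ n) :
    spine n N' W s ⊆ spine n N' W t := by
  intro x hx
  obtain ⟨m, hm⟩ := isOfType_of_mem_spine hx
  rw [mem_spine hN hm] at hx ⊢
  obtain ⟨-, k, hk, hx⟩ := hx
  exact ⟨htn, k, hk.trans hst, hx⟩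

theorem spine_subset (hN : N' + n ≤ N) : spine n N' W t ⊆ W := by
  intro x hx
  obtain ⟨m, hm⟩ := isOfType_of_mem_spine hx
  rw [mem_spine hN hm] at hx
  obtain ⟨-, k, hk, K, hK, -⟩ := hx
  exact hK.mem

theorem IsOfType.exists_isTangentType (hN : N' + n ≤ N) (hW : IsOfType n N' m W) (hx : x ∈ W) :
    ∃ k, m ≤ k ∧ k ≤ n ∧ IsTangentType n N' W x k := by
  obtain ⟨p, P, 𝒴, h⟩ := hW.exists_isCylinder hN
  obtain ⟨a, ha, F, hF, b, hb, rfl⟩ := h.exists_carrier hx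
  exact ⟨m + F.card, Nat.le_add_right _ _, (h.isOfType_tangentCone hN hF).le,
    h.isTangentType hN ha hF hb⟩

theorem subset_spine_self (hN : N' + n ≤ N) (hW : IsOfType n N' m W) : W ⊆ spine n N' W n := by
  intro x hx
  obtain ⟨k, -, hk, h⟩ := hW.exists_isTangentType hN hx
  exact (mem_spine hN hW).2 ⟨le_rfl, k, hk, h⟩

theorem isClosed_spine (hN : N' + n ≤ N) (hW : IsOfType n N' m W) (htn : t ≤ n) :
    IsClosed (spine n N' W t) := by
  obtain ⟨p, P, 𝒴, h⟩ := hW.exists_isCylinder hN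
  by_cases hmt : m ≤ t
  · have : spine n N' W t = cylinder p P (skeleton 𝒴 (t - m)) := by
      ext x
      rw [mem_spine hN hW, h.mem_cylinder_skeleton hN (by omega), Nat.add_sub_cancel' hmt]
      exact ⟨fun h => h.2, fun h => ⟨htn, h⟩⟩
    rw [this]
    exact isClosed_cylinder ((skeleton_subset_support _).trans h.support_subset)
      (h.cone.isClosed_skeleton _)
  · have : spine n N' W t = ∅ := by
      ext x
      rw [mem_spine hN hW]
      simp only [mem_empty_iff_false, iff_false, not_and, not_exists]
      intro _ k hk hx
      have := h.le_of_isTangentType hN hx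
      omega
    rw [this]
    exact isClosed_empty

/-- The lowest spine is a plane. -/
theorem IsCylinder.mem_spine_self (hN : N' + n ≤ N) {p : Euc N} {P : Submodule ℝ (Euc N)}
    {𝒴 : Finset (Finset (Euc N))} (h : IsCylinder n N' m W p P 𝒴) :
    x ∈ spine n N' W m ↔ x - p ∈ P := by
  have hm := h.le
  rw [mem_spine hN (h.isOfType (by omega))]
  have := h.mem_cylinder_skeleton (x := x) (k := 0) hN (by omega)
  rw [add_zero] at this
  rw [← this]
  constructor
  · rintro ⟨-, a, ha, b, ⟨Y, hY, hYk, hb⟩, rfl⟩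
    rw [Finset.card_eq_zero] at hYk
    rw [hYk, Finset.coe_empty, simpleCone_empty, mem_singleton_iff] at hb
    rw [hb]
    simpa using ha
  · intro hx
    obtain ⟨X, hX⟩ := h.cone.1
    exact ⟨hm, x - p, hx, 0, ⟨∅, ⟨X, hX, Finset.empty_subset _⟩, rfl, zero_mem_simpleCone _⟩,
      by abel⟩

/-- Near a point of its lowest spine, a set has points of the next spine at any prescribed
distance from the lowest spine. -/
theorem IsOfType.exists_mem_spine_succ (hN : N' + n ≤ N) (hW : IsOfType n N' m W) (hmn : m < n)
    (hx : x ∈ spine n N' W m) {s : ℝ} (hs : 0 < s) :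
    ∃ z ∈ spine n N' W (m + 1), dist z x = s ∧ ∀ q ∈ spine n N' W m, s ≤ dist z q := by
  obtain ⟨p, P, 𝒴, h⟩ := hW.exists_isCylinder hN
  rw [h.mem_spine_self hN] at hx
  obtain ⟨X, hX⟩ := h.cone.1
  obtain ⟨e, he⟩ : X.Nonempty := by
    rw [← Finset.card_pos, (h.cone.2.1 X hX).2]
    omega
  have hF : ({e} : Finset (Euc N)) ∈ faces 𝒴 := ⟨X, hX, by simpa using he⟩
  have hnorm : ‖e‖ = 1 := (h.cone.2.1 X hX).1.1 e he
  have heP : e ∈ Pᗮ := h.face_subset hF e (Finset.mem_singleton_self e)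
  have hb : s • e ∈ openCone {e} := ⟨fun _ => s, fun _ _ => hs, by simp⟩
  have hxe : x + s • e = p + (x - p) + s • e := by abel
  -- Moving along a unit vertex `e`, orthogonal to `P`, leaves the lowest spine at unit speed;
  -- projecting to `Pᗮ` bounds the distance to that plane from below.
  refine ⟨x + s • e, ?_, ?_, ?_⟩
  · rw [mem_spine hN hW]
    refine ⟨hmn, m + 1, le_rfl, ?_⟩
    rw [hxe]
    simpa using h.isTangentType hN hx hF hb
  · rw [dist_eq_norm, add_sub_cancel_left, norm_smul, hnorm, mul_one, Real.norm_of_nonneg hs.le]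
  · intro q hq
    rw [h.mem_spine_self hN] at hq
    have hd : x - q ∈ P := by
      have := P.sub_mem hx hq
      rwa [sub_sub_sub_cancel_right] at this
    have hproj : Pᗮ.starProjection (x + s • e - q) = s • e := by
      have : x + s • e - q = (x - q) + s • e := by abel
      rw [this, map_add, (Submodule.starProjection_apply_eq_zero_iff Pᗮ).2
        (by rwa [Submodule.orthogonal_orthogonal]), zero_add,
        Submodule.starProjection_eq_self_iff.2 (Pᗮ.smul_mem s heP)]
    have := Submodule.norm_starProjection_apply_le Pᗮ (x + s • e - q)
    rwa [hproj, norm_smul, hnorm, mul_one, Real.norm_of_nonneg hs.le, ← dist_eq_norm] at this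

end Types

/-! ### The family of blow-up limits and its finitely many models -/

section BlowUps

variable {n N' N : ℕ} {m : ℕ} {W K : Set (Euc N)} {x : Euc N} {𝓑 : Set (Set (Euc N))}

/-- Once `W` agrees with `x + K` in the ball of radius `r`, dilations recover the cone `K` from `W`
in that ball. -/
theorem IsTangent.eventually_blowUp (h : IsTangent W x K) :
    ∀ᶠ r in 𝓝[>] (0 : ℝ), blowUp W x r = K := by
  obtain ⟨ρ, hρ, hball⟩ := Metric.eventually_nhds_iff.1 h.eventually
  filter_upwards [Ioo_mem_nhdsGT hρ] with r hr
  ext v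
  constructor
  · rintro ⟨c, hc, y, ⟨hyW, hy⟩, rfl⟩
    have hyK : y - x ∈ K := by
      rw [← hball (y := y - x) (by
        rw [dist_zero_right, ← dist_eq_norm]
        exact (mem_ball.1 hy).trans hr.2), add_sub_cancel]
      exact hyW
    rcases hc.eq_or_lt with rfl | hc
    · rw [zero_smul]
      exact h.zero_mem
    · exact h.smul_mem _ hyK _ hc
  · intro hv
    obtain ⟨t, ⟨ht1, ht2⟩, ht0⟩ := (((tendsto_smul_nhdsGT_zero v).eventually
      (h.eventually.and (ball_mem_nhds 0 hr.1))).and self_mem_nhdsWithin).exists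
    have ht0 : 0 < t := ht0
    refine ⟨t⁻¹, (inv_pos.2 ht0).le, x + t • v, ⟨ht1.2 (h.smul_mem v hv t ht0), ?_⟩, ?_⟩
    · simpa [mem_ball, dist_eq_norm] using ht2
    · rw [add_sub_cancel_left, smul_smul, inv_mul_cancel₀ ht0.ne', one_smul]

theorem mem_blowUpLimits (hN : N' + n ≤ N) (h𝓑 : ∀ W ∈ 𝓑, ∃ m ≤ n, IsOfType n N' m W)
    {Y : Set (Euc N)} : Y ∈ blowUpLimits 𝓑 ↔
      ∃ W ∈ 𝓑, ∃ (x : Euc N) (K : Set (Euc N)) (R : Euc N ≃ᵢ Euc N),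
        IsTangent W x K ∧ Y = R '' K := by
  constructor
  · rintro ⟨W, hW, x, hx, R, hR⟩
    obtain ⟨m, -, hm⟩ := h𝓑 W hW
    obtain ⟨k, -, -, K, hK, -⟩ := hm.exists_isTangentType hN hx
    obtain ⟨r, hr, hrK⟩ := (hR.and hK.eventually_blowUp).exists
    exact ⟨W, hW, x, K, R, hK, by rw [hr, hrK]⟩
  · rintro ⟨W, hW, x, K, R, hK, rfl⟩
    refine ⟨W, hW, x, hK.mem, R, ?_⟩
    filter_upwards [hK.eventually_blowUp] with r hr
    rw [hr]

theorem image_mem_blowUpLimits {Y : Set (Euc N)} (hY : Y ∈ blowUpLimits 𝓑) (R : Euc N ≃ᵢ Euc N) :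
    R '' Y ∈ blowUpLimits 𝓑 := by
  obtain ⟨W, hW, x, hx, R₀, hR⟩ := hY
  refine ⟨W, hW, x, hx, R₀.trans R, ?_⟩
  filter_upwards [hR] with r hr
  rw [hr, ← image_comp]
  rfl

theorem image_mem_limitsOfType {Y : Set (Euc N)} (hY : Y ∈ limitsOfType n N' 𝓑 m)
    (R : Euc N ≃ᵢ Euc N) : R '' Y ∈ limitsOfType n N' 𝓑 m :=
  ⟨image_mem_blowUpLimits hY.1 R, hY.2.image R⟩

theorem exists_mem_limitsOfType (hN : N' + n ≤ N) (h𝓑 : ∀ W ∈ 𝓑, ∃ m ≤ n, IsOfType n N' m W)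
    {Y : Set (Euc N)} (hY : Y ∈ blowUpLimits 𝓑) : ∃ m ≤ n, Y ∈ limitsOfType n N' 𝓑 m := by
  obtain ⟨W, hW, x, K, R, hK, rfl⟩ := (mem_blowUpLimits hN h𝓑).1 hY
  obtain ⟨m, -, hm⟩ := h𝓑 W hW
  obtain ⟨k, -, hk, K', hK', hkK'⟩ := hm.exists_isTangentType hN hK.mem
  rw [hK'.unique hK] at hkK'
  exact ⟨k, hk, hY, hkK'.image R⟩

/-- A tangent cone of a blow-up limit is a rotated tangent cone of the original member of `𝓑` at a
nearby point, by `eventually_isTangent`. -/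
theorem IsTangent.mem_blowUpLimits (hN : N' + n ≤ N)
    (h𝓑 : ∀ W ∈ 𝓑, ∃ m ≤ n, IsOfType n N' m W) {Y L : Set (Euc N)} (hY : Y ∈ blowUpLimits 𝓑)
    {y : Euc N} (hL : IsTangent Y y L) : L ∈ blowUpLimits 𝓑 := by
  obtain ⟨W, hW, x, K, R, hK, rfl⟩ := (ConeStrata.mem_blowUpLimits hN h𝓑).1 hY
  obtain ⟨A, b, hR⟩ := exists_linearIsometryEquiv R
  obtain ⟨k, hk, rfl⟩ := hL.mem
  obtain ⟨m, -, hm⟩ := h𝓑 W hW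
  have hKtype : ∃ l, IsOfType n N' l K := by
    obtain ⟨l, -, -, K', hK', hl⟩ := hm.exists_isTangentType hN hK.mem
    rw [hK'.unique hK] at hl
    exact ⟨l, hl⟩
  obtain ⟨l, hl⟩ := hKtype
  obtain ⟨_, -, -, L', hL', -⟩ := hl.exists_isTangentType hN hk
  obtain ⟨t, ht⟩ := (hK.eventually_isTangent k).exists
  have hWL := (ht L').2 hL'
  rw [hL.unique (hL'.image hR)]
  exact (ConeStrata.mem_blowUpLimits hN h𝓑).2 ⟨W, hW, _, L', A.toIsometryEquiv, hWL, rfl⟩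

theorem mem_image_addLeft {W : Set (Euc N)} {a z : Euc N} :
    z ∈ IsometryEquiv.addLeft a '' W ↔ z - a ∈ W := by
  constructor
  · rintro ⟨w, hw, rfl⟩
    simpa using hw
  · exact fun h => ⟨z - a, h, by simp⟩

/-- The images of a set of type `m` under homotheties are translates of it. -/
theorem exists_homothety_mem_limitsOfType (hN : N' + n ≤ N) {Y : Set (Euc N)}
    (hY : Y ∈ limitsOfType n N' 𝓑 m) {s : ℝ} (hs : 0 < s) (a : Euc N) :
    ∃ Y' ∈ limitsOfType n N' 𝓑 m, ∀ z, z ∈ Y' ↔ s⁻¹ • (z - a) ∈ Y := by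
  obtain ⟨p, P, 𝒴, h⟩ := hY.2.exists_isCylinder hN
  refine ⟨IsometryEquiv.addLeft (a + s • p - p) '' Y, image_mem_limitsOfType hY _, fun z => ?_⟩
  rw [mem_image_addLeft, h.eq_cylinder, mem_cylinder h.support_subset,
    mem_cylinder h.support_subset]
  have e : s⁻¹ • (z - a) - p = s⁻¹ • (z - (a + s • p - p) - p) := by
    have : s⁻¹ • s • p = p := by rw [smul_smul, inv_mul_cancel₀ hs.ne', one_smul]
    rw [← this]
    simp only [smul_sub, smul_add, this]
    abel
  rw [e, map_smul]
  refine ⟨fun h => smul_mem_support h (inv_pos.2 hs).le, fun h => ?_⟩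
  have := smul_mem_support h hs.le
  rwa [smul_smul, mul_inv_cancel₀ hs.ne', one_smul] at this

/-- Up to isometries, there are finitely many blow-up limits. -/
theorem exists_finite_models (hN : N' + n ≤ N) (h𝓑 : ∀ W ∈ 𝓑, ∃ m ≤ n, IsOfType n N' m W)
    (hfin : FiniteModIsometry 𝓑) :
    ∃ 𝒢 : Set (Set (Euc N)), 𝒢.Finite ∧ (∀ K ∈ 𝒢, K ∈ blowUpLimits 𝓑 ∧
      ∃ m P 𝒴, IsCylinder n N' m K 0 P 𝒴) ∧
      ∀ Y ∈ blowUpLimits 𝓑, ∃ K ∈ 𝒢, ∃ R : Euc N ≃ᵢ Euc N, Y = R '' K := by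
  obtain ⟨𝓕, hfin, hsub, hcov⟩ := hfin
  have hcyl : ∀ W ∈ 𝓑, ∃ m p P 𝒴, IsCylinder n N' m W p P 𝒴 := by
    intro W hW
    obtain ⟨m, -, hm⟩ := h𝓑 W hW
    obtain ⟨p, P, 𝒴, h⟩ := hm.exists_isCylinder hN
    exact ⟨m, p, P, 𝒴, h⟩
  refine ⟨⋃ W ∈ 𝓕, {K | ∃ x, IsTangent W x K}, hfin.biUnion fun W hW => ?_, ?_, ?_⟩
  · obtain ⟨m, p, P, 𝒴, h⟩ := hcyl W (hsub hW)
    -- Tangent cones depend only on the carrier, and there are finitely many faces.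
    refine ((finite_faces 𝒴).image (tangentCone P 𝒴)).subset ?_
    rintro K ⟨x, hK⟩
    obtain ⟨a, ha, F, hF, b, hb, rfl⟩ := h.exists_carrier hK.mem
    exact ⟨F, hF, (h.isTangent ha hF hb).unique hK⟩
  · intro K hK
    simp only [mem_iUnion] at hK
    obtain ⟨W, hW, x, hK⟩ := hK
    refine ⟨(mem_blowUpLimits hN h𝓑).2 ⟨W, hsub hW, x, K, IsometryEquiv.refl _, hK, (image_id K).symm⟩, ?_⟩
    obtain ⟨m, p, P, 𝒴, h⟩ := hcyl W (hsub hW)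
    obtain ⟨a, ha, F, hF, b, hb, rfl⟩ := h.exists_carrier hK.mem
    rw [hK.unique (h.isTangent ha hF hb)]
    exact ⟨_, _, _, h.isCylinder_tangentCone hF⟩
  · intro Y hY
    obtain ⟨W, hW, x, K, R, hK, rfl⟩ := (mem_blowUpLimits hN h𝓑).1 hY
    obtain ⟨W', hW', R', rfl⟩ := hcov W hW
    obtain ⟨A, b, hR'⟩ := exists_linearIsometryEquiv R'
    obtain ⟨x', hx', rfl⟩ := hK.mem
    obtain ⟨m, p, P, 𝒴, h⟩ := hcyl W' (hsub hW')
    obtain ⟨a, ha, F, hF, b, hb, rfl⟩ := h.exists_carrier hx'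
    have hT := h.isTangent ha hF hb
    refine ⟨tangentCone P 𝒴 F, ?_, A.toIsometryEquiv.trans R, ?_⟩
    · simp only [mem_iUnion]
      exact ⟨W', hW', _, hT⟩
    · rw [hK.unique (hT.image hR'), ← image_comp]
      rfl

end BlowUps

/-! ### The local distance in terms of points -/

section LocalDist

variable {N : ℕ} {x : Euc N} {r δ δ' : ℝ} {F G : Set (Euc N)}

theorem localDist_comm (x : Euc N) (r : ℝ) (F G : Set (Euc N)) :
    localDist x r F G = localDist x r G F := by
  rw [localDist, localDist, sup_comm]

theorem exists_dist_lt_of_localDist_le (hr : 0 < r) (hδ : 0 ≤ δ)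
    (h : localDist x r F G ≤ ENNReal.ofReal δ) (hδδ' : δ < δ') {z : Euc N} (hz : z ∈ G)
    (hzx : dist z x < r) : ∃ w ∈ F, dist z w < δ' * r := by
  have h1 : infEDist z F ≤ ENNReal.ofReal (δ * r) := by
    rw [localDist, ENNReal.div_le_iff (by simpa using hr) ENNReal.ofReal_ne_top,
      ← ENNReal.ofReal_mul hδ] at h
    exact (le_iSup₂_of_le (f := fun z (_ : z ∈ G ∩ ball x r) => infEDist z F) z
      ⟨hz, hzx⟩ le_rfl).trans (le_sup_left.trans h)
  have h2 : infEDist z F < ENNReal.ofReal (δ' * r) :=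
    h1.trans_lt ((ENNReal.ofReal_lt_ofReal_iff (mul_pos (hδ.trans_lt hδδ') hr)).2
      (mul_lt_mul_of_pos_right hδδ' hr))
  obtain ⟨w, hw, hzw⟩ := infEDist_lt_iff.1 h2
  refine ⟨w, hw, ?_⟩
  rw [edist_dist] at hzw
  exact (ENNReal.ofReal_lt_ofReal_iff_of_nonneg dist_nonneg).1 hzw

theorem localDist_le (hr : 0 < r) (h1 : ∀ z ∈ G, dist z x < r → ∃ w ∈ F, dist z w ≤ δ * r)
    (h2 : ∀ z ∈ F, dist z x < r → ∃ w ∈ G, dist z w ≤ δ * r) :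
    localDist x r F G ≤ ENNReal.ofReal δ := by
  rcases le_or_gt 0 δ with hδ | hδ
  · rw [localDist, ENNReal.div_le_iff (by simpa using hr) ENNReal.ofReal_ne_top,
      ← ENNReal.ofReal_mul hδ]
    have key : ∀ A B : Set (Euc N), (∀ z ∈ B, dist z x < r → ∃ w ∈ A, dist z w ≤ δ * r) →
        ⨆ z ∈ B ∩ ball x r, infEDist z A ≤ ENNReal.ofReal (δ * r) := by
      intro A B h
      refine iSup₂_le fun z hz => ?_
      obtain ⟨w, hw, hzw⟩ := h z hz.1 hz.2
      refine (infEDist_le_edist_of_mem hw).trans ?_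
      rw [edist_dist]
      exact ENNReal.ofReal_le_ofReal hzw
    exact sup_le (key F G h1) (key G F h2)
  -- For negative `δ` the right-hand side is 0 in `[0, ∞]`, while the hypotheses leave no points in
  -- the ball.
  · have key : ∀ A B : Set (Euc N), (∀ z ∈ B, dist z x < r → ∃ w ∈ A, dist z w ≤ δ * r) →
        ⨆ z ∈ B ∩ ball x r, infEDist z A ≤ 0 := by
      intro A B h
      refine iSup₂_le fun z hz => ?_
      obtain ⟨w, hw, hzw⟩ := h z hz.1 hz.2
      exact absurd (dist_nonneg.trans hzw) (not_le.2 (mul_neg_of_neg_of_pos hδ hr))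
    have h0 := sup_le (key F G h1) (key G F h2)
    rw [localDist, le_antisymm h0 bot_le, ENNReal.zero_div]
    exact bot_le

end LocalDist

/-! ### Existence of the dilation factor `n₀` -/

section Substitution

variable {n N' N : ℕ} {m k t : ℕ} {W Y K : Set (Euc N)} {x q : Euc N} {s : ℝ}
  {𝓑 : Set (Set (Euc N))}

/-- The carrier of `x` has a vertex `f`. The tangent cone at the point on the ray of `f` has type `m
+ 1`, and a translate of it has the same germ at `x` as `K`. -/
theorem IsCylinder.exists_limit_of_notMem_spine (hN : N' + n ≤ N)
    (h𝓑 : ∀ W ∈ 𝓑, ∃ m ≤ n, IsOfType n N' m W) (hK : K ∈ blowUpLimits 𝓑) {p : Euc N}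
    {P : Submodule ℝ (Euc N)} {𝒴 : Finset (Finset (Euc N))} (h : IsCylinder n N' m K p P 𝒴)
    (hx : x ∈ K) (hxm : x ∉ spine n N' K m) :
    ∃ Y ∈ limitsOfType n N' 𝓑 (m + 1), ∀ᶠ v in 𝓝 (0 : Euc N), x + v ∈ K ↔ x + v ∈ Y := by
  classical
  obtain ⟨a, ha, F, hF, b, hb, rfl⟩ := h.exists_carrier hx
  obtain ⟨f, hf⟩ : F.Nonempty := by
    rw [Finset.nonempty_iff_ne_empty]
    rintro rfl
    apply hxm
    rw [h.mem_spine_self hN]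
    obtain ⟨c, -, hc⟩ := hb
    rw [Finset.sum_empty] at hc
    rw [← hc, add_zero, add_sub_cancel_left]
    exact ha
  have hF' : ({f} : Finset (Euc N)) ∈ faces 𝒴 := faces_subset hF (by simpa using hf)
  have hL := h.isTangent ha hF hb
  set L := tangentCone P 𝒴 F
  obtain ⟨c, hc, hcb⟩ := hb
  have hb' : c f • f ∈ openCone {f} := ⟨c, by simpa using hc f hf, by simp⟩
  have hK₀ := h.isTangent ha hF' hb'
  have hK₀t := h.isOfType_tangentCone hN hF'
  rw [Finset.card_singleton] at hK₀t
  set K₀ := tangentCone P 𝒴 {f}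
  obtain ⟨τ, hτ, hτ0⟩ := ((hK₀.eventually_isTangent (b - c f • f)).and self_mem_nhdsWithin).exists
  have hτ0 : 0 < τ := hτ0
  -- The point moved from the ray of `f` towards `b` has the same carrier as `b`, hence the same
  -- tangent cone `L`; for this `τ` its tangent cone is also that of `K₀` at `b - c f • f`.
  have hmem : c f • f + τ • (b - c f • f) ∈ openCone F := by
    refine ⟨fun y => if y = f then c f else τ * c y, fun y hy => ?_, ?_⟩
    · beta_reduce
      split_ifs
      · exact hc f hf
      · exact mul_pos hτ0 (hc y hy)
    · rw [← Finset.add_sum_erase F _ hf]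
      beta_reduce
      rw [if_pos rfl, ← hcb, ← Finset.add_sum_erase F _ hf,
        add_sub_cancel_left, Finset.smul_sum]
      congr 1
      refine Finset.sum_congr rfl fun y hy => ?_
      rw [if_neg (Finset.ne_of_mem_erase hy), mul_smul]
  have hL' := h.isTangent ha hF hmem
  rw [← add_assoc] at hL'
  have hKL := (hτ _).1 hL'
  refine ⟨IsometryEquiv.addLeft (p + a + c f • f) '' K₀, image_mem_limitsOfType
    ⟨hK₀.mem_blowUpLimits hN h𝓑 hK, hK₀t⟩ _, ?_⟩
  filter_upwards [hL.eventually, hKL.eventually] with v h1 h2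
  rw [h1, mem_image_addLeft, ← h2]
  have : b - c f • f + v = p + a + b + v - (p + a + c f • f) := by abel
  rw [this]

/-- The unit sphere of `Pᗮ` is compact and misses the lowest spine `P`, so the local statement has a
Lebesgue number. -/
theorem IsCylinder.exists_uniform_radius (hN : N' + n ≤ N)
    (h𝓑 : ∀ W ∈ 𝓑, ∃ m ≤ n, IsOfType n N' m W) (hK : K ∈ blowUpLimits 𝓑)
    {P : Submodule ℝ (Euc N)} {𝒴 : Finset (Finset (Euc N))} (h : IsCylinder n N' m K 0 P 𝒴) :
    ∃ ρ > 0, ∀ q ∈ Pᗮ, ‖q‖ = 1 → K ∩ ball q ρ = ∅ ∨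
      ∃ Y ∈ limitsOfType n N' 𝓑 (m + 1), K ∩ ball q ρ = Y ∩ ball q ρ := by
  have hcpt : IsCompact ((Pᗮ : Set (Euc N)) ∩ sphere 0 1) :=
    (isCompact_sphere _ _).inter_left (Submodule.closed_of_finiteDimensional _)
  have hloc : ∀ q : ((Pᗮ : Set (Euc N)) ∩ sphere 0 1 : Set (Euc N)), ∃ ρ > 0,
      K ∩ ball (q : Euc N) ρ = ∅ ∨
      ∃ Y ∈ limitsOfType n N' 𝓑 (m + 1), K ∩ ball (q : Euc N) ρ = Y ∩ ball (q : Euc N) ρ := by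
    rintro ⟨q, hqP, hq⟩
    by_cases hqK : q ∈ K
    · have hqm : q ∉ spine n N' K m := by
        rw [h.mem_spine_self hN, sub_zero]
        intro hqP'
        have : q = 0 := by
          have hm : q ∈ P ⊓ Pᗮ := ⟨hqP', hqP⟩
          rwa [Submodule.inf_orthogonal_eq_bot, Submodule.mem_bot] at hm
        rw [this] at hq
        simp at hq
      obtain ⟨Y, hY, hev⟩ := h.exists_limit_of_notMem_spine hN h𝓑 hK hqK hqm
      obtain ⟨ρ, hρ, hball⟩ := Metric.eventually_nhds_iff.1 hev
      refine ⟨ρ, hρ, Or.inr ⟨Y, hY, ?_⟩⟩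
      ext z
      simp only [mem_inter_iff, mem_ball]
      refine and_congr_left fun hz => ?_
      have := hball (y := z - q) (by rwa [dist_zero_right, ← dist_eq_norm])
      rwa [add_sub_cancel] at this
    · obtain ⟨ρ, hρ, hball⟩ := Metric.isOpen_iff.1 h.isClosed.isOpen_compl q hqK
      refine ⟨ρ, hρ, Or.inl ?_⟩
      ext z
      simp only [mem_inter_iff, mem_empty_iff_false, iff_false, not_and']
      exact fun hz => hball hz
  choose ρ hρ hprop using hloc
  obtain ⟨δ, hδ, hleb⟩ := lebesgue_number_lemma_of_metric
    (c := fun q : ((Pᗮ : Set (Euc N)) ∩ sphere 0 1 : Set (Euc N)) => ball (q : Euc N) (ρ q)) hcpt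
    (fun q => isOpen_ball) (fun q hq => mem_iUnion.2 ⟨⟨q, hq⟩, mem_ball_self (hρ _)⟩)
  refine ⟨δ, hδ, fun q hqP hq => ?_⟩
  obtain ⟨i, hi⟩ := hleb q ⟨hqP, by simpa using hq⟩
  rcases hprop i with he | ⟨Y, hY, he⟩
  · exact Or.inl (subset_eq_empty (inter_subset_inter_right K hi) he)
  · refine Or.inr ⟨Y, hY, ?_⟩
    rw [← inter_eq_right.2 hi, ← inter_assoc, ← inter_assoc, he]

/-- `D` is a factor such that a set of type `m` whose `m`-spine misses the ball `D B` is empty or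
coincides with a set of type `m + 1` in the ball `B`. -/
def IsLocalFactor (n N' : ℕ) (𝓑 : Set (Set (Euc N))) (W : Set (Euc N)) (D : ℝ) : Prop :=
  ∀ m, W ∈ limitsOfType n N' 𝓑 m → ∀ (q : Euc N) (s : ℝ), 0 < s →
    ball q (D * s) ∩ spine n N' W m = ∅ → W ∩ ball q s = ∅ ∨
      ∃ Y ∈ limitsOfType n N' 𝓑 (m + 1), W ∩ ball q s = Y ∩ ball q s

theorem IsLocalFactor.mono {D D' : ℝ} (h : IsLocalFactor n N' 𝓑 W D) (hD : D ≤ D') :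
    IsLocalFactor n N' 𝓑 W D' := fun m hm q s hs hq => h m hm q s hs
  (subset_eq_empty (inter_subset_inter_left _
    (ball_subset_ball (mul_le_mul_of_nonneg_right hD hs.le))) hq)

/-- `K` is invariant under translations along `P` and under dilations centered on `P`, so every ball
off the spine can be moved to one centered on the unit sphere of `Pᗮ`. -/
theorem IsCylinder.exists_isLocalFactor (hN : N' + n ≤ N)
    (h𝓑 : ∀ W ∈ 𝓑, ∃ m ≤ n, IsOfType n N' m W) (hK : K ∈ blowUpLimits 𝓑)
    {P : Submodule ℝ (Euc N)} {𝒴 : Finset (Finset (Euc N))} (h : IsCylinder n N' m K 0 P 𝒴) :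
    ∃ D, IsLocalFactor n N' 𝓑 K D := by
  obtain ⟨ρ, hρ, hloc⟩ := h.exists_uniform_radius hN h𝓑 hK
  refine ⟨ρ⁻¹, fun m' hm' q s hs hq => ?_⟩
  have hle := h.le
  obtain rfl : m' = m := hm'.2.unique hN (h.isOfType (by omega))
  set u := Pᗮ.starProjection q with hu
  have huP : u ∈ Pᗮ := Submodule.starProjection_apply_mem _ _
  have haP : q - u ∈ P := by
    have := Submodule.sub_starProjection_mem_orthogonal (K := Pᗮ) q
    rwa [Submodule.orthogonal_orthogonal] at this
  -- The norm of `u` is the distance from `q` to the plane `P`, which is the `m`-spine; the ball of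
  -- radius `ρ⁻¹ s` misses it.
  have hl : s ≤ ρ * ‖u‖ := by
    by_contra hlt
    rw [not_le] at hlt
    have : q - u ∈ ball q (ρ⁻¹ * s) ∩ spine n N' K m' := by
      refine ⟨?_, ?_⟩
      · rw [mem_ball, dist_eq_norm, sub_sub_cancel_left, norm_neg, lt_inv_mul_iff₀ hρ]
        exact hlt
      · rw [h.mem_spine_self hN, sub_zero]
        exact haP
    rw [hq] at this
    exact this
  have hu0 : 0 < ‖u‖ := by
    by_contra h0
    have : ‖u‖ = 0 := le_antisymm (not_lt.1 h0) (norm_nonneg _)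
    rw [this, mul_zero] at hl
    exact absurd hs (not_lt.2 hl)
  have hKw : ∀ z, z ∈ K ↔ ‖u‖⁻¹ • (z - (q - u)) ∈ K := by
    intro z
    rw [h.eq_cylinder, mem_cylinder h.support_subset, mem_cylinder h.support_subset, sub_zero,
      sub_zero, map_smul, map_sub, (Submodule.starProjection_apply_eq_zero_iff Pᗮ (v := q - u)).2
      (by rwa [Submodule.orthogonal_orthogonal]), sub_zero]
    refine ⟨fun h => smul_mem_support h (inv_pos.2 hu0).le, fun h => ?_⟩
    have := smul_mem_support h hu0.le
    rwa [smul_smul, mul_inv_cancel₀ hu0.ne', one_smul] at this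
  have hball : ∀ z ∈ ball q s, ‖u‖⁻¹ • (z - (q - u)) ∈ ball (‖u‖⁻¹ • u) ρ := by
    intro z hz
    rw [mem_ball, dist_eq_norm] at hz ⊢
    rw [← smul_sub, norm_smul, norm_inv, norm_norm, inv_mul_lt_iff₀ hu0]
    have : z - (q - u) - u = z - q := by abel
    rw [this, mul_comm]
    exact hz.trans_le hl
  rcases hloc (‖u‖⁻¹ • u) (Submodule.smul_mem _ _ huP)
    (by rw [norm_smul, norm_inv, norm_norm, inv_mul_cancel₀ hu0.ne']) with he | ⟨Y, hY, he⟩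
  · left
    ext z
    simp only [mem_inter_iff, mem_empty_iff_false, iff_false, not_and']
    intro hz hzK
    have := mem_inter ((hKw z).1 hzK) (hball z hz)
    rw [he] at this
    exact this
  · right
    obtain ⟨Y', hY', hYY'⟩ := exists_homothety_mem_limitsOfType hN hY hu0 (q - u)
    refine ⟨Y', hY', ?_⟩
    ext z
    simp only [mem_inter_iff]
    refine and_congr_left fun hz => ?_
    have := Set.ext_iff.1 he (‖u‖⁻¹ • (z - (q - u)))
    simp only [mem_inter_iff, hball z hz, and_true] at this
    rw [hKw, hYY', this]

theorem image_inter_ball (R : Euc N ≃ᵢ Euc N) (W : Set (Euc N)) (q : Euc N) (s : ℝ) :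
    R '' W ∩ ball q s = R '' (W ∩ ball (R.symm q) s) := by
  rw [image_inter R.injective, R.image_ball, R.apply_symm_apply]

/-- The factor is unaffected by isometries and may be increased, so a common bound over the finitely
many models serves. -/
theorem exists_isLocalFactor (hN : N' + n ≤ N) (h𝓑 : ∀ W ∈ 𝓑, ∃ m ≤ n, IsOfType n N' m W)
    (hfin : FiniteModIsometry 𝓑) :
    ∃ D, 1 ≤ D ∧ ∀ W ∈ blowUpLimits 𝓑, IsLocalFactor n N' 𝓑 W D := by
  obtain ⟨𝒢, h𝒢, hmod, hcov⟩ := exists_finite_models hN h𝓑 hfin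
  have hex : ∀ K ∈ 𝒢, ∃ D, IsLocalFactor n N' 𝓑 K D := by
    intro K hK
    obtain ⟨hKA, m, P, 𝒴, h⟩ := hmod K hK
    exact h.exists_isLocalFactor hN h𝓑 hKA
  choose! D hD using hex
  obtain ⟨M, hM⟩ := (h𝒢.image D).bddAbove
  refine ⟨max M 1, le_max_right _ _, fun W hW m hm q s hs hq => ?_⟩
  obtain ⟨K, hK, R, rfl⟩ := hcov W hW
  have hKD := (hD K hK).mono ((hM (mem_image_of_mem D hK)).trans (le_max_left M 1))
  have hKm : K ∈ limitsOfType n N' 𝓑 m := by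
    have := image_mem_limitsOfType hm R.symm
    rwa [image_symm_image] at this
  have hq' : ball (R.symm q) (max M 1 * s) ∩ spine n N' K m = ∅ := by
    rw [spine_image, inter_comm, image_inter_ball, image_eq_empty, inter_comm] at hq
    exact hq
  rcases hKD m hKm (R.symm q) s hs hq' with he | ⟨Y, hY, he⟩
  · left
    rw [image_inter_ball, he, image_empty]
  · right
    exact ⟨R '' Y, image_mem_limitsOfType hY R, by rw [image_inter_ball, he, ← image_inter_ball]⟩

theorem IsTangentType.congr {W' : Set (Euc N)} (h : IsTangentType n N' W x k)
    (hW : ∀ᶠ v in 𝓝 (0 : Euc N), x + v ∈ W ↔ x + v ∈ W') : IsTangentType n N' W' x k := by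
  obtain ⟨K, hK, hk⟩ := h
  exact ⟨K, hK.congr hW, hk⟩

/-- Spines are determined by tangent cones, hence by germs. -/
theorem spine_inter_ball_subset (hN : N' + n ≤ N) (hW : IsOfType n N' m W)
    (hY : IsOfType n N' k Y) (h : W ∩ ball q s = Y ∩ ball q s) :
    spine n N' W t ∩ ball q s ⊆ spine n N' Y t ∩ ball q s := by
  rintro x ⟨hx, hxq⟩
  refine ⟨?_, hxq⟩
  rw [mem_spine hN hW] at hx
  rw [mem_spine hN hY]
  obtain ⟨htn, l, hl, hx⟩ := hx
  refine ⟨htn, l, hl, hx.congr ?_⟩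
  have htend : Tendsto (fun v : Euc N => x + v) (𝓝 0) (𝓝 x) := by
    have : ContinuousAt (fun v : Euc N => x + v) 0 := by fun_prop
    simpa using this.tendsto
  filter_upwards [htend.eventually (isOpen_ball.mem_nhds hxq)] with v hv
  have := Set.ext_iff.1 h (x + v)
  simp only [mem_inter_iff] at this
  exact ⟨fun hw => (this.1 ⟨hw, hv⟩).1, fun hw => (this.2 ⟨hw, hv⟩).1⟩

/-- Each application of the local factor raises the type by one at the cost of a factor `D`.
Locality of spines carries the missing spine over to the new set. -/
theorem exists_limit_of_ball_inter_spine_eq_empty (hN : N' + n ≤ N) {D : ℝ} (hD1 : 1 ≤ D)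
    (hD : ∀ W ∈ blowUpLimits 𝓑, IsLocalFactor n N' 𝓑 W D) (j : ℕ) :
    ∀ m, ∀ W ∈ limitsOfType n N' 𝓑 m, m + j ≤ n → ∀ (q : Euc N) (s : ℝ), 0 < s →
      ball q (D ^ (j + 1) * s) ∩ spine n N' W (m + j) = ∅ → W ∩ ball q s = ∅ ∨
      ∃ Y ∈ limitsOfType n N' 𝓑 (m + j + 1), W ∩ ball q s = Y ∩ ball q s := by
  induction j with
  | zero =>
    intro m W hW _ q s hs hq
    rw [zero_add, pow_one] at hq
    exact hD W hW.1 m hW q s hs hq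
  | succ j ih =>
    intro m W hW hmj q s hs hq
    have hpos : 0 < D ^ (j + 1) * s := by positivity
    have hle : s ≤ D ^ (j + 1) * s := le_mul_of_one_le_left hs.le (one_le_pow₀ hD1)
    have hsub := ball_subset_ball (x := q) hle
    have hq1 : ball q (D * (D ^ (j + 1) * s)) ∩ spine n N' W m = ∅ := by
      rw [← mul_assoc, ← pow_succ']
      exact subset_eq_empty (inter_subset_inter_right _ (spine_mono hN (by omega) hmj)) hq
    rcases hD W hW.1 m hW q _ hpos hq1 with he | ⟨Y, hY, he⟩
    · exact Or.inl (subset_eq_empty (inter_subset_inter_right _ hsub) he)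
    · have hWY : W ∩ ball q s = Y ∩ ball q s := by
        rw [← inter_eq_right.2 hsub, ← inter_assoc, ← inter_assoc, he]
      have hmj' : m + 1 + j = m + (j + 1) := by omega
      have hqY : ball q (D ^ (j + 1) * s) ∩ spine n N' Y (m + 1 + j) = ∅ := by
        rw [hmj', inter_comm]
        refine subset_eq_empty (spine_inter_ball_subset hN hY.2 hW.2 he.symm) ?_
        rw [inter_comm]
        refine subset_eq_empty (inter_subset_inter_left _ (ball_subset_ball ?_)) hq
        rw [pow_succ D (j + 1), mul_assoc]
        gcongr
        exact le_mul_of_one_le_left hs.le hD1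
      rcases ih (m + 1) Y hY (by omega) q s hs hqY with he' | ⟨Y', hY', he'⟩
      · exact Or.inl (by rw [hWY, he'])
      · exact Or.inr ⟨Y', by rwa [hmj'] at hY', by rw [hWY, he']⟩

/-- The second clause of `IsSubstituting` also concerns balls that miss `W`, and there a limit of
prescribed type missing the ball is needed. A tangent cone of type `t < N` is not the whole space,
as its translations have dimension `t`; dilation makes an omitted ball as large as required. -/
theorem exists_limit_inter_ball_eq_empty (hnN : n < N) (hN : N' + n ≤ N)
    (h𝓑 : ∀ W ∈ 𝓑, ∃ m ≤ n, IsOfType n N' m W) (hW : W ∈ limitsOfType n N' 𝓑 m) (hmt : m ≤ t)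
    (htn : t ≤ n) (q : Euc N) (hs : 0 < s) :
    ∃ Y ∈ limitsOfType n N' 𝓑 t, Y ∩ ball q s = ∅ := by
  obtain ⟨p, P, 𝒴, h⟩ := hW.2.exists_isCylinder hN
  obtain ⟨X, hX⟩ := h.cone.1
  have hcard := (h.cone.2.1 X hX).2
  obtain ⟨F, hFX, hF⟩ := Finset.exists_subset_card_eq (show t - m ≤ X.card by omega)
  have hFf : F ∈ faces 𝒴 := ⟨X, hX, hFX⟩
  have hT := h.isTangent (Submodule.zero_mem P) hFf (sum_mem_openCone F)
  have hcyl := h.isCylinder_tangentCone hFf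
  have htype := h.isOfType_tangentCone hN hFf
  rw [hF, Nat.add_sub_cancel' hmt] at hcyl htype
  set K := tangentCone P 𝒴 F
  have hKt : K ∈ limitsOfType n N' 𝓑 t := ⟨hT.mem_blowUpLimits hN h𝓑 hW.1, htype⟩
  obtain ⟨z, hz⟩ : ∃ z, z ∉ K := by
    by_contra hall
    push Not at hall
    have htop : P ⊔ Submodule.span ℝ (F : Set (Euc N)) = ⊤ := by
      rw [Submodule.eq_top_iff']
      intro v
      rw [← hcyl.mem_of_invariant]
      exact fun w => ⟨fun _ => hall _, fun _ => hall _⟩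
    have := hcyl.finrank_eq
    rw [htop, finrank_top, finrank_euclideanSpace_fin] at this
    omega
  obtain ⟨ρ, hρ, hball⟩ := Metric.isOpen_iff.1 hcyl.isClosed.isOpen_compl z hz
  obtain ⟨Y, hY, hYK⟩ := exists_homothety_mem_limitsOfType hN hKt (div_pos hs hρ)
    (q - (s / ρ) • z)
  refine ⟨Y, hY, ?_⟩
  ext w
  simp only [mem_inter_iff, mem_empty_iff_false, iff_false, not_and']
  intro hw
  rw [hYK]
  apply hball
  rw [mem_ball, dist_eq_norm] at hw ⊢
  have hc : s / ρ ≠ 0 := (div_pos hs hρ).ne'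
  have e : (s / ρ)⁻¹ • (w - (q - (s / ρ) • z)) - z = (s / ρ)⁻¹ • (w - q) := by
    have : (s / ρ)⁻¹ • (s / ρ) • z = z := by rw [smul_smul, inv_mul_cancel₀ hc, one_smul]
    simp only [smul_sub, this]
    abel
  rw [e, norm_smul, norm_inv, Real.norm_of_nonneg (div_pos hs hρ).le,
    inv_mul_lt_iff₀ (div_pos hs hρ), div_mul_cancel₀ _ hρ.ne']
  exact hw

theorem isSubstituting_of_isLocalFactor (hnN : n < N) (hN : N' + n ≤ N)
    (h𝓑 : ∀ W ∈ 𝓑, ∃ m ≤ n, IsOfType n N' m W) {D n₀ : ℝ} (hD1 : 1 ≤ D)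
    (hD : ∀ W ∈ blowUpLimits 𝓑, IsLocalFactor n N' 𝓑 W D) (hn₀ : D ^ (n + 1) ≤ n₀) :
    IsSubstituting n N' 𝓑 n₀ := by
  intro m t hmt htn W hW y s hs
  -- Type exactly `t + 1` gives the first clause, and by contraposition the second.
  have key : ball y (n₀ * s) ∩ spine n N' W t = ∅ →
      ∃ Y ∈ limitsOfType n N' 𝓑 (t + 1), W ∩ ball y s = Y ∩ ball y s := by
    intro hq
    have hq' : ball y (D ^ (t - m + 1) * s) ∩ spine n N' W (m + (t - m)) = ∅ := by
      rw [Nat.add_sub_cancel' hmt]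
      refine subset_eq_empty (inter_subset_inter_left _ (ball_subset_ball ?_)) hq
      exact mul_le_mul_of_nonneg_right
        ((pow_le_pow_right₀ hD1 (by omega)).trans hn₀) hs.le
    rcases exists_limit_of_ball_inter_spine_eq_empty hN hD1 hD (t - m) m W hW (by omega) y s hs hq'
      with he | ⟨Y, hY, he⟩
    · obtain ⟨Y, hY, hYe⟩ := exists_limit_inter_ball_eq_empty hnN hN h𝓑 hW
        (hmt.trans (Nat.le_succ t)) htn y hs
      exact ⟨Y, hY, by rw [he, hYe]⟩
    · rw [Nat.add_sub_cancel' hmt] at hY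
      exact ⟨Y, hY, he⟩
  refine ⟨fun _ hq => ?_, fun hne => ?_⟩
  · obtain ⟨Y, hY, he⟩ := key hq
    exact ⟨t + 1, le_rfl, htn, Y, hY, he⟩
  · by_contra hemp
    rw [not_nonempty_iff_eq_empty] at hemp
    obtain ⟨Y, hY, he⟩ := key hemp
    exact hne Y hY he

end Substitution

/-! ### Limits along ultrafilters -/

section Limits

variable {N : ℕ}

/-- The closed unit ball of operators is compact; the limit preserves norms and is bijective because
the dimension is finite. -/
theorem exists_tendsto_linearIsometryEquiv (𝒰 : Ultrafilter ℕ) (B : ℕ → Euc N ≃ₗᵢ[ℝ] Euc N) :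
    ∃ B' : Euc N ≃ₗᵢ[ℝ] Euc N, ∀ v, Tendsto (fun i => B i v) 𝒰 (𝓝 (B' v)) := by
  let T : ℕ → Euc N →L[ℝ] Euc N := fun i => (B i).toLinearIsometry.toContinuousLinearMap
  have hT : ∀ i, T i ∈ closedBall (0 : Euc N →L[ℝ] Euc N) 1 := fun i => by
    rw [mem_closedBall_zero_iff]
    exact (B i).toLinearIsometry.norm_toContinuousLinearMap_le
  obtain ⟨T', -, hT'⟩ := (isCompact_closedBall (0 : Euc N →L[ℝ] Euc N) 1).ultrafilter_le_nhds
    (𝒰.map T) (le_principal_iff.2 (Ultrafilter.mem_map.2 (univ_mem' hT)))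
  have htend : Tendsto T 𝒰 (𝓝 T') := hT'
  have hpt : ∀ v, Tendsto (fun i => B i v) 𝒰 (𝓝 (T' v)) := fun v =>
    ((ContinuousLinearMap.apply ℝ (Euc N) v).continuous.tendsto T').comp htend
  have hnorm : ∀ v, ‖T' v‖ = ‖v‖ := by
    intro v
    refine tendsto_nhds_unique (hpt v).norm ?_
    simp only [LinearIsometryEquiv.norm_map]
    exact tendsto_const_nhds
  exact ⟨LinearIsometry.toLinearIsometryEquiv ⟨T'.toLinearMap, hnorm⟩ rfl, hpt⟩

theorem exists_eventually_eq {α : Type*} (𝒰 : Ultrafilter ℕ) {S : Set α} (hS : S.Finite)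
    {f : ℕ → α} (hf : ∀ i, f i ∈ S) : ∃ a ∈ S, ∀ᶠ i in 𝒰, f i = a := by
  obtain ⟨a, ha, h⟩ := Ultrafilter.eq_pure_of_finite_mem (f := 𝒰.map f) hS
    (Eventually.of_forall hf : ∀ᶠ i in (𝒰 : Filter ℕ), f i ∈ S)
  refine ⟨a, ha, ?_⟩
  have : {a} ∈ 𝒰.map f := by rw [h]; exact Ultrafilter.mem_pure.2 rfl
  exact this

end Limits

/-! ### Existence of the separation constant `δ₀` -/

section Separation

variable {n N' N : ℕ} {m k t : ℕ} {W Y K K' : Set (Euc N)} {x q : Euc N} {s : ℝ}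
  {𝓑 : Set (Set (Euc N))}

/-- While the lowest spine stays away from the ball, the set is replaced by one of the next type;
this stops because types do not exceed `n`. -/
theorem exists_limit_spine_near {D : ℝ}
    (hD : ∀ W ∈ blowUpLimits 𝓑, IsLocalFactor n N' 𝓑 W D) (j : ℕ) :
    ∀ m, n ≤ m + j → ∀ W ∈ limitsOfType n N' 𝓑 m, ∀ (q : Euc N) (s : ℝ), 0 < s →
      (W ∩ ball q s).Nonempty → ∃ k, ∃ Y ∈ limitsOfType n N' 𝓑 k, W ∩ ball q s = Y ∩ ball q s ∧
        (ball q (D * s) ∩ spine n N' Y k).Nonempty := by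
  induction j with
  | zero =>
    intro m hm W hW q s hs hWq
    refine ⟨m, W, hW, rfl, ?_⟩
    by_contra hemp
    rw [not_nonempty_iff_eq_empty] at hemp
    rcases hD W hW.1 m hW q s hs hemp with he | ⟨Y, hY, -⟩
    · exact hWq.ne_empty he
    · have := hY.2.le
      omega
  | succ j ih =>
    intro m hm W hW q s hs hWq
    by_cases hemp : (ball q (D * s) ∩ spine n N' W m).Nonempty
    · exact ⟨m, W, hW, rfl, hemp⟩
    · rw [not_nonempty_iff_eq_empty] at hemp
      rcases hD W hW.1 m hW q s hs hemp with he | ⟨Y, hY, he⟩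
      · exact absurd he hWq.ne_empty
      · obtain ⟨k, Y', hY', he', hne⟩ := ih (m + 1) (by omega) Y hY q s hs (by rwa [← he])
        exact ⟨k, Y', hY', by rw [he, he'], hne⟩

/-- Every blow-up limit is, in a given ball, a rescaled copy of one of finitely many models, seen
from a point at bounded distance of the origin. -/
theorem exists_normal_form (hN : N' + n ≤ N) {D : ℝ}
    (hD : ∀ W ∈ blowUpLimits 𝓑, IsLocalFactor n N' 𝓑 W D) {𝒢 : Set (Set (Euc N))}
    (hmod : ∀ K ∈ 𝒢, K ∈ blowUpLimits 𝓑 ∧ ∃ m P 𝒴, IsCylinder n N' m K 0 P 𝒴)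
    (hcov : ∀ Y ∈ blowUpLimits 𝓑, ∃ K ∈ 𝒢, ∃ R : Euc N ≃ᵢ Euc N, Y = R '' K)
    (hW : W ∈ limitsOfType n N' 𝓑 m) (hs : 0 < s) (hWq : (W ∩ ball q s).Nonempty) :
    ∃ K ∈ 𝒢, ∃ (A : Euc N ≃ₗᵢ[ℝ] Euc N) (g : Euc N), ‖g‖ ≤ D ∧
      ∀ v, ‖v‖ < 1 → (q + s • v ∈ W ↔ g + A v ∈ K) := by
  obtain ⟨k, Y, hY, he, z, hzq, hz⟩ := exists_limit_spine_near hD n m (by omega) W hW q s hs hWq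
  obtain ⟨K, hK, R, rfl⟩ := hcov Y hY.1
  obtain ⟨hKA, k', P, 𝒴, h⟩ := hmod K hK
  have hle := h.le
  have hKk : IsOfType n N' k K := by
    have := hY.2.image R.symm
    rwa [image_symm_image] at this
  obtain rfl := hKk.unique hN (h.isOfType (by omega))
  obtain ⟨A, b, hR⟩ := exists_linearIsometryEquiv R
  rw [spine_image] at hz
  obtain ⟨u, hu, rfl⟩ := hz
  rw [h.mem_spine_self hN, sub_zero] at hu
  -- The base point is the rescaled position of `q` relative to the spine point `R u`, which lies
  -- within `D s` of `q`. The component `u ∈ P` may be dropped by invariance.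
  refine ⟨K, hK, A.symm, s⁻¹ • A.symm (q - R u), ?_, fun v hv => ?_⟩
  · rw [norm_smul, norm_inv, Real.norm_of_nonneg hs.le, LinearIsometryEquiv.norm_map,
      inv_mul_le_iff₀ hs, mul_comm, ← dist_eq_norm, dist_comm]
    exact (mem_ball.1 hzq).le
  · have hvq : q + s • v ∈ ball q s := by
      rw [mem_ball, dist_eq_norm, add_sub_cancel_left, norm_smul, Real.norm_of_nonneg hs.le]
      exact mul_lt_of_lt_one_right hs hv
    have h1 := Set.ext_iff.1 he (q + s • v)
    simp only [mem_inter_iff, hvq, and_true] at h1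
    have h2 : q + s • v ∈ R '' K ↔ A.symm (q + s • v - b) ∈ K := by
      constructor
      · rintro ⟨w, hw, hwe⟩
        rw [← hwe, hR, add_sub_cancel_left, A.symm_apply_apply]
        exact hw
      · intro hw
        exact ⟨_, hw, by rw [hR, A.apply_symm_apply, add_sub_cancel]⟩
    have h3 : A.symm (q + s • v - b) = s • (s⁻¹ • A.symm (q - R u) + A.symm v) + u := by
      rw [smul_add, smul_smul, mul_inv_cancel₀ hs.ne', one_smul, hR, ← map_smul, ← map_add]
      apply A.injective
      rw [map_add, A.apply_symm_apply, A.apply_symm_apply]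
      abel
    have h4 : ∀ w, s • w + u ∈ K ↔ w ∈ K := by
      intro w
      rw [← h.mem_of_invariant.2 hu]
      rw [h.eq_cylinder, mem_cylinder h.support_subset, mem_cylinder h.support_subset, sub_zero,
        sub_zero, map_smul]
      refine ⟨fun hw => ?_, fun hw => smul_mem_support hw hs.le⟩
      have := smul_mem_support hw (inv_pos.2 hs).le
      rwa [smul_smul, inv_mul_cancel₀ hs.ne', one_smul] at this
    rw [h1, h2, h3, h4]

theorem IsTangentType.of_normal_form (hs : 0 < s) {A : Euc N ≃ₗᵢ[ℝ] Euc N} {g v₀ : Euc N}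
    (h : ∀ v, ‖v‖ < 1 → (q + s • v ∈ W ↔ g + A v ∈ K)) (hv₀ : ‖v₀‖ < 1)
    (hW : IsTangentType n N' W (q + s • v₀) k) : IsTangentType n N' K (g + A v₀) k := by
  obtain ⟨L, hL, hk⟩ := hW
  refine ⟨A '' L, ⟨?_, ⟨0, hL.zero_mem, map_zero A⟩, ?_⟩, hk.image A.toIsometryEquiv⟩
  · rintro _ ⟨v, hv, rfl⟩ t ht
    exact ⟨t • v, hL.smul_mem v hv t ht, map_smul A t v⟩
  · have h1 : Tendsto (fun w : Euc N => s • A.symm w) (𝓝 0) (𝓝 0) := by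
      have : Continuous fun w : Euc N => s • A.symm w := by fun_prop
      simpa using this.tendsto 0
    have h2 : Tendsto (fun w : Euc N => v₀ + A.symm w) (𝓝 0) (𝓝 v₀) := by
      have : Continuous fun w : Euc N => v₀ + A.symm w := by fun_prop
      simpa using this.tendsto 0
    have h3 : ∀ᶠ v in 𝓝 v₀, ‖v‖ < 1 := continuous_norm.continuousAt.eventually (gt_mem_nhds hv₀)
    filter_upwards [h1.eventually hL.eventually, h2.eventually h3] with w hw1 hw2
    have e1 : g + A v₀ + w = g + A (v₀ + A.symm w) := by
      rw [map_add, A.apply_symm_apply, add_assoc]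
    have e2 : q + s • (v₀ + A.symm w) = q + s • v₀ + s • A.symm w := by
      rw [smul_add, add_assoc]
    have e3 : w ∈ A '' L ↔ A.symm w ∈ L := by
      constructor
      · rintro ⟨w, hw, rfl⟩
        rwa [A.symm_apply_apply]
      · exact fun hw => ⟨_, hw, A.apply_symm_apply w⟩
    rw [e1, ← h _ hw2, e2, hw1, e3, hL.smul_mem_iff hs]

/-- The two models `K - g` and `B⁻¹ (K' - g')` are `δ`-close near the origin, while the tangent
cone of the first one at the origin is of type at most `t` and the tangent cones of the second one
near the origin are of type greater than `t`. -/
structure IsClosePair (n N' t : ℕ) (K K' : Set (Euc N)) (g g' : Euc N) (B : Euc N ≃ₗᵢ[ℝ] Euc N)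
    (δ : ℝ) : Prop where
  exists_right : ∀ v, ‖v‖ < 1 / 2 → g + v ∈ K → ∃ w, ‖w - v‖ < δ ∧ g' + B w ∈ K'
  exists_left : ∀ w, ‖w‖ < 1 / 2 → g' + B w ∈ K' → ∃ v, ‖v - w‖ < δ ∧ g + v ∈ K
  mem_spine : g ∈ spine n N' K t
  lt : ∀ w, ‖w‖ < 1 → g' + B w ∈ K' → ∀ l, IsTangentType n N' K' (g' + B w) l → t < l

/-- Along an ultrafilter the models and indices are eventually constant, and base points and
rotations converge. The limit models agree near the base points, and the first has tangent type at
most `t` at `g₀` because spines are closed; yet `g₀'` is visible in the pairs close to the limit,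
where all types exceed `t`. -/
theorem not_isClosePair_seq (hN : N' + n ≤ N) {𝒢 : Set (Set (Euc N))} (h𝒢 : 𝒢.Finite)
    (hmod : ∀ K ∈ 𝒢, ∃ m, IsOfType n N' m K) (D : ℝ) (t : ℕ → ℕ) (K K' : ℕ → Set (Euc N))
    (g g' : ℕ → Euc N) (B : ℕ → Euc N ≃ₗᵢ[ℝ] Euc N) (δ : ℕ → ℝ) (ht : ∀ i, t i < n)
    (hK : ∀ i, K i ∈ 𝒢) (hK' : ∀ i, K' i ∈ 𝒢) (hg : ∀ i, ‖g i‖ ≤ D) (hg' : ∀ i, ‖g' i‖ ≤ D)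
    (hδ : Tendsto δ atTop (𝓝 0)) :
    ¬ ∀ i, IsClosePair n N' (t i) (K i) (K' i) (g i) (g' i) (B i) (δ i) := by
  intro h
  let 𝒰 : Ultrafilter ℕ := hyperfilter ℕ
  have hδ : Tendsto δ 𝒰 (𝓝 0) := hδ.mono_left Nat.hyperfilter_le_atTop
  obtain ⟨K₀, hK₀, hKe⟩ := exists_eventually_eq 𝒰 h𝒢 hK
  obtain ⟨K₀', hK₀', hKe'⟩ := exists_eventually_eq 𝒰 h𝒢 hK'
  obtain ⟨t₀, ht₀, hte⟩ := exists_eventually_eq 𝒰 (finite_lt_nat n) (f := t) ht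
  have hcpt : ∀ g : ℕ → Euc N, (∀ i, ‖g i‖ ≤ D) → ∃ g₀, Tendsto g 𝒰 (𝓝 g₀) := by
    intro g hg
    obtain ⟨g₀, -, hg₀⟩ := (isCompact_closedBall (0 : Euc N) D).ultrafilter_le_nhds (𝒰.map g)
      (le_principal_iff.2 (Ultrafilter.mem_map.2 (univ_mem' fun i =>
        mem_closedBall_zero_iff.2 (hg i))))
    exact ⟨g₀, hg₀⟩
  obtain ⟨g₀, hg₀⟩ := hcpt g hg
  obtain ⟨g₀', hg₀'⟩ := hcpt g' hg'
  obtain ⟨B₀, hB₀⟩ := exists_tendsto_linearIsometryEquiv 𝒰 B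
  have hev : ∀ᶠ i in 𝒰, IsClosePair n N' t₀ K₀ K₀' (g i) (g' i) (B i) (δ i) := by
    filter_upwards [hKe, hKe', hte] with i h1 h2 h3
    have := h i
    rwa [h1, h2, h3] at this
  obtain ⟨m, hm⟩ := hmod K₀ hK₀
  obtain ⟨m', hm'⟩ := hmod K₀' hK₀'
  have hmem : ∀ w, Tendsto (fun i => (B i).symm (g₀' + B₀ w - g' i)) 𝒰 (𝓝 w) := by
    intro w
    rw [tendsto_iff_dist_tendsto_zero]
    have e : ∀ i, dist ((B i).symm (g₀' + B₀ w - g' i)) w = ‖(g₀' - g' i) + (B₀ w - B i w)‖ := by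
      intro i
      rw [← (B i).dist_map, (B i).apply_symm_apply, dist_eq_norm]
      congr 1
      abel
    simp only [e]
    have := ((tendsto_const_nhds (x := g₀')).sub hg₀').add
      ((tendsto_const_nhds (x := B₀ w)).sub (hB₀ w))
    simpa using this.norm
  have hiff : ∀ v, ‖v‖ < 1 / 2 → (g₀ + v ∈ K₀ ↔ g₀' + B₀ v ∈ K₀') := by
    intro v hv
    constructor
    · intro hvK
      rw [← (hm'.isClosed hN).closure_eq, Metric.mem_closure_iff]
      intro η hη
      have e1 : Tendsto (fun i => g₀ + v - g i) 𝒰 (𝓝 v) := by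
        simpa using (tendsto_const_nhds (x := g₀ + v)).sub hg₀
      have e2 : Tendsto (fun i => ‖g₀' - g' i‖ + ‖B₀ v - B i v‖ + δ i + ‖g₀ + v - g i - v‖) 𝒰
          (𝓝 0) := by
        have a1 := ((tendsto_const_nhds (x := g₀')).sub hg₀').norm
        have a2 := ((tendsto_const_nhds (x := B₀ v)).sub (hB₀ v)).norm
        have a3 := (e1.sub (tendsto_const_nhds (x := v))).norm
        simpa using ((a1.add a2).add hδ).add a3
      obtain ⟨i, hi, hi1, hi2⟩ := (hev.and ((e1.eventually (continuous_norm.continuousAt.eventually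
        (gt_mem_nhds hv))).and (e2.eventually (gt_mem_nhds hη)))).exists
      obtain ⟨w, hw, hwK⟩ := hi.exists_right _ hi1 (by simpa using hvK)
      refine ⟨_, hwK, lt_of_le_of_lt ?_ hi2⟩
      have e3 : g₀' + B₀ v - (g' i + B i w) =
          (g₀' - g' i) + (B₀ v - B i v) - B i (w - (g₀ + v - g i)) - B i (g₀ + v - g i - v) := by
        simp only [map_sub]
        abel
      rw [dist_eq_norm, e3]
      refine (norm_sub_le _ _).trans ?_
      rw [(B i).norm_map]
      gcongr
      refine (norm_sub_le _ _).trans ?_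
      rw [(B i).norm_map]
      exact add_le_add (norm_add_le _ _) hw.le
    · intro hvK
      rw [← (hm.isClosed hN).closure_eq, Metric.mem_closure_iff]
      intro η hη
      have e1 := hmem v
      have e2 : Tendsto (fun i => ‖g₀ - g i‖ + δ i + ‖(B i).symm (g₀' + B₀ v - g' i) - v‖) 𝒰
          (𝓝 0) := by
        have a1 := ((tendsto_const_nhds (x := g₀)).sub hg₀).norm
        have a3 := (e1.sub (tendsto_const_nhds (x := v))).norm
        simpa using (a1.add hδ).add a3
      obtain ⟨i, hi, hi1, hi2⟩ := (hev.and ((e1.eventually (continuous_norm.continuousAt.eventually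
        (gt_mem_nhds hv))).and (e2.eventually (gt_mem_nhds hη)))).exists
      obtain ⟨w, hw, hwK⟩ := hi.exists_left _ hi1 (by
        rw [(B i).apply_symm_apply, add_sub_cancel]
        exact hvK)
      refine ⟨_, hwK, lt_of_le_of_lt ?_ hi2⟩
      have e3 : g₀ + v - (g i + w) = (g₀ - g i) - (w - (B i).symm (g₀' + B₀ v - g' i)) -
          ((B i).symm (g₀' + B₀ v - g' i) - v) := by
        abel
      rw [dist_eq_norm, e3]
      refine (norm_sub_le _ _).trans ?_
      gcongr
      exact (norm_sub_le _ _).trans (add_le_add le_rfl hw.le)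
  have hspine : g₀ ∈ spine n N' K₀ t₀ := by
    have hcl := isClosed_spine (t := t₀) hN hm (le_of_lt ht₀)
    exact hcl.mem_of_tendsto hg₀ (hev.mono fun i hi => hi.mem_spine)
  obtain ⟨-, l, hl, L, hL, hLl⟩ := (mem_spine hN hm).1 hspine
  have hL' : IsTangentType n N' K₀' g₀' l := by
    -- The agreement holds only for `‖v‖ < 1 / 2`, whereas the lemma expects the unit ball; the
    -- factor 2 introduced here is undone below by homogeneity of `M`.
    have := IsTangentType.of_normal_form (q := g₀) (g := g₀') (v₀ := 0) (A := B₀) (k := l)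
      (n := n) (N' := N') (s := 1 / 2)
      (W := K₀) (K := {z | g₀' + (2 : ℝ)⁻¹ • (z - g₀') ∈ K₀'}) (by norm_num)
      (fun v hv => by
        rw [hiff _ (by
          rw [norm_smul]
          norm_num
          linarith)]
        simp [map_smul]) (by simp)
      (by simpa using ⟨L, hL, hLl⟩)
    rw [map_zero, add_zero] at this
    obtain ⟨M, hM, hMl⟩ := this
    refine ⟨M, ⟨hM.smul_mem, hM.zero_mem, ?_⟩, hMl⟩
    have htend : Tendsto (fun v : Euc N => (2 : ℝ) • v) (𝓝 0) (𝓝 0) := by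
      have : Continuous fun v : Euc N => (2 : ℝ) • v := by fun_prop
      simpa using this.tendsto 0
    filter_upwards [htend.eventually hM.eventually] with v hv
    rw [hM.smul_mem_iff two_pos] at hv
    rw [← hv]
    simp [smul_smul]
  have h0 : g₀' ∈ K₀' := by
    obtain ⟨M, hM, -⟩ := hL'
    exact hM.mem
  have e1 := hmem 0
  obtain ⟨i, hi, hi1⟩ := (hev.and (e1.eventually (continuous_norm.continuousAt.eventually
    (gt_mem_nhds (show ‖(0 : Euc N)‖ < 1 by simp))))).exists
  have e2 : g' i + B i ((B i).symm (g₀' + B₀ 0 - g' i)) = g₀' := by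
    rw [(B i).apply_symm_apply, map_zero]
    abel
  have := hi.lt _ hi1 (by rwa [e2]) l (by rwa [e2])
  omega

theorem exists_isSeparating (hN : N' + n ≤ N) (h𝓑 : ∀ W ∈ 𝓑, ∃ m ≤ n, IsOfType n N' m W)
    (hfin : FiniteModIsometry 𝓑) : ∃ δ₀, 0 < δ₀ ∧ δ₀ < 1 / 10 ∧ IsSeparating n N' 𝓑 δ₀ := by
  obtain ⟨𝒢, h𝒢, hmod, hcov⟩ := exists_finite_models hN h𝓑 hfin
  obtain ⟨D, hD1, hD⟩ := exists_isLocalFactor hN h𝓑 hfin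
  by_contra hcon
  push Not at hcon
  have hseq : ∀ i : ℕ, ∃ (t : ℕ) (K K' : Set (Euc N)) (g g' : Euc N) (B : Euc N ≃ₗᵢ[ℝ] Euc N),
      t < n ∧ K ∈ 𝒢 ∧ K' ∈ 𝒢 ∧ ‖g‖ ≤ D ∧ ‖g'‖ ≤ D ∧
      IsClosePair n N' t K K' g g' B (1 / ((i : ℝ) + 1)) := by
    intro i
    have hi : (0 : ℝ) < i + 1 := by positivity
    set δ : ℝ := 1 / (20 * ((i : ℝ) + 1)) with hδ
    have hδ0 : 0 < δ := by positivity
    have hδ1 : δ < 1 / 10 := by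
      rw [hδ, div_lt_div_iff₀ (by positivity) (by norm_num)]
      have : (0 : ℝ) ≤ i := Nat.cast_nonneg i
      linarith
    have hns := hcon δ hδ0 hδ1
    unfold IsSeparating at hns
    push Not at hns
    obtain ⟨m, t, hmt, htn, W, hW, x, hx, u, htu, hun, W', hW', r, hr, hWr, hd⟩ := hns
    -- Normal forms are taken at scale `2 r`: the ball of radius `r` becomes `‖v‖ < 1 / 2`, and
    -- points displaced by less than `δ` stay in the unit ball.
    have hs : 0 < 2 * r := by positivity
    have hWx : (W ∩ ball x (2 * r)).Nonempty := ⟨x, spine_subset hN hx, mem_ball_self hs⟩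
    have hWx' : (W' ∩ ball x (2 * r)).Nonempty :=
      hWr.mono (inter_subset_inter_right _ (ball_subset_ball (by linarith)))
    obtain ⟨K, hK, A, g, hg, hA⟩ := exists_normal_form hN hD hmod hcov hW hs hWx
    obtain ⟨K', hK', A', g', hg', hA'⟩ := exists_normal_form hN hD hmod hcov hW' hs hWx'
    have hclose : ∀ (F G K K' : Set (Euc N)) (A A' : Euc N ≃ₗᵢ[ℝ] Euc N) (g g' : Euc N),
        localDist x r G F ≤ ENNReal.ofReal δ →
        (∀ v, ‖v‖ < 1 → (x + (2 * r) • v ∈ F ↔ g + A v ∈ K)) →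
        (∀ v, ‖v‖ < 1 → (x + (2 * r) • v ∈ G ↔ g' + A' v ∈ K')) → ∀ v, ‖v‖ < 1 / 2 →
        g + A v ∈ K → ∃ w, ‖w - v‖ < 1 / ((i : ℝ) + 1) ∧ g' + A' w ∈ K' := by
      intro F G K K' A A' g g' hd hA hA' v hv hvK
      rw [← hA v (by linarith)] at hvK
      obtain ⟨w, hw, hvw⟩ := exists_dist_lt_of_localDist_le hr hδ0.le hd
        (by linarith : δ < 2 * δ) hvK (by
          rw [dist_eq_norm, add_sub_cancel_left, norm_smul, Real.norm_of_nonneg hs.le]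
          nlinarith)
      have hxw : x + (2 * r) • ((2 * r)⁻¹ • (w - x)) = w := by
        rw [smul_smul, mul_inv_cancel₀ hs.ne', one_smul, add_sub_cancel]
      have hwv : ‖(2 * r)⁻¹ • (w - x) - v‖ < δ := by
        have e : (2 * r)⁻¹ • (w - x) - v = (2 * r)⁻¹ • (w - (x + (2 * r) • v)) := by
          have : (2 * r)⁻¹ • (2 * r) • v = v := by
            rw [smul_smul, inv_mul_cancel₀ hs.ne', one_smul]
          simp only [smul_sub, smul_add, this]
          abel
        rw [e, norm_smul, norm_inv, Real.norm_of_nonneg hs.le, inv_mul_lt_iff₀ hs, ← dist_eq_norm,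
          dist_comm]
        linarith
      have hδi : δ ≤ 1 / ((i : ℝ) + 1) := by
        rw [hδ]
        exact one_div_le_one_div_of_le hi (by linarith)
      refine ⟨(2 * r)⁻¹ • (w - x), hwv.trans_le hδi, ?_⟩
      rw [← hA' _ ?_, hxw]
      · exact hw
      · have := norm_add_le ((2 * r)⁻¹ • (w - x) - v) v
        rw [sub_add_cancel] at this
        linarith
    refine ⟨t, K, K', g, g', A.symm.trans A', htn, hK, hK', hg, hg', ?_, ?_, ?_, ?_⟩
    · intro v hv hvK
      obtain ⟨w, hw, hwK⟩ := hclose W W' K K' A A' g g' (by rwa [localDist_comm]) hA hA'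
        (A.symm v) (by rwa [LinearIsometryEquiv.norm_map]) (by rwa [A.apply_symm_apply])
      refine ⟨A w, ?_, by simpa using hwK⟩
      rwa [← A.symm.norm_map, map_sub, A.symm_apply_apply]
    · intro w hw hwK
      obtain ⟨v, hv, hvK⟩ := hclose W' W K' K A' A g' g hd hA' hA
        (A.symm w) (by rwa [LinearIsometryEquiv.norm_map]) (by simpa using hwK)
      refine ⟨A v, ?_, hvK⟩
      rwa [← A.symm.norm_map, map_sub, A.symm_apply_apply]
    · obtain ⟨-, M, P, 𝒴, hM⟩ := hmod K hK
      have hle := hM.le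
      obtain ⟨hle', l, hl, hxl⟩ := (mem_spine hN hW.2).1 hx
      refine (mem_spine hN (hM.isOfType (by omega))).2 ⟨hle', l, hl, ?_⟩
      have := IsTangentType.of_normal_form hs hA (v₀ := 0) (by simp) (by simpa using hxl)
      simpa using this
    · intro w hw hwK l hl
      have hw' : ‖A.symm w‖ < 1 := by rwa [LinearIsometryEquiv.norm_map]
      have hmem := (hA' _ hw').2 (by simpa using hwK)
      obtain ⟨l', hul', -, hl'⟩ := hW'.2.exists_isTangentType hN hmem
      have h1 := IsTangentType.of_normal_form hs hA' hw' hl'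
      have h2 := hl.unique hN (by simpa using h1)
      omega
  choose t K K' g g' B ht hK hK' hg hg' hclose using hseq
  refine not_isClosePair_seq hN h𝒢 (fun K hK => ?_) D t K K' g g' B _ ht hK hK' hg hg' ?_ hclose
  · obtain ⟨-, m, P, 𝒴, h⟩ := hmod K hK
    have hle := h.le
    exact ⟨m, h.isOfType (by omega)⟩
  · exact tendsto_one_div_add_atTop_nhds_zero_nat

theorem exists_admissible (hnN : n < N) (hN : N' + n ≤ N)
    (h𝓑 : ∀ W ∈ 𝓑, ∃ m ≤ n, IsOfType n N' m W) (hfin : FiniteModIsometry 𝓑) :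
    ∃ n₀ δ₀ : ℝ, Admissible n N' 𝓑 n₀ δ₀ := by
  obtain ⟨D, hD1, hD⟩ := exists_isLocalFactor hN h𝓑 hfin
  obtain ⟨δ₀, h0, h1, hsep⟩ := exists_isSeparating hN h𝓑 hfin
  exact ⟨max 11 (D ^ (n + 1)), δ₀, lt_of_lt_of_le (by norm_num) (le_max_left _ _), h0, h1, hsep,
    isSubstituting_of_isLocalFactor hnN hN h𝓑 hD1 hD (le_max_right _ _)⟩

end Separation

/-! ### Calculus of closeness in balls -/

section NearSets

variable {N : ℕ} {x x' y : Euc N} {r ρ ρ' σ η η' θ δ : ℝ} {F G H : Set (Euc N)}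

/-- In the ball `B(x, ρ)`, the sets `F` and `G` are at distance less than `η`. -/
def Near (x : Euc N) (ρ η : ℝ) (F G : Set (Euc N)) : Prop :=
  (∀ z ∈ F, dist z x < ρ → ∃ w ∈ G, dist z w < η) ∧
    ∀ z ∈ G, dist z x < ρ → ∃ w ∈ F, dist z w < η

theorem Near.symm (h : Near x ρ η F G) : Near x ρ η G F := ⟨h.2, h.1⟩

theorem Near.mono (h : Near x ρ η F G) (hρ : dist x' x + ρ' ≤ ρ) (hη : η ≤ η') :
    Near x' ρ' η' F G := by
  have hd : ∀ z, dist z x' < ρ' → dist z x < ρ := fun z hz => by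
    linarith [dist_triangle z x' x]
  refine ⟨fun z hz hzx => ?_, fun z hz hzx => ?_⟩
  · obtain ⟨w, hw, hzw⟩ := h.1 z hz (hd z hzx)
    exact ⟨w, hw, hzw.trans_le hη⟩
  · obtain ⟨w, hw, hzw⟩ := h.2 z hz (hd z hzx)
    exact ⟨w, hw, hzw.trans_le hη⟩

theorem Near.trans (h₁ : Near x ρ η F G) (h₂ : Near y σ θ G H) (hη : 0 ≤ η) (hθ : 0 ≤ θ)
    (hρ : dist x' x + ρ' + θ ≤ ρ) (hσ : dist x' y + ρ' + η ≤ σ) : Near x' ρ' (η + θ) F H := by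
  refine ⟨fun z hz hzx => ?_, fun z hz hzx => ?_⟩
  · obtain ⟨w, hw, hzw⟩ := h₁.1 z hz (by linarith [dist_triangle z x' x])
    obtain ⟨v, hv, hwv⟩ := h₂.1 w hw (by
      linarith [dist_triangle w z y, dist_triangle z x' y, dist_comm w z])
    exact ⟨v, hv, by linarith [dist_triangle z w v]⟩
  · obtain ⟨w, hw, hzw⟩ := h₂.2 z hz (by linarith [dist_triangle z x' y])
    obtain ⟨v, hv, hwv⟩ := h₁.2 w hw (by
      linarith [dist_triangle w z x, dist_triangle z x' x, dist_comm w z])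
    exact ⟨v, hv, by linarith [dist_triangle z w v]⟩

theorem Near.of_inter_eq (h : Near x ρ η F G) (hGH : G ∩ ball x σ = H ∩ ball x σ) (hη : 0 ≤ η)
    (hρ : ρ' ≤ ρ) (hσ : ρ' + η ≤ σ) : Near x ρ' η F H := by
  refine ⟨fun z hz hzx => ?_, fun z hz hzx => ?_⟩
  · obtain ⟨w, hw, hzw⟩ := h.1 z hz (hzx.trans_le hρ)
    have : w ∈ G ∩ ball x σ := ⟨hw, by
      rw [mem_ball]
      linarith [dist_triangle w z x, dist_comm w z]⟩
    rw [hGH] at this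
    exact ⟨w, this.1, hzw⟩
  · have : z ∈ H ∩ ball x σ := ⟨hz, by
      rw [mem_ball]
      linarith⟩
    rw [← hGH] at this
    exact h.2 z this.1 (hzx.trans_le hρ)

theorem Near.translate (h : Near x ρ η F G) {v : Euc N} (hv : ‖v‖ ≤ θ)
    (hρ : dist x' x + ρ' + θ ≤ ρ) : Near x' ρ' (η + θ) F (IsometryEquiv.addLeft v '' G) := by
  refine ⟨fun z hz hzx => ?_, fun z hz hzx => ?_⟩
  · obtain ⟨w, hw, hzw⟩ := h.1 z hz (by
      linarith [dist_triangle z x' x, norm_nonneg v])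
    refine ⟨v + w, ⟨w, hw, rfl⟩, ?_⟩
    have : dist w (v + w) = ‖v‖ := by
      rw [dist_comm, dist_eq_norm, add_sub_cancel_right]
    linarith [dist_triangle z w (v + w)]
  · rw [mem_image_addLeft] at hz
    have hd : dist z (z - v) = ‖v‖ := by rw [dist_eq_norm, sub_sub_cancel]
    obtain ⟨w, hw, hzw⟩ := h.2 _ hz (by
      linarith [dist_triangle (z - v) z x, dist_triangle z x' x, dist_comm z (z - v)])
    exact ⟨w, hw, by linarith [dist_triangle z (z - v) w]⟩

theorem near_of_localDist_lt (hr : 0 < r) (h : localDist x r F G < ENNReal.ofReal δ) :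
    Near x r (δ * r) F G := by
  obtain ⟨δ', h0, h1, h2⟩ := ENNReal.lt_iff_exists_real_btwn.1 h
  have hδ : δ' < δ := (ENNReal.ofReal_lt_ofReal_iff'.1 h2).1
  exact ⟨fun z hz hzx => exists_dist_lt_of_localDist_le hr h0 (by
      rw [localDist_comm]
      exact h1.le) hδ hz hzx,
    fun z hz hzx => exists_dist_lt_of_localDist_le hr h0 h1.le hδ hz hzx⟩

theorem Near.localDist_le (h : Near x r η F G) (hr : 0 < r) :
    localDist x r F G ≤ ENNReal.ofReal (η / r) := by
  refine ConeStrata.localDist_le hr (fun z hz hzx => ?_) (fun z hz hzx => ?_)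
  · obtain ⟨w, hw, hzw⟩ := h.2 z hz hzx
    exact ⟨w, hw, by rw [div_mul_cancel₀ _ hr.ne']; exact hzw.le⟩
  · obtain ⟨w, hw, hzw⟩ := h.1 z hz hzx
    exact ⟨w, hw, by rw [div_mul_cancel₀ _ hr.ne']; exact hzw.le⟩

theorem Near.localDist_lt (h : Near x r η F G) (hr : 0 < r) (hδ : 0 < δ) (hη : η < δ * r) :
    localDist x r F G < ENNReal.ofReal δ :=
  (h.localDist_le hr).trans_lt
    ((ENNReal.ofReal_lt_ofReal_iff hδ).2 ((div_lt_iff₀ hr).2 hη))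

end NearSets

/-- The standing assumptions: the constants are admissible, and `ε` is small. -/
structure IsStandard {N : ℕ} (n N' : ℕ) (𝓑 : Set (Set (Euc N))) (n₀ δ₀ ε : ℝ) (E : Set (Euc N)) :
    Prop where
  one_le : 1 ≤ n
  dim_le : N' + n ≤ N
  types : ∀ W ∈ 𝓑, ∃ m ≤ n, IsOfType n N' m W
  admissible : Admissible n N' 𝓑 n₀ δ₀
  approximable : IsApproximable 𝓑 ε E
  pos : 0 < ε
  small_one : 10 ^ 4 * constN₀ n₀ δ₀ ^ 2 * ε ≤ 1
  small_two : 10 ^ 4 * constC₀ n n₀ δ₀ * constN₀ n₀ δ₀ * ε ≤ 1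
  small_three : 10 ^ 5 * (n : ℝ) ^ 2 * n₀ ^ n * constC₁ n n₀ δ₀ * constN₀ n₀ δ₀ * ε ≤ 1

/-! ### From spine points of approximations to points of strata -/

section Existence

variable {N n N' m t u v : ℕ} {𝓑 : Set (Set (Euc N))} {n₀ δ₀ ε : ℝ} {E W Z : Set (Euc N)}
  {x y : Euc N} {r ρ η s : ℝ}

theorem constN₀_mul (h : Admissible n N' 𝓑 n₀ δ₀) : constN₀ n₀ δ₀ * δ₀ = n₀ :=
  div_mul_cancel₀ _ h.2.1.ne'

theorem le_constN₀ (h : Admissible n N' 𝓑 n₀ δ₀) : 100 ≤ constN₀ n₀ δ₀ := by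
  have h1 := h.1
  have h2 := h.2.1
  have h3 := h.2.2.1
  rw [constN₀, le_div_iff₀ h2]
  linarith

/-- A larger type would contradict separation in the ball of radius `ρ`, which `Z` meets because `x
∈ W` has a point of `Z` nearby. -/
theorem type_le_of_near (h : Admissible n N' 𝓑 n₀ δ₀) (hN : N' + n ≤ N)
    (hW : W ∈ limitsOfType n N' 𝓑 m) (hmt : m ≤ t) (htn : t < n) (hx : x ∈ spine n N' W t)
    (hZ : Z ∈ limitsOfType n N' 𝓑 v) (hnear : Near x ρ η W Z) (hρ : 0 < ρ)
    (hη : η ≤ δ₀ * ρ) : v ≤ t := by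
  obtain ⟨-, hδ, hδ1, hsep, -⟩ := h
  by_contra hvt
  have hxW := spine_subset hN hx
  obtain ⟨w, hw, hxw⟩ := hnear.1 x hxW (by rwa [dist_self])
  have h1 := hsep m t hmt htn W hW x hx v (by omega) hZ.2.le Z hZ ρ hρ
    ⟨w, hw, by rw [mem_ball, dist_comm]; nlinarith⟩
  refine absurd ((hnear.localDist_le hρ).trans (ENNReal.ofReal_le_ofReal ?_)) (not_le.2 h1)
  rwa [div_le_iff₀ hρ]

/-- If the `t`-spine of `Z` missed the dilated ball, `Z` could be replaced near `x` by a set of type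
at least `t + 1`, and that set would still be close to `W`, contrary to `type_le_of_near`. -/
theorem exists_spine_near (h : Admissible n N' 𝓑 n₀ δ₀) (hN : N' + n ≤ N)
    (hW : W ∈ limitsOfType n N' 𝓑 m) (hmt : m ≤ t) (htn : t < n) (hx : x ∈ spine n N' W t)
    (hZ : Z ∈ limitsOfType n N' 𝓑 v) (hnear : Near x ρ η W Z) (hρ : 0 < ρ) (hη0 : 0 ≤ η)
    (hη : η ≤ δ₀ * ρ) : v ≤ t ∧ ∃ z ∈ spine n N' Z t, dist z x < n₀ * (ρ + η) := by
  have hvt := type_le_of_near h hN hW hmt htn hx hZ hnear hρ hη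
  refine ⟨hvt, ?_⟩
  by_contra hno
  push Not at hno
  have hxW := spine_subset hN hx
  obtain ⟨w, hw, hxw⟩ := hnear.1 x hxW (by rwa [dist_self])
  obtain ⟨u, htu, -, Y, hY, he⟩ := (h.2.2.2.2 v t hvt htn Z hZ x (ρ + η) (by positivity)).1
    ⟨w, by rw [mem_ball, dist_comm]; linarith, hw⟩ (by
      ext z
      simp only [mem_inter_iff, mem_empty_iff_false, iff_false, not_and']
      exact fun hz hzx => absurd (mem_ball.1 hzx) (not_lt.2 (hno z hz)))
  have := type_le_of_near h hN hW hmt htn hx hY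
    (hnear.of_inter_eq he hη0 le_rfl le_rfl) hρ hη
  omega

/-- In the ball `B(y, s)` the set `E` is at distance less than `η` from a set of type at most `t`
whose `t`-spine contains `y`. -/
def IsCloseToSpine (n N' : ℕ) (𝓑 : Set (Set (Euc N))) (E : Set (Euc N)) (t : ℕ) (y : Euc N)
    (s η : ℝ) : Prop :=
  ∃ u ≤ t, ∃ W ∈ limitsOfType n N' 𝓑 u, y ∈ spine n N' W t ∧ Near y s η E W

/-- At all small scales around `y ∈ E`, the set `E` is close to sets of type at most `t` whose
`t`-spine contains `y`. -/
def IsCentered (n N' : ℕ) (𝓑 : Set (Set (Euc N))) (c : ℝ) (E : Set (Euc N)) (t : ℕ)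
    (y : Euc N) : Prop :=
  y ∈ E ∧ ∃ r₀ > 0, ∀ r, 0 < r → r < r₀ → IsCloseToSpine n N' 𝓑 E t y r (c * r)

theorem IsStandard.exists_near (H : IsStandard n N' 𝓑 n₀ δ₀ ε E) (hx : x ∈ E) (hr : 0 < r) :
    ∃ m ≤ n, ∃ Z ∈ limitsOfType n N' 𝓑 m, x ∈ Z ∧ Near x r (ε * r) E Z := by
  obtain ⟨Z, hZ, hxZ, hd⟩ := H.approximable.2.2 x hx r hr
  obtain ⟨m, hm, hZm⟩ := exists_mem_limitsOfType H.dim_le H.types hZ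
  exact ⟨m, hm, Z, hZm, hxZ, near_of_localDist_lt hr hd⟩

theorem IsStandard.small_N₀ (H : IsStandard n N' 𝓑 n₀ δ₀ ε E) :
    10 ^ 6 * (constN₀ n₀ δ₀ * ε) ≤ 1 := by
  have h1 := H.small_one
  have h2 := le_constN₀ H.admissible
  have h3 : 0 ≤ constN₀ n₀ δ₀ * ε := mul_nonneg (by linarith) H.pos.le
  nlinarith

theorem IsStandard.small_ε (H : IsStandard n N' 𝓑 n₀ δ₀ ε E) : 10 ^ 8 * ε ≤ 1 := by
  have h1 := H.small_N₀
  have h2 := le_constN₀ H.admissible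
  have h3 := H.pos
  nlinarith

/-- Comparing `W` with a fresh approximation of `E` resets the relative error to `2 ε`, whatever `η`
was; the price is a displacement proportional to the old error. -/
theorem IsCloseToSpine.exists_quarter (H : IsStandard n N' 𝓑 n₀ δ₀ ε E) (htn : t < n)
    (hy : IsCloseToSpine n N' 𝓑 E t y s η) (hs : 0 < s) (hη : 0 ≤ η)
    (hsmall : constN₀ n₀ δ₀ * (η + ε * s) ≤ s / 10) :
    ∃ y', dist y' y < 2 * constN₀ n₀ δ₀ * (η + ε * s) ∧
      IsCloseToSpine n N' 𝓑 E t y' (s / 4) (2 * ε * (s / 4)) := by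
  obtain ⟨u, hut, W, hW, hyW, hnear⟩ := hy
  obtain ⟨z, hz, hyz⟩ := hnear.2 y (spine_subset H.dim_le hyW) (by rwa [dist_self])
  have hs2 : 0 < s / 2 := half_pos hs
  obtain ⟨v, -, Z, hZ, -, hEZ⟩ := H.exists_near hz hs2
  have hε := H.pos
  have hεs : 0 < ε * s := mul_pos hε hs
  have hn₀ := H.admissible.1
  have hδ := H.admissible.2.1
  have hδ1 := H.admissible.2.2.1
  have hN₀ := le_constN₀ H.admissible
  have hNδ := constN₀_mul H.admissible
  set N₀ := constN₀ n₀ δ₀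
  have hsum : 0 < η + ε * s := by linarith
  -- This radius makes the error at most `δ₀ ρ`, and then `n₀ ρ = N₀ (η + ε s)` is the scale of the
  -- displacement.
  set ρ := (η + ε * s) / δ₀ with hρdef
  have hρ : 0 < ρ := div_pos hsum hδ
  have hδρ : δ₀ * ρ = η + ε * s := mul_div_cancel₀ _ hδ.ne'
  have hnρ : n₀ * ρ = N₀ * (η + ε * s) := by
    rw [← hNδ, mul_assoc, hδρ]
  have hρs : ρ ≤ s / 100 := by nlinarith
  have hηs : η + ε * s ≤ s / 1000 := by nlinarith
  have hWZ : Near y ρ (η + ε * (s / 2)) W Z := by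
    refine hnear.symm.trans hEZ hη (by positivity) ?_ ?_
    · rw [dist_self]
      linarith
    · linarith
  obtain ⟨hvt, z', hz', hzy'⟩ := exists_spine_near H.admissible H.dim_le hW hut htn hyW hZ hWZ hρ
    (by positivity) (by linarith)
  have hd : dist z' y < 2 * N₀ * (η + ε * s) := by
    refine hzy'.trans_le ?_
    have : n₀ * (ρ + (η + ε * (s / 2))) ≤ n₀ * (ρ + ρ) := by
      have : η + ε * (s / 2) ≤ ρ := by nlinarith
      nlinarith
    linarith
  refine ⟨z', hd, v, hvt, Z, hZ, hz', hEZ.mono ?_ (by linarith)⟩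
  linarith [dist_triangle z' y z]

theorem exists_nat_pow_quarter {s r : ℝ} (hr : 0 < r) (hrs : r ≤ s) :
    ∃ i : ℕ, r ≤ s / 4 ^ i ∧ s / 4 ^ i < 4 * r := by
  have hs : 0 < s := hr.trans_le hrs
  obtain ⟨i, h1, h2⟩ := exists_nat_pow_near_of_lt_one (div_pos hr hs) ((div_le_one hs).2 hrs)
    (by norm_num : (0 : ℝ) < 1 / 4) (by norm_num)
  rw [div_pow, one_pow] at h1 h2
  have h4 : (0 : ℝ) < 4 ^ i := by positivity
  refine ⟨i, ?_, ?_⟩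
  · rw [div_le_div_iff₀ hs h4] at h2
    rw [le_div_iff₀ h4]
    linarith
  · rw [div_lt_div_iff₀ (by positivity) hs, pow_succ] at h1
    rw [div_lt_iff₀ h4]
    linarith

theorem IsCloseToSpine.translate {y' : Euc N} {θ s' : ℝ}
    (h : IsCloseToSpine n N' 𝓑 E t y s η) (hθ : dist y' y ≤ θ) (hs : s' + 2 * θ ≤ s) :
    IsCloseToSpine n N' 𝓑 E t y' s' (η + θ) := by
  obtain ⟨u, hut, W, hW, hyW, hnear⟩ := h
  refine ⟨u, hut, IsometryEquiv.addLeft (y' - y) '' W, image_mem_limitsOfType hW _, ?_,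
    hnear.translate (by rwa [← dist_eq_norm]) (by linarith)⟩
  rw [spine_image]
  exact ⟨y, hyW, by simp⟩

/-- Iterating `exists_quarter` gives displacements that decay geometrically. The limit point lies in
the closed set `E` and inherits the closeness at all small scales. -/
theorem IsCloseToSpine.exists_isCentered (H : IsStandard n N' 𝓑 n₀ δ₀ ε E) (htn : t < n)
    (hy : IsCloseToSpine n N' 𝓑 E t y s η) (hs : 0 < s) (hη : 0 ≤ η)
    (hsmall : constN₀ n₀ δ₀ * (η + ε * s) ≤ s / 10) :
    ∃ y', dist y' y < 4 * constN₀ n₀ δ₀ * (η + ε * s) ∧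
      IsCentered n N' 𝓑 (80 * constN₀ n₀ δ₀ * ε) E t y' := by
  obtain ⟨y₁, hy₁, h₁⟩ := hy.exists_quarter H htn hs hη hsmall
  have hN₀ := le_constN₀ H.admissible
  have hsm := H.small_N₀
  have hε := H.pos
  set N₀ := constN₀ n₀ δ₀
  have hstep : ∀ (y : Euc N) (s : ℝ), 0 < s → IsCloseToSpine n N' 𝓑 E t y s (2 * ε * s) →
      ∃ y', dist y' y < 6 * N₀ * ε * s ∧
        IsCloseToSpine n N' 𝓑 E t y' (s / 4) (2 * ε * (s / 4)) := by
    intro y s hs hy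
    obtain ⟨y', hy', h'⟩ := hy.exists_quarter H htn hs (by positivity) (by
      change N₀ * (2 * ε * s + ε * s) ≤ s / 10
      nlinarith)
    refine ⟨y', hy'.trans_le ?_, h'⟩
    change 2 * N₀ * (2 * ε * s + ε * s) ≤ _
    linarith
  choose! f hf using hstep
  set s₁ := s / 4 with hs₁
  have hs₁0 : 0 < s₁ := by positivity
  let Y : ℕ → Euc N := fun i => Nat.rec y₁ (fun i y => f y (s₁ / 4 ^ i)) i
  have hYs : ∀ i, Y (i + 1) = f (Y i) (s₁ / 4 ^ i) := fun i => rfl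
  have hpos : ∀ i : ℕ, 0 < s₁ / 4 ^ i := fun i => by positivity
  have hY : ∀ i, IsCloseToSpine n N' 𝓑 E t (Y i) (s₁ / 4 ^ i) (2 * ε * (s₁ / 4 ^ i)) := by
    intro i
    induction i with
    | zero =>
      have e0 : Y 0 = y₁ := rfl
      rw [e0, pow_zero, div_one]
      exact h₁
    | succ i ih =>
      have := (hf (Y i) _ (hpos i) ih).2
      rw [hYs, pow_succ, ← div_div]
      exact this
  have hd : ∀ i, dist (Y i) (Y (i + 1)) ≤ 6 * N₀ * ε * s₁ * (1 / 4) ^ i := by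
    intro i
    rw [dist_comm, hYs]
    refine (hf (Y i) _ (hpos i) (hY i)).1.le.trans (le_of_eq ?_)
    rw [div_pow, one_pow]
    ring
  obtain ⟨y', hy'⟩ := cauchySeq_tendsto_of_complete (cauchySeq_of_le_geometric _ _
    (by norm_num) hd)
  -- The constant is `6 / (1 - 1/4) = 8`.
  have hlim : ∀ i, dist (Y i) y' ≤ 8 * N₀ * ε * (s₁ / 4 ^ i) := by
    intro i
    refine (dist_le_of_le_geometric_of_tendsto _ _ (by norm_num) hd hy' i).trans (le_of_eq ?_)
    rw [div_pow, one_pow]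
    ring
  refine ⟨y', ?_, ?_, s₁ / 2, by positivity, fun r hr hrs => ?_⟩
  · have h0 := hlim 0
    have e0 : Y 0 = y₁ := rfl
    rw [e0, pow_zero, div_one] at h0
    have : 0 ≤ N₀ * η := by positivity
    have h2 := dist_triangle y' y₁ y
    rw [dist_comm y' y₁] at h2
    rw [hs₁] at h0
    nlinarith
  · rw [← H.approximable.1.closure_eq, Metric.mem_closure_iff]
    intro θ hθ
    have htend : Tendsto (fun i : ℕ => (8 * N₀ * ε + 2 * ε) * s₁ * (1 / 4 : ℝ) ^ i) atTop
        (𝓝 0) := by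
      simpa using (tendsto_pow_atTop_nhds_zero_of_lt_one (by norm_num : (0 : ℝ) ≤ 1 / 4)
        (by norm_num)).const_mul ((8 * N₀ * ε + 2 * ε) * s₁)
    obtain ⟨i, hi⟩ := (htend.eventually (gt_mem_nhds hθ)).exists
    obtain ⟨u, -, W, hW, hyW, hnear⟩ := hY i
    obtain ⟨z, hz, hyz⟩ := hnear.2 _ (spine_subset H.dim_le hyW) (by
      rw [dist_self]
      exact hpos i)
    refine ⟨z, hz, ?_⟩
    have h1 := dist_triangle y' (Y i) z
    rw [dist_comm y' (Y i)] at h1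
    have h2 := hlim i
    rw [div_pow, one_pow] at hi
    have e : (8 * N₀ * ε + 2 * ε) * s₁ * (1 / 4 ^ i) =
        8 * N₀ * ε * (s₁ / 4 ^ i) + 2 * ε * (s₁ / 4 ^ i) := by ring
    linarith
  -- With `2 r ≤ τ < 8 r` the translated approximation has error `(2 ε + 8 N₀ ε) τ`, which is at
  -- most `80 N₀ ε r`.
  · obtain ⟨i, hi1, hi2⟩ := exists_nat_pow_quarter (s := s₁) (r := 2 * r) (by positivity)
      (by linarith)
    have hτ := hpos i
    set τ := s₁ / 4 ^ i
    obtain ⟨u, hut, W, hW, hyW, hnear⟩ := (hY i).translate (y' := y')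
      (θ := 8 * N₀ * ε * τ) (s' := r) (by
        rw [dist_comm]
        exact hlim i) (by nlinarith)
    refine ⟨u, hut, W, hW, hyW, hnear.mono (by rw [dist_self, zero_add]) ?_⟩
    have h1 : ε * τ ≤ ε * (4 * (2 * r)) := by gcongr
    have h2 : N₀ * (ε * τ) ≤ N₀ * (ε * (4 * (2 * r))) := by gcongr
    nlinarith [mul_pos hε hτ]

theorem le_constC₀ (H : IsStandard n N' 𝓑 n₀ δ₀ ε E) :
    10 ^ 8 * (n₀ ^ n * constN₀ n₀ δ₀) ≤ constC₀ n n₀ δ₀ ∧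
      10 ^ 8 * (n₀ * constN₀ n₀ δ₀) ≤ constC₀ n n₀ δ₀ ∧ n₀ ≤ n₀ ^ n := by
  have h1 := H.admissible.1
  have h2 := le_constN₀ H.admissible
  have h3 := H.one_le
  have h4 : n₀ ≤ n₀ ^ n := le_self_pow₀ (by linarith) (by omega)
  have h5 : n₀ ^ n ≤ (n₀ + n) ^ (3 * n) :=
    (pow_le_pow_right₀ (by linarith : (1 : ℝ) ≤ n₀) (by omega : n ≤ 3 * n)).trans
      (pow_le_pow_left₀ (by linarith) (by linarith [Nat.cast_nonneg (α := ℝ) n]) _)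
  have h6 : 10 ^ 8 * (n₀ ^ n * constN₀ n₀ δ₀) ≤ constC₀ n n₀ δ₀ := by
    rw [constC₀, mul_assoc]
    gcongr
  refine ⟨h6, le_trans ?_ h6, h4⟩
  gcongr

theorem mem_stratum_of_near (hx : x ∈ E) (hx2 : x ∈ ball (0 : Euc N) 2)
    (hC : 0 < constC₀ n n₀ δ₀ * ε)
    {r₀ : ℝ} (hr₀ : 0 < r₀) (h : ∀ r, 0 < r → r < r₀ → ∃ T ∈ limitsOfType n N' 𝓑 m,
      x ∈ spine n N' T m ∧ ∃ η < constC₀ n n₀ δ₀ * ε * r, Near x r η E T) :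
    x ∈ stratum n N' 𝓑 n₀ δ₀ ε E m := by
  refine ⟨⟨hx, hx2⟩, r₀, hr₀, fun r hr hrr => ?_⟩
  obtain ⟨T, hT, hxT, η, hη, hnear⟩ := h r hr hrr
  exact (iInf₂_le (f := fun W (_ : W ∈ {W | W ∈ limitsOfType n N' 𝓑 m ∧ x ∈ spine n N' W m}) =>
    localDist x r E W) T ⟨hT, hxT⟩).trans_lt (hnear.localDist_lt hr hC hη)

theorem exists_near_of_mem_stratum (hx : x ∈ stratum n N' 𝓑 n₀ δ₀ ε E m) :
    ∃ r₀ > 0, ∀ r, 0 < r → r < r₀ → ∃ T ∈ limitsOfType n N' 𝓑 m,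
      x ∈ spine n N' T m ∧ Near x r (constC₀ n n₀ δ₀ * ε * r) E T := by
  obtain ⟨-, r₀, hr₀, h⟩ := hx
  refine ⟨r₀, hr₀, fun r hr hrr => ?_⟩
  obtain ⟨T, hT'⟩ := iInf_lt_iff.1 (h r hr hrr)
  obtain ⟨⟨hT, hxT⟩, hd⟩ := iInf_lt_iff.1 hT'
  exact ⟨T, hT, hxT, near_of_localDist_lt hr hd⟩

/-- A point that is centered for the least possible index belongs to the corresponding stratum. -/
theorem IsCentered.mem_stratum (H : IsStandard n N' 𝓑 n₀ δ₀ ε E) {j : ℕ} (hjn : j < n)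
    (hy2 : y ∈ ball (0 : Euc N) 2) (hy : IsCentered n N' 𝓑 (80 * constN₀ n₀ δ₀ * ε) E j y)
    (hρ : 0 < ρ) (hmin : ∀ i < j, ∀ z, dist z y < ρ →
      ¬ IsCentered n N' 𝓑 (80 * constN₀ n₀ δ₀ * ε) E i z) :
    y ∈ stratum n N' 𝓑 n₀ δ₀ ε E j := by
  have hn₀ := H.admissible.1
  have hδ := H.admissible.2.1
  have hδ1 := H.admissible.2.2.1
  have hN₀ := le_constN₀ H.admissible
  have hC := (le_constC₀ H).2.1
  have hs1 := H.small_one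
  have hsN := H.small_N₀
  have hsε := H.small_ε
  have hsC := H.small_two
  have hε := H.pos
  set N₀ := constN₀ n₀ δ₀
  have hnN : 0 < n₀ * N₀ := by positivity
  have hC0 : 0 < constC₀ n n₀ δ₀ := by linarith
  have hn₀N : n₀ * N₀ * ε * 10 ^ 8 ≤ 1 := by
    have : 10 ^ 4 * (10 ^ 8 * (n₀ * N₀)) * N₀ * ε ≤ 1 := by
      refine le_trans ?_ hsC
      gcongr
    have h' : 0 ≤ n₀ * N₀ * ε := by positivity
    nlinarith
  obtain ⟨hyE, r₀, hr₀, hcen⟩ := hy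
  refine mem_stratum_of_near hyE hy2 (by positivity)
    -- The approximation is used at radius `4 n₀ r`, and the auxiliary centered points stay within
    -- `3 n₀ r` of `y`.
    (r₀ := min (r₀ / (4 * n₀)) (ρ / (3 * n₀))) (by positivity) fun r hr hrr => ?_
  have hr1 : 4 * n₀ * r < r₀ := by
    have := hrr.trans_le (min_le_left _ _)
    rw [lt_div_iff₀ (by positivity)] at this
    linarith
  have hr2 : 3 * n₀ * r < ρ := by
    have := hrr.trans_le (min_le_right _ _)
    rw [lt_div_iff₀ (by positivity)] at this
    linarith
  obtain ⟨u, huj, W, hW, hyW, hnear⟩ := hcen (4 * n₀ * r) (by positivity) hr1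
  set θ := 80 * N₀ * ε * (4 * n₀ * r) with hθdef
  have hθ : 0 ≤ θ := by positivity
  have hθr : θ ≤ r / 10 := by
    have : θ = 320 * (n₀ * N₀ * ε) * r := by rw [hθdef]; ring
    rw [this]
    nlinarith
  have hθC : θ + ε * r < constC₀ n n₀ δ₀ * ε * r := by
    have h1 : 10 ^ 8 * (n₀ * N₀) * (ε * r) ≤ constC₀ n n₀ δ₀ * (ε * r) := by gcongr
    have h2 : 0 < ε * r := by positivity
    have h3 : θ = 320 * (n₀ * N₀) * (ε * r) := by rw [hθdef]; ring
    have h4 : 1 < n₀ * N₀ := by nlinarith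
    have h5 : ε * r < n₀ * N₀ * (ε * r) := lt_mul_of_one_lt_left h2 h4
    rw [h3, mul_assoc (constC₀ n n₀ δ₀)]
    nlinarith
  have hnr : 10 * r ≤ n₀ * r := by gcongr
  rcases huj.eq_or_lt with rfl | huj
  · refine ⟨W, hW, hyW, θ, by linarith [mul_pos hε hr], hnear.mono ?_ le_rfl⟩
    rw [dist_self]
    linarith
  -- A point of the `(j - 1)`-spine here would produce a nearby centered point of index `j - 1`,
  -- against minimality.
  · have hmiss : ball y (n₀ * (2 * r)) ∩ spine n N' W (j - 1) = ∅ := by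
      ext q
      simp only [mem_inter_iff, mem_empty_iff_false, iff_false, not_and, mem_ball]
      intro hqy hq
      have hq' : IsCloseToSpine n N' 𝓑 E (j - 1) q (n₀ * r) θ :=
        ⟨u, by omega, W, hW, hq, hnear.mono (by linarith) le_rfl⟩
      have hθ2 : θ + ε * (n₀ * r) ≤ 321 * N₀ * ε * (n₀ * r) := by
        have h1 : ε * (n₀ * r) ≤ N₀ * (ε * (n₀ * r)) :=
          le_mul_of_one_le_left (by positivity) (by linarith)
        rw [hθdef]
        linarith
      have hθ3 : N₀ * (θ + ε * (n₀ * r)) ≤ 321 * (N₀ ^ 2 * ε) * (n₀ * r) := by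
        calc N₀ * (θ + ε * (n₀ * r)) ≤ N₀ * (321 * N₀ * ε * (n₀ * r)) := by gcongr
          _ = _ := by ring
      have hθ4 : 321 * (N₀ ^ 2 * ε) * (n₀ * r) ≤ n₀ * r / 20 := by
        have : 0 < n₀ * r := by positivity
        nlinarith
      obtain ⟨q', hqq', hq'c⟩ := hq'.exists_isCentered H (by omega) (by positivity) hθ
        (by
          change N₀ * (θ + ε * (n₀ * r)) ≤ _
          linarith [mul_pos (by linarith : 0 < n₀) hr])
      refine hmin (j - 1) (by omega) q' ?_ hq'c
      have hqq'' : dist q' q < 4 * N₀ * (θ + ε * (n₀ * r)) := hqq'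
      have := dist_triangle q' q y
      linarith [mul_pos (by linarith : 0 < n₀) hr]
    obtain ⟨v, hjv, -, Y, hY, he⟩ := (H.admissible.2.2.2.2 u (j - 1) (by omega) (by omega) W hW y
      (2 * r) (by positivity)).1 ⟨y, mem_ball_self (by positivity), spine_subset H.dim_le hyW⟩ hmiss
    have hself : ∀ τ, 0 < τ → τ ≤ r → Near y τ (δ₀ * τ) W Y := by
      intro τ hτ hτr
      have hWW : Near y (2 * τ) (δ₀ * τ) W W :=
        ⟨fun z hz _ => ⟨z, hz, by rw [dist_self]; positivity⟩,
          fun z hz _ => ⟨z, hz, by rw [dist_self]; positivity⟩⟩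
      exact hWW.of_inter_eq he (by positivity) (by linarith) (by nlinarith)
    -- `W` and `Y` coincide near `y`, so the comparison radius may be arbitrarily small; this one
    -- puts the spine of `Y` within `ε r` of `y`.
    have hτ : 0 < ε * r / (2 * n₀) := by positivity
    have hτr : ε * r / (2 * n₀) ≤ r := by
      rw [div_le_iff₀ (by positivity)]
      nlinarith
    obtain ⟨hvj, z, hz, hzy⟩ := exists_spine_near H.admissible H.dim_le hW huj.le hjn hyW hY
      (hself _ hτ hτr) hτ (by positivity) le_rfl
    obtain rfl : v = j := by omega
    have hzy' : dist y z ≤ ε * r := by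
      rw [dist_comm]
      refine hzy.le.trans ?_
      have : n₀ * (ε * r / (2 * n₀)) = ε * r / 2 := by
        field_simp
      have h' : n₀ * (ε * r / (2 * n₀) + δ₀ * (ε * r / (2 * n₀))) = (1 + δ₀) * (ε * r / 2) := by
        rw [← this]
        ring
      rw [h']
      nlinarith [mul_pos hε hr]
    have hEY : Near y (3 / 2 * r) θ E Y :=
      (hnear.mono (x' := y) (ρ' := 2 * r) (by rw [dist_self]; linarith) le_rfl).of_inter_eq he hθ
        (by linarith) (by linarith)
    refine ⟨_, image_mem_limitsOfType hY (IsometryEquiv.addLeft (y - z)), ?_, θ + ε * r, hθC,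
      hEY.translate (by rwa [← dist_eq_norm]) ?_⟩
    · rw [spine_image]
      exact ⟨z, hz, by simp⟩
    · rw [dist_self]
      nlinarith

/-- Among the centered points in the ball, one of least index satisfies the minimality required by
`IsCentered.mem_stratum`. -/
theorem IsCloseToSpine.exists_mem_stratum (H : IsStandard n N' 𝓑 n₀ δ₀ ε E) (htn : t < n)
    (hy : IsCloseToSpine n N' 𝓑 E t y s η) (hs : 0 < s) (hη : 0 ≤ η)
    (hsmall : constN₀ n₀ δ₀ * (η + ε * s) ≤ s / 10)
    (hρ : 4 * constN₀ n₀ δ₀ * (η + ε * s) ≤ ρ) (hball : ball y ρ ⊆ ball 0 2) :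
    ∃ j ≤ t, ∃ z ∈ stratum n N' 𝓑 n₀ δ₀ ε E j, dist z y < ρ := by
  classical
  obtain ⟨y', hyy', hy'⟩ := hy.exists_isCentered H htn hs hη hsmall
  have hex : ∃ j, ∃ z, dist z y < ρ ∧ IsCentered n N' 𝓑 (80 * constN₀ n₀ δ₀ * ε) E j z :=
    ⟨t, y', hyy'.trans_le hρ, hy'⟩
  obtain ⟨z, hz, hzc⟩ := Nat.find_spec hex
  have hle : Nat.find hex ≤ t := Nat.find_min' hex ⟨y', hyy'.trans_le hρ, hy'⟩
  refine ⟨Nat.find hex, hle, z, ?_, hz⟩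
  refine hzc.mem_stratum H (hle.trans_lt htn) (hball hz) (ρ := ρ - dist z y) (by linarith)
    fun i hi w hw hwc => Nat.find_min hex hi ⟨w, ?_, hwc⟩
  linarith [dist_triangle w z y]

end Existence

/-! ### Approximation near strata and comparison with spines -/

section Strata

variable {N n N' m k v : ℕ} {𝓑 : Set (Set (Euc N))} {n₀ δ₀ ε : ℝ} {E T W Y : Set (Euc N)}
  {x y : Euc N} {r ρ ρ' σ : ℝ}

/-- The ball `B(x, ρ)` is contained in `B(0, 2)` and contains no point of a stratum of index less
than `m`. -/
def IsFree (n N' : ℕ) (𝓑 : Set (Set (Euc N))) (n₀ δ₀ ε : ℝ) (E : Set (Euc N)) (m : ℕ) (x : Euc N)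
    (ρ : ℝ) : Prop :=
  ball x ρ ⊆ ball 0 2 ∧ ∀ k < m, ∀ z ∈ stratum n N' 𝓑 n₀ δ₀ ε E k, ρ ≤ dist z x

theorem ball_subset_of_dist_add_le {s : Set (Euc N)} (h : ball x ρ ⊆ s) (hd : dist y x + ρ' ≤ ρ) :
    ball y ρ' ⊆ s :=
  (ball_subset_ball' (by linarith)).trans h

theorem IsStandard.le_pow (H : IsStandard n N' 𝓑 n₀ δ₀ ε E) : 10 ≤ n₀ ^ n :=
  H.admissible.1.le.trans (le_constC₀ H).2.2

theorem IsStandard.small_pow (H : IsStandard n N' 𝓑 n₀ δ₀ ε E) :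
    10 ^ 12 * (n₀ ^ n * constN₀ n₀ δ₀ ^ 2 * ε) ≤ 1 := by
  have hN₀ := le_constN₀ H.admissible
  have hε := H.pos
  calc 10 ^ 12 * (n₀ ^ n * constN₀ n₀ δ₀ ^ 2 * ε)
      = 10 ^ 4 * (10 ^ 8 * (n₀ ^ n * constN₀ n₀ δ₀)) * constN₀ n₀ δ₀ * ε := by ring
    _ ≤ 10 ^ 4 * constC₀ n n₀ δ₀ * constN₀ n₀ δ₀ * ε := by
      gcongr
      exact (le_constC₀ H).1
    _ ≤ 1 := H.small_two

theorem IsStandard.small_pow_mul (H : IsStandard n N' 𝓑 n₀ δ₀ ε E) :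
    10 ^ 5 * ((n : ℝ) ^ 2 * ((n₀ ^ n) ^ 2 * constN₀ n₀ δ₀ ^ 2 * ε)) ≤ 1 := by
  have h := H.small_three
  rw [constC₁] at h
  refine le_trans (le_of_eq ?_) h
  ring

/-- Near `x`, the set `E` is close to a set of type at least `m` if no stratum of index less than
`m` comes close to `x`. -/
theorem IsStandard.exists_near_of_isFree (H : IsStandard n N' 𝓑 n₀ δ₀ ε E) (hmn : m ≤ n)
    (hx : x ∈ E) (hr : 0 < r) (hfree : IsFree n N' 𝓑 n₀ δ₀ ε E m x (5 / 2 * (n₀ ^ n * r))) :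
    ∃ v, m ≤ v ∧ v ≤ n ∧ ∃ Y ∈ limitsOfType n N' 𝓑 v,
      Near x (3 / 2 * r) (9 / 4 * (ε * (n₀ ^ n * r))) E Y := by
  have hn₀ := H.admissible.1
  have hN₀ := le_constN₀ H.admissible
  have hM := H.le_pow
  have hε := H.pos
  have hsN := H.small_N₀
  have hsM := H.small_pow
  set N₀ := constN₀ n₀ δ₀
  set R := n₀ ^ n * r with hR
  have hRr : 10 * r ≤ R := by
    rw [hR]
    gcongr
  have hR0 : 0 < R := by linarith
  have hεR : ε * R ≤ r / 10 := by
    have h1 : n₀ ^ n * ε ≤ n₀ ^ n * N₀ ^ 2 * ε := by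
      gcongr
      exact le_mul_of_one_le_right (by linarith) (by nlinarith)
    have h2 : ε * R = n₀ ^ n * ε * r := by rw [hR]; ring
    rw [h2]
    nlinarith
  have hNεR : N₀ * ε * R ≤ R / 1000 := by nlinarith
  have hεR0 : 0 < ε * R := by positivity
  -- Radius `9/4 R` covers balls of radius `R / 4` about points within `2 R` of `x`. The stratum
  -- points found within `R / 2` of these lie inside the free ball of radius `5/2 R`.
  obtain ⟨u, hun, Z, hZ, hxZ, hEZ⟩ := H.exists_near hx (by positivity : 0 < 9 / 4 * R)
  have e : ε * (9 / 4 * R) = 9 / 4 * (ε * R) := by ring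
  rw [e] at hEZ
  rcases le_or_gt m u with hmu | hum
  · refine ⟨u, hmu, hun, Z, hZ, hEZ.mono ?_ le_rfl⟩
    rw [dist_self]
    linarith
  · have hpow : n₀ * (2 * n₀ ^ (n - 1) * r) = 2 * R := by
      rw [hR]
      obtain ⟨l, rfl⟩ : ∃ l, n = l + 1 := ⟨n - 1, by omega⟩
      rw [add_tsub_cancel_right, pow_succ]
      ring
    have hpow1 : 1 ≤ n₀ ^ (n - 1) := one_le_pow₀ (by linarith)
    have hmiss : ball x (n₀ * (2 * n₀ ^ (n - 1) * r)) ∩ spine n N' Z (m - 1) = ∅ := by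
      rw [hpow]
      ext q
      simp only [mem_inter_iff, mem_empty_iff_false, iff_false, not_and, mem_ball]
      intro hqx hq
      have hclose : IsCloseToSpine n N' 𝓑 E (m - 1) q (R / 4) (9 / 4 * (ε * R)) :=
        ⟨u, by omega, Z, hZ, hq, hEZ.mono (by linarith) le_rfl⟩
      obtain ⟨j, hj, z, hz, hzq⟩ := hclose.exists_mem_stratum H (by omega) (by positivity)
        (by positivity) (ρ := R / 2)
        (by
          change N₀ * (9 / 4 * (ε * R) + ε * (R / 4)) ≤ _
          nlinarith)
        (by
          change 4 * N₀ * (9 / 4 * (ε * R) + ε * (R / 4)) ≤ _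
          nlinarith)
        (ball_subset_of_dist_add_le hfree.1 (by linarith))
      have := hfree.2 j (by omega) z hz
      linarith [dist_triangle z q x]
    obtain ⟨v, hmv, hvn, Y, hY, he⟩ := (H.admissible.2.2.2.2 u (m - 1) (by omega) (by omega) Z hZ x
      (2 * n₀ ^ (n - 1) * r) (by positivity)).1 ⟨x, mem_ball_self (by positivity), hxZ⟩ hmiss
    refine ⟨v, by omega, hvn, Y, hY, hEZ.of_inter_eq he (by positivity) (by linarith) ?_⟩
    nlinarith

/-- A rough approximation at a much smaller scale determines the type of the approximation. -/
theorem IsStandard.exists_near_of_near (H : IsStandard n N' 𝓑 n₀ δ₀ ε E) (hmn : m ≤ n)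
    (hx : x ∈ E) (hr : 0 < r) (hfree : IsFree n N' 𝓑 n₀ δ₀ ε E m x (5 / 2 * (n₀ ^ n * r)))
    (hσ : σ = 6 * ε * n₀ ^ n / δ₀ * r) (hW : W ∈ limitsOfType n N' 𝓑 m) (hxW : x ∈ spine n N' W m)
    (hEW : Near x σ (constC₀ n n₀ δ₀ * ε * σ) E W) :
    ∃ T ∈ limitsOfType n N' 𝓑 m, x ∈ spine n N' T m ∧
      Near x r (13 * (n₀ ^ n * constN₀ n₀ δ₀) * ε * r) E T := by
  have hn₀ := H.admissible.1
  have hδ := H.admissible.2.1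
  have hδ1 := H.admissible.2.2.1
  have hN₀ := le_constN₀ H.admissible
  have hNδ := constN₀_mul H.admissible
  have hM := H.le_pow
  have hε := H.pos
  have hsM := H.small_pow
  have hsC := H.small_two
  have hC := (le_constC₀ H).1
  obtain ⟨v, hmv, hvn, Y, hY, hEY⟩ := H.exists_near_of_isFree hmn hx hr hfree
  set N₀ := constN₀ n₀ δ₀
  set M := n₀ ^ n
  set C₀ := constC₀ n n₀ δ₀
  have hC0 : 0 < C₀ := by
    refine lt_of_lt_of_le ?_ hC
    positivity
  have hσ0 : 0 < σ := by
    rw [hσ]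
    positivity
  -- The scale `σ` is chosen so that `δ₀ σ / 2` dominates the combined errors `C₀ ε σ` and `9/4 ε M
  -- r` in the ball of radius `σ / 2`.
  have hδσ : δ₀ * σ = 6 * (ε * (M * r)) := by
    rw [hσ]
    field_simp
  have hnσ : n₀ * σ = 6 * (M * N₀ * ε * r) := by
    rw [← hNδ, mul_assoc, hδσ]
    ring
  have hMN : M * N₀ * ε ≤ 1 / 10 ^ 10 := by
    have : M * N₀ * ε * 100 ≤ M * N₀ * ε * N₀ := by gcongr
    nlinarith
  set b := M * N₀ * ε * r with hb
  have hb0 : 0 < b := by positivity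
  have hbr : b ≤ r / 1000 := by
    rw [hb]
    nlinarith
  have hab : 100 * (ε * (M * r)) ≤ b := by
    have : 100 * (ε * (M * r)) ≤ N₀ * (ε * (M * r)) := by gcongr
    rw [hb]
    linarith
  set a := ε * (M * r)
  have ha0 : 0 < a := by positivity
  have hCδ : C₀ * ε ≤ δ₀ / 1000 := by
    have h1 : 10 ^ 4 * (C₀ * ε) * n₀ ≤ δ₀ := by
      rw [← hNδ]
      calc 10 ^ 4 * (C₀ * ε) * (N₀ * δ₀) = 10 ^ 4 * C₀ * N₀ * ε * δ₀ := by ring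
        _ ≤ 1 * δ₀ := by gcongr
        _ = δ₀ := one_mul _
    have h2 : 0 < C₀ * ε := by positivity
    nlinarith
  have hCσ : C₀ * ε * σ ≤ 6 * a / 1000 := by
    rw [← hδσ]
    calc C₀ * ε * σ ≤ δ₀ / 1000 * σ := by gcongr
      _ = _ := by ring
  have hδσ1 : δ₀ * σ ≤ σ / 10 := by nlinarith
  have hσr : 10 * σ ≤ n₀ * σ := by gcongr
  have key : v = m ∧ ∃ z ∈ spine n N' Y m, dist z x ≤ 7 / 2 * b := by
    rcases hmn.lt_or_eq with hlt | rfl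
    · have hWY : Near x (σ / 2) (C₀ * ε * σ + 9 / 4 * a) W Y := by
        refine hEW.symm.trans hEY (by positivity) (by positivity) ?_ ?_
        · rw [dist_self]
          linarith
        · rw [dist_self]
          linarith
      obtain ⟨hvm, z, hz, hzx⟩ := exists_spine_near H.admissible H.dim_le hW le_rfl hlt hxW hY hWY
        (by positivity) (by positivity) (by linarith)
      refine ⟨by omega, z, hz, hzx.le.trans ?_⟩
      have h1 : n₀ * (σ / 2 + (C₀ * ε * σ + 9 / 4 * a)) ≤ n₀ * (11 / 20 * σ) := by
        gcongr
        linarith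
      linarith
    -- Separation is available only below index `n`; in top type the equality is automatic and the
    -- spine is the whole set.
    · obtain rfl : v = m := by omega
      obtain ⟨w, hw, hxw⟩ := hEY.1 x hx (by rw [dist_self]; positivity)
      refine ⟨rfl, w, subset_spine_self H.dim_le hY.2 hw, ?_⟩
      rw [dist_comm]
      linarith
  obtain ⟨rfl, z, hz, hzx⟩ := key
  refine ⟨_, image_mem_limitsOfType hY (IsometryEquiv.addLeft (x - z)), ?_,
    (hEY.translate (v := x - z) (θ := 7 / 2 * b) (x' := x) (ρ' := r)
      (by rwa [← dist_eq_norm, dist_comm]) ?_).mono (by rw [dist_self, zero_add]) ?_⟩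
  · rw [spine_image]
    exact ⟨z, hz, by simp⟩
  · rw [dist_self]
    linarith
  · have : 13 * (M * N₀) * ε * r = 13 * b := by rw [hb]; ring
    rw [this]
    linarith

/-- The approximation of `E` near a point of the stratum of index `m`. -/
theorem IsStandard.exists_near_of_mem_stratum (H : IsStandard n N' 𝓑 n₀ δ₀ ε E) (hmn : m ≤ n)
    (hx : x ∈ stratum n N' 𝓑 n₀ δ₀ ε E m) (hr : 0 < r)
    (hfree : IsFree n N' 𝓑 n₀ δ₀ ε E m x (5 / 2 * (n₀ ^ n * r))) :
    ∃ T ∈ limitsOfType n N' 𝓑 m, x ∈ spine n N' T m ∧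
      Near x r (13 * (n₀ ^ n * constN₀ n₀ δ₀) * ε * r) E T := by
  have hxE : x ∈ E := hx.1.1
  have hn₀ := H.admissible.1
  have hδ := H.admissible.2.1
  have hN₀ := le_constN₀ H.admissible
  have hNδ := constN₀_mul H.admissible
  have hM := H.le_pow
  have hε := H.pos
  have hsM := H.small_pow
  have hC := (le_constC₀ H).1
  obtain ⟨r₀, hr₀, h₀⟩ := ConeStrata.exists_near_of_mem_stratum hx
  set N₀ := constN₀ n₀ δ₀
  set M := n₀ ^ n
  set κ := 6 * ε * M / δ₀ with hκ
  have hκ0 : 0 < κ := by positivity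
  have hκ1 : κ < 1 := by
    rw [hκ, div_lt_one hδ]
    have h1 : M * N₀ * ε * 1 ≤ M * N₀ * ε * N₀ := by
      gcongr
      linarith
    have h2 : M * N₀ * ε * δ₀ = M * ε * n₀ := by rw [← hNδ]; ring
    have h3 : M * ε * 10 ≤ M * ε * n₀ := by gcongr
    nlinarith
  have hfree' : ∀ r' ≤ r, IsFree n N' 𝓑 n₀ δ₀ ε E m x (5 / 2 * (M * r')) := by
    intro r' hr'
    have : 5 / 2 * (M * r') ≤ 5 / 2 * (M * r) := by gcongr
    exact ⟨(ball_subset_ball this).trans hfree.1, fun i hi z hz => this.trans (hfree.2 i hi z hz)⟩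
  -- Induction on the number of factors `κ` separating `r'` from the scales given by the stratum; it
  -- closes because `13 M N₀ ≤ C₀`.
  have key : ∀ (i : ℕ) (r' : ℝ), 0 < r' → r' ≤ r → κ ^ i * r' < r₀ →
      ∃ T ∈ limitsOfType n N' 𝓑 m, x ∈ spine n N' T m ∧
        Near x r' (constC₀ n n₀ δ₀ * ε * r') E T := by
    intro i
    induction i with
    | zero =>
      intro r' hr' _ h
      rw [pow_zero, one_mul] at h
      exact h₀ r' hr' h
    | succ i ih =>
      intro r' hr' hrr h
      obtain ⟨W, hW, hxW, hEW⟩ := ih (κ * r') (by positivity)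
        ((mul_le_of_le_one_left hr'.le hκ1.le).trans hrr) (by
          rwa [pow_succ, mul_assoc] at h)
      obtain ⟨T, hT, hxT, hET⟩ := H.exists_near_of_near hmn hxE hr' (hfree' r' hrr) rfl hW hxW hEW
      refine ⟨T, hT, hxT, hET.mono (by rw [dist_self, zero_add]) ?_⟩
      have : 13 * (M * N₀) ≤ constC₀ n n₀ δ₀ := by
        have : 0 < M * N₀ := by positivity
        linarith
      gcongr
  obtain ⟨i, hi⟩ := exists_pow_lt_of_lt_one (div_pos hr₀ (mul_pos hκ0 hr)) hκ1
  rw [lt_div_iff₀ (mul_pos hκ0 hr)] at hi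
  obtain ⟨W, hW, hxW, hEW⟩ := key i (κ * r) (by positivity) (mul_le_of_le_one_left hr.le hκ1.le) hi
  exact H.exists_near_of_near hmn hxE hr hfree rfl hW hxW hEW

/-- Close to every point of a stratum there is a point of a stratum that is isolated from the
strata of smaller index. -/
theorem exists_stratum_isolated {h : ℝ} (hh : 0 ≤ h) (hy : y ∈ stratum n N' 𝓑 n₀ δ₀ ε E k) :
    ∃ j ≤ k, ∃ z ∈ stratum n N' 𝓑 n₀ δ₀ ε E j, dist z y ≤ k * h ∧
      ∀ i < j, ∀ w ∈ stratum n N' 𝓑 n₀ δ₀ ε E i, h ≤ dist w z := by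
  induction k using Nat.strong_induction_on generalizing y with
  | _ k ih =>
    by_cases hk : ∀ i < k, ∀ w ∈ stratum n N' 𝓑 n₀ δ₀ ε E i, h ≤ dist w y
    · exact ⟨k, le_rfl, y, hy, by rw [dist_self]; positivity, hk⟩
    · push Not at hk
      obtain ⟨i, hik, w, hw, hwy⟩ := hk
      obtain ⟨j, hji, z, hz, hzw, hmin⟩ := ih i hik hw
      refine ⟨j, by omega, z, hz, ?_, hmin⟩
      -- Each descent costs less than `h` and lowers the index by at least one, so the total cost is
      -- at most `k h`.
      have : (i : ℝ) + 1 ≤ k := by exact_mod_cast hik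
      nlinarith [dist_triangle z w y]

/-- Points of the stratum of index `k` are close to the `k`-spine of an approximation of `E`. -/
theorem IsStandard.exists_spine_near_stratum (H : IsStandard n N' 𝓑 n₀ δ₀ ε E)
    (hkn : k < n) (hr : 0 < r) (hT : T ∈ limitsOfType n N' 𝓑 m)
    (hET : Near x r (14 * (n₀ ^ n * constN₀ n₀ δ₀) * ε * r) E T)
    (hball : ball x (5 / 2 * (n₀ ^ n * r)) ⊆ ball 0 2)
    (hy : y ∈ stratum n N' 𝓑 n₀ δ₀ ε E k) (hyx : dist y x + r / (100 * n) ≤ r) :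
    ∃ q ∈ spine n N' T k,
      dist y q < 12 * (n * ((n₀ ^ n) ^ 2 * constN₀ n₀ δ₀ ^ 2 * ε)) * r := by
  have hn₀ := H.admissible.1
  have hδ := H.admissible.2.1
  have hδ1 := H.admissible.2.2.1
  have hN₀ := le_constN₀ H.admissible
  have hNδ := constN₀_mul H.admissible
  have hM := H.le_pow
  have hε := H.pos
  have hsM := H.small_pow
  have hsX := H.small_pow_mul
  have hn1 : (1 : ℝ) ≤ n := by exact_mod_cast H.one_le
  have hn : (k : ℝ) ≤ n := by exact_mod_cast hkn.le
  set N₀ := constN₀ n₀ δ₀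
  set M := n₀ ^ n
  set X := M ^ 2 * N₀ ^ 2 * ε with hX
  have hX0 : 0 < X := by positivity
  obtain ⟨c, hc⟩ : ∃ c, c = M * N₀ * ε * r := ⟨_, rfl⟩
  have hc0 : 0 < c := by
    rw [hc]
    positivity
  have hcr : 14 * (M * N₀) * ε * r = 14 * c := by rw [hc]; ring
  rw [hcr] at hET
  obtain ⟨σ, hσ⟩ : ∃ σ, σ = 30 * c / δ₀ := ⟨_, rfl⟩
  have hσ0 : 0 < σ := by
    rw [hσ]
    positivity
  have hδσ : δ₀ * σ = 30 * c := by
    rw [hσ]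
    field_simp
  have hnσ : n₀ * σ = 30 * (N₀ * c) := by
    rw [← hNδ, mul_assoc, hδσ]
    ring
  have hδσ1 : δ₀ * σ ≤ σ / 10 := by nlinarith
  have hσn : 10 * σ ≤ n₀ * σ := by gcongr
  have hMNc : M * (N₀ * c) = X * r := by rw [hX, hc]; ring
  have hNc : 10 * (N₀ * c) ≤ M * (N₀ * c) := by gcongr
  -- This is the isolation radius needed to approximate `E` at scale `σ` around the isolated point
  -- `z`.
  obtain ⟨h, hh⟩ : ∃ h, h = 5 / 2 * (M * σ) := ⟨_, rfl⟩
  have hh0 : 0 < h := by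
    rw [hh]
    positivity
  have hhX : h ≤ 15 / 2 * (X * r) := by
    have h1 : M * (10 * σ) ≤ M * (n₀ * σ) := by gcongr
    rw [hnσ] at h1
    rw [hh]
    linarith
  have hσh : 25 * σ ≤ h := by
    have : 10 * σ ≤ M * σ := by gcongr
    rw [hh]
    linarith
  have hXr : 0 < X * r := by positivity
  have hnX : 1000 * (n * (X * r)) ≤ r / (100 * n) := by
    rw [le_div_iff₀ (by positivity)]
    nlinarith
  have hnh : n * h ≤ 15 / 2 * (n * (X * r)) := by nlinarith
  have hhn : h ≤ n * h := le_mul_of_one_le_left hh0.le hn1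
  have hMr : 10 * r ≤ M * r := by gcongr
  have hrn : 0 < r / (100 * n) := by positivity
  obtain ⟨j, hjk, z, hz, hzy, hmin⟩ := exists_stratum_isolated hh0.le hy
  have hzy' : dist z y ≤ n * h := hzy.trans (by gcongr)
  have hzx : dist z x + h + h ≤ r := by linarith [dist_triangle z y x]
  have hfree' : IsFree n N' 𝓑 n₀ δ₀ ε E j z h :=
    ⟨ball_subset_of_dist_add_le hball (by linarith), hmin⟩
  rw [hh] at hfree'
  obtain ⟨T', hT', hzT', hET'⟩ := H.exists_near_of_mem_stratum (by omega) hz hσ0 hfree'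
  have hcσ : 13 * (M * N₀) * ε * σ ≤ c := by
    have h1 : 13 * (M * N₀) * ε * σ = 13 * (M * N₀) * ε * (30 * c) / δ₀ := by rw [hσ]; ring
    rw [h1, div_le_iff₀ hδ]
    have h2 : N₀ * (390 * (M * N₀ * ε)) ≤ N₀ * δ₀ := by
      rw [hNδ]
      linarith
    have h3 := mul_le_mul_of_nonneg_right (le_of_mul_le_mul_left h2 (by linarith)) hc0.le
    linarith
  have hpos : 0 ≤ 13 * (M * N₀) * ε * σ := by positivity
  generalize 13 * (M * N₀) * ε * σ = a at *
  -- The error is at most `15 c = δ₀ (σ / 2)`, so the spine of `T` passes near `z`.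
  have hTT : Near z (σ / 2) (a + 14 * c) T' T := by
    refine hET'.symm.trans hET hpos (by positivity) ?_ ?_
    · rw [dist_self]
      linarith
    · linarith
  obtain ⟨-, q, hq, hqz⟩ := exists_spine_near H.admissible H.dim_le hT' le_rfl (by omega) hzT' hT hTT
    (by positivity) (by positivity) (by linarith)
  refine ⟨q, spine_mono H.dim_le hjk hkn.le hq, ?_⟩
  have h1 : n₀ * (σ / 2 + (a + 14 * c)) ≤ n₀ * σ := by
    gcongr
    linarith
  have h2 : X * r ≤ n * (X * r) := le_mul_of_one_le_left hXr.le hn1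
  have h3 := dist_triangle y z q
  rw [dist_comm y z, dist_comm z q] at h3
  have h4 : 12 * (n * X) * r = 12 * (n * (X * r)) := by ring
  rw [h4]
  linarith

/-- A point `z` of the `(m + 1)`-spine of `T` at distance `r / 2` from the `m`-spine yields a point
of a stratum of index at most `m + 1`. Lower strata are excluded by freeness, and index `m` because
that stratum stays near the `m`-spine. -/
theorem IsStandard.exists_mem_stratum_succ (H : IsStandard n N' 𝓑 n₀ δ₀ ε E) (hmn : m + 1 < n)
    (hx : x ∈ stratum n N' 𝓑 n₀ δ₀ ε E m) (hρ : 0 < ρ)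
    (hfree : IsFree n N' 𝓑 n₀ δ₀ ε E m x ρ) :
    ∃ y ∈ stratum n N' 𝓑 n₀ δ₀ ε E (m + 1), ∃ ρ' > 0, dist y x + ρ' ≤ ρ ∧
      IsFree n N' 𝓑 n₀ δ₀ ε E (m + 1) y ρ' := by
  have hN₀ := le_constN₀ H.admissible
  have hM := H.le_pow
  have hε := H.pos
  have hsM := H.small_pow
  have hsN := H.small_N₀
  have hsX := H.small_pow_mul
  have hn1 : (1 : ℝ) ≤ n := by exact_mod_cast H.one_le
  have hM0 : 0 < n₀ ^ n := by linarith
  obtain ⟨r, hr, rfl⟩ : ∃ r > 0, ρ = 5 / 2 * (n₀ ^ n * r) :=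
    ⟨2 / 5 * ρ / n₀ ^ n, by positivity, by field_simp⟩
  obtain ⟨T, hT, hxT, hET⟩ := H.exists_near_of_mem_stratum (by omega) hx hr hfree
  obtain ⟨z, hz, hzx, hzq⟩ := hT.2.exists_mem_spine_succ H.dim_le (by omega) hxT (half_pos hr)
  have hnear := fun y => H.exists_spine_near_stratum (y := y) (by omega : m < n) hr hT
    (hET.mono (by rw [dist_self, zero_add]) (by gcongr; norm_num)) hfree.1
  set N₀ := constN₀ n₀ δ₀
  set M := n₀ ^ n
  set X := M ^ 2 * N₀ ^ 2 * ε
  have hX0 : 0 < X := by positivity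
  have hMr : 10 * r ≤ M * r := by gcongr
  have hnr : r / (100 * n) ≤ r / 100 := by
    gcongr
    linarith
  have hnX : n * X ≤ 1 / 10 ^ 5 := by nlinarith
  have hiso : ∀ w ∈ stratum n N' 𝓑 n₀ δ₀ ε E m, r / 8 ≤ dist w z := by
    intro w hw
    by_contra! hwz
    obtain ⟨q, hq, hwq⟩ := hnear w hw (by linarith [dist_triangle w z x])
    have h1 := hzq q hq
    have h2 := dist_triangle z w q
    rw [dist_comm z w] at h2
    nlinarith
  have hclose : IsCloseToSpine n N' 𝓑 E (m + 1) z (r / 4) (13 * (M * N₀) * ε * r) :=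
    ⟨m, by omega, T, hT, hz, hET.mono (by linarith) le_rfl⟩
  have hsmall : N₀ * (13 * (M * N₀) * ε * r + ε * (r / 4)) ≤ r / 1000 := by
    have e : N₀ * (13 * (M * N₀) * ε * r + ε * (r / 4)) =
        (13 * (M * N₀ ^ 2 * ε) + N₀ * ε / 4) * r := by ring
    rw [e]
    nlinarith
  obtain ⟨i, hi, y, hy, hyz⟩ := hclose.exists_mem_stratum H hmn (by positivity) (by positivity)
    (ρ := r / 16)
    (by
      change N₀ * (13 * (M * N₀) * ε * r + ε * (r / 4)) ≤ _
      linarith)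
    (by
      change 4 * N₀ * (13 * (M * N₀) * ε * r + ε * (r / 4)) ≤ _
      linarith)
    (ball_subset_of_dist_add_le hfree.1 (by linarith))
  have hyx := dist_triangle y z x
  have him : i = m + 1 := by
    by_contra hne
    rcases (by omega : i < m ∨ i = m) with him | rfl
    · have := hfree.2 i him y hy
      linarith
    · have := hiso y hy
      linarith
  subst him
  refine ⟨y, hy, r / 16, by positivity, by linarith,
    ball_subset_of_dist_add_le hfree.1 (by linarith), fun i hi w hw => ?_⟩
  rcases (by omega : i < m ∨ i = m) with him | rfl
  · have := hfree.2 i him w hw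
    linarith [dist_triangle w y x]
  · have := hiso w hw
    linarith [dist_triangle w y z]

/-- Close to a point of a stratum there are points of all strata of larger index. -/
theorem IsStandard.exists_mem_stratum_of_le (H : IsStandard n N' 𝓑 n₀ δ₀ ε E) (hmk : m ≤ k)
    (hkn : k < n) (hx : x ∈ stratum n N' 𝓑 n₀ δ₀ ε E m) (hρ : 0 < ρ)
    (hball : ball x ρ ⊆ ball 0 2) : ∃ y ∈ stratum n N' 𝓑 n₀ δ₀ ε E k, dist y x < ρ := by
  classical
  -- Starting from the least index present in the ball makes it free of lower strata; then the index
  -- is raised one at a time inside shrinking balls.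
  have hex : ∃ j, ∃ z ∈ stratum n N' 𝓑 n₀ δ₀ ε E j, dist z x < ρ := ⟨m, x, hx, by rwa [dist_self]⟩
  obtain ⟨z, hz, hzx⟩ := Nat.find_spec hex
  have hjm : Nat.find hex ≤ m := Nat.find_min' hex ⟨x, hx, by rwa [dist_self]⟩
  have hmin : ∀ i < Nat.find hex, ∀ w ∈ stratum n N' 𝓑 n₀ δ₀ ε E i, ρ ≤ dist w x :=
    fun i hi w hw => not_lt.1 fun hwx => Nat.find_min hex hi ⟨w, hw, hwx⟩
  generalize Nat.find hex = j at *
  have key : ∀ k, j ≤ k → k < n → ∃ y ∈ stratum n N' 𝓑 n₀ δ₀ ε E k, ∃ ρ' > 0,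
      dist y x + ρ' ≤ ρ ∧ IsFree n N' 𝓑 n₀ δ₀ ε E k y ρ' := by
    intro k hjk
    induction k, hjk using Nat.le_induction with
    | base =>
      refine fun _ => ⟨z, hz, ρ - dist z x, by linarith, by linarith,
        ball_subset_of_dist_add_le hball (by linarith), fun i hi w hw => ?_⟩
      linarith [hmin i hi w hw, dist_triangle w z x]
    | succ k hjk ih =>
      intro hkn
      obtain ⟨y, hy, ρ₁, hρ₁, hyx, hfree⟩ := ih (by omega)
      obtain ⟨y', hy', ρ₂, hρ₂, hyy', hfree'⟩ := H.exists_mem_stratum_succ hkn hy hρ₁ hfree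
      exact ⟨y', hy', ρ₂, hρ₂, by linarith [dist_triangle y' y x], hfree'⟩
  obtain ⟨y, hy, ρ', hρ', hyx, -⟩ := key k (by omega) hkn
  exact ⟨y, hy, by linarith⟩

/-- Points of the `k`-spine of an approximation of `E` are close to the stratum of index `k`. -/
theorem IsStandard.exists_stratum_near_spine (H : IsStandard n N' 𝓑 n₀ δ₀ ε E) (hmk : m ≤ k)
    (hkn : k < n) (hr : 0 < r) (hT : T ∈ limitsOfType n N' 𝓑 m)
    (hET : Near x r (14 * (n₀ ^ n * constN₀ n₀ δ₀) * ε * r) E T)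
    (hball : ball x (5 / 2 * (n₀ ^ n * r)) ⊆ ball 0 2)
    (hy : y ∈ spine n N' T k) (hyx : dist y x + r / (100 * n) ≤ r) :
    ∃ z ∈ stratum n N' 𝓑 n₀ δ₀ ε E k,
      dist y z < 12 * (n * ((n₀ ^ n) ^ 2 * constN₀ n₀ δ₀ ^ 2 * ε)) * r := by
  have hN₀ := le_constN₀ H.admissible
  have hM := H.le_pow
  have hε := H.pos
  have hsX := H.small_pow_mul
  have hn1 : (1 : ℝ) ≤ n := by exact_mod_cast H.one_le
  set N₀ := constN₀ n₀ δ₀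
  set M := n₀ ^ n
  set X := M ^ 2 * N₀ ^ 2 * ε with hX
  have hX0 : 0 < X := by positivity
  set b := M * N₀ ^ 2 * ε * r with hb
  have hb0 : 0 < b := by positivity
  have hbX : 10 * b ≤ X * r := by
    have : X * r = M * b := by rw [hX, hb]; ring
    rw [this]
    gcongr
  have hXr : 0 < X * r := by positivity
  have hXn : X * r ≤ n * (X * r) := le_mul_of_one_le_left hXr.le hn1
  have hnX : 1000 * (n * (X * r)) ≤ r / (100 * n) := by
    rw [le_div_iff₀ (by positivity)]
    nlinarith
  have hMr : 10 * r ≤ M * r := by gcongr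
  have hrn : 0 < r / (100 * n) := by positivity
  have hrr : r / (100 * n) ≤ r := by
    linarith [dist_nonneg (x := y) (y := x)]
  have hclose : IsCloseToSpine n N' 𝓑 E k y (r / (100 * n)) (14 * (M * N₀) * ε * r) :=
    ⟨m, hmk, T, hT, hy, hET.mono hyx le_rfl⟩
  have hsmall : N₀ * (14 * (M * N₀) * ε * r + ε * (r / (100 * n))) ≤ 15 * b := by
    have h1 : N₀ * (ε * (r / (100 * n))) ≤ N₀ * (ε * r) := by gcongr
    have h2 : N₀ * (ε * r) ≤ b := by
      have : b = M * N₀ * (N₀ * (ε * r)) := by rw [hb]; ring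
      rw [this]
      exact le_mul_of_one_le_left (by positivity) (by nlinarith)
    have h3 : N₀ * (14 * (M * N₀) * ε * r + ε * (r / (100 * n))) =
      14 * b + N₀ * (ε * (r / (100 * n))) := by rw [hb]; ring
    linarith
  obtain ⟨j, hj, z, hz, hzy⟩ := hclose.exists_mem_stratum H hkn hrn (by positivity)
    (ρ := 60 * b)
    (by
      change N₀ * (14 * (M * N₀) * ε * r + ε * (r / (100 * n))) ≤ _
      linarith)
    (by
      change 4 * N₀ * (14 * (M * N₀) * ε * r + ε * (r / (100 * n))) ≤ _
      linarith)
    (ball_subset_of_dist_add_le hball (by linarith))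
  -- The index found may be smaller than `k`; it is raised to `k` within the room left in the ball
  -- of radius `60 b`.
  obtain ⟨w, hw, hwz⟩ := H.exists_mem_stratum_of_le hj hkn hz (ρ := 60 * b - dist z y)
    (by linarith) (ball_subset_of_dist_add_le hball (by linarith [dist_triangle z y x]))
  refine ⟨w, hw, ?_⟩
  rw [dist_comm]
  linarith [dist_triangle w z y]

/-- The comparison of strata and spines uses only the margin `r / (100 n)` between the two radii. -/
theorem scale_le (hn : 0 < n) : scale n k ≤ 1 - 1 / (100 * n) := by
  have hn1 : (0 : ℝ) < n := by exact_mod_cast hn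
  rw [scale]
  have : 1 / (100 * (n : ℝ)) ≤ ((k : ℝ) + 1) / (100 * n) := by
    gcongr
    linarith [Nat.cast_nonneg (α := ℝ) k]
  linarith

theorem le_scale (hkn : k < n) : 99 / 100 ≤ scale n k := by
  have hn1 : (0 : ℝ) < n := by exact_mod_cast (by omega : 0 < n)
  have hk : (k : ℝ) + 1 ≤ n := by exact_mod_cast hkn
  rw [scale]
  have : ((k : ℝ) + 1) / (100 * n) ≤ 1 / 100 := by
    rw [div_le_div_iff₀ (by positivity) (by norm_num)]
    linarith
  linarith

theorem IsStandard.lt_constC₅ (H : IsStandard n N' 𝓑 n₀ δ₀ ε E) :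
    100 * (n * ((n₀ ^ n) ^ 2 * constN₀ n₀ δ₀ ^ 2)) < constC₅ n n₀ δ₀ := by
  have hn₀ := H.admissible.1
  have hN₀ := le_constN₀ H.admissible
  have hn1 : (1 : ℝ) ≤ n := by exact_mod_cast H.one_le
  rw [constC₅, mul_comm 2 n, pow_mul]
  have h1 : 0 < n * ((n₀ ^ n) ^ 2 * constN₀ n₀ δ₀ ^ 2) := by positivity
  have h2 : 0 ≤ 10 ^ 3 * n₀ ^ (n * 2 + 1) * constN₀ n₀ δ₀ ^ 2 * (n : ℝ) ^ 3 := by positivity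
  linarith

/-- The strata of `E` are close to the spines of the approximation of `E`. -/
theorem IsStandard.exists_approximation (H : IsStandard n N' 𝓑 n₀ δ₀ ε E) (hmn : m ≤ n)
    (hx : x ∈ stratum n N' 𝓑 n₀ δ₀ ε E m) (hr : 0 < r)
    (hfree : IsFree n N' 𝓑 n₀ δ₀ ε E m x (5 / 2 * (n₀ ^ n * r))) :
    ∃ T ∈ limitsOfType n N' 𝓑 m, x ∈ spine n N' T m ∧
      localDist x r E T < ENNReal.ofReal (14 * constC₁ n n₀ δ₀ * ε) ∧
      ∀ k : ℕ, m ≤ k → k < n → 0 < scale n k ∧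
        (stratum n N' 𝓑 n₀ δ₀ ε E k ∩ ball x (scale n k * r)).Nonempty ∧
        localDist x (scale n k * r) (stratum n N' 𝓑 n₀ δ₀ ε E k) (spine n N' T k)
          < ENNReal.ofReal (constC₅ n n₀ δ₀ * ε) := by
  have hN₀ := le_constN₀ H.admissible
  have hM := H.le_pow
  have hε := H.pos
  have hn1 : (1 : ℝ) ≤ n := by exact_mod_cast H.one_le
  have hM0 : 0 < n₀ ^ n := by linarith
  have hN₀0 : 0 < constN₀ n₀ δ₀ := by linarith
  have hb : 0 < n₀ ^ n * constN₀ n₀ δ₀ * ε * r := by positivity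
  have hMr : 10 * r ≤ n₀ ^ n * r := by gcongr
  obtain ⟨T, hT, hxT, hET⟩ := H.exists_near_of_mem_stratum hmn hx hr hfree
  refine ⟨T, hT, hxT, hET.localDist_lt hr ?_ ?_, fun k hmk hkn => ?_⟩
  · rw [constC₁]
    positivity
  · rw [constC₁]
    linarith
  · have hET' : Near x r (14 * (n₀ ^ n * constN₀ n₀ δ₀) * ε * r) E T :=
      hET.mono (by rw [dist_self, zero_add]) (by linarith)
    have hs := le_scale hkn
    have hs1 := scale_le (k := k) (show 0 < n from H.one_le)
    have hsr : 99 / 100 * r ≤ scale n k * r := by gcongr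
    have hsr1 : scale n k * r + r / (100 * n) ≤ r := by
      calc scale n k * r + r / (100 * n) ≤ (1 - 1 / (100 * n)) * r + r / (100 * n) := by gcongr
        _ = r := by ring
    have hsr0 : 0 < scale n k * r := by linarith
    have hrn : 0 < r / (100 * n) := by positivity
    refine ⟨by linarith, ?_, Near.localDist_lt
      (η := 12 * (n * ((n₀ ^ n) ^ 2 * constN₀ n₀ δ₀ ^ 2 * ε)) * r)
      ⟨fun y hy hyx => ?_, fun y hy hyx => ?_⟩ hsr0 ?_ ?_⟩
    · obtain ⟨y, hy, hyx⟩ := H.exists_mem_stratum_of_le hmk hkn hx hsr0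
        (ball_subset_of_dist_add_le hfree.1 (by rw [dist_self]; linarith))
      exact ⟨y, hy, hyx⟩
    · exact H.exists_spine_near_stratum hkn hr hT hET' hfree.1 hy (by linarith)
    · exact H.exists_stratum_near_spine hmk hkn hr hT hET' hfree.1 hy (by linarith)
    · have := H.lt_constC₅
      have h1 : 0 < constC₅ n n₀ δ₀ := lt_of_le_of_lt (by positivity) this
      positivity
    · have h1 := mul_lt_mul_of_pos_right H.lt_constC₅ hε
      have h2 : 0 < n * ((n₀ ^ n) ^ 2 * constN₀ n₀ δ₀ ^ 2 * ε) := by positivity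
      have h3 : 0 < constC₅ n n₀ δ₀ * ε := lt_of_le_of_lt (by positivity) h1
      -- Since `C₅` exceeds `100 n n₀^{2n} N₀²`, the factor `99/100` lost to the smaller radius is
      -- harmless.
      calc 12 * (n * ((n₀ ^ n) ^ 2 * constN₀ n₀ δ₀ ^ 2 * ε)) * r
          < constC₅ n n₀ δ₀ * ε * (99 / 100 * r) := by nlinarith
        _ ≤ constC₅ n n₀ δ₀ * ε * (scale n k * r) := by gcongr

end Strata

/-! ### Choice of `ε₀` and conclusion -/

/-- No element of `[0, ∞]` is less than 0, so an approximable set cannot exist for `ε ≤ 0`; only the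
upper bound on `ε` has to be imposed. -/
theorem IsApproximable.pos {N : ℕ} {𝓑 : Set (Set (Euc N))} {ε : ℝ} {E : Set (Euc N)}
    (h : IsApproximable 𝓑 ε E) : 0 < ε := by
  obtain ⟨Z, -, -, hZ⟩ := h.2.2 0 h.2.1 1 one_pos
  by_contra hε
  rw [ENNReal.ofReal_of_nonpos (not_lt.1 hε)] at hZ
  exact not_lt_zero hZ

theorem exists_isStandard {N n N' : ℕ} (hn : 0 < n) (hN : N' + n ≤ N) {𝓑 : Set (Set (Euc N))}
    (h𝓑 : ∀ W ∈ 𝓑, ∃ m ≤ n, IsOfType n N' m W) {n₀ δ₀ : ℝ} (h : Admissible n N' 𝓑 n₀ δ₀) :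
    ∃ ε₀ > 0, ∀ ε < ε₀, ∀ E, IsApproximable 𝓑 ε E → IsStandard n N' 𝓑 n₀ δ₀ ε E := by
  have hn₀ := h.1
  have hN₀ := le_constN₀ h
  have hn1 : (0 : ℝ) < n := by exact_mod_cast hn
  have hC₁ : 0 < constC₁ n n₀ δ₀ := by
    rw [constC₁]
    positivity
  have hC₀ : 0 < constC₀ n n₀ δ₀ := by
    rw [constC₀]
    positivity
  have h1 : 0 < 10 ^ 4 * constN₀ n₀ δ₀ ^ 2 := by positivity
  have h2 : 0 < 10 ^ 4 * constC₀ n n₀ δ₀ * constN₀ n₀ δ₀ := by positivity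
  have h3 : 0 < 10 ^ 5 * (n : ℝ) ^ 2 * n₀ ^ n * constC₁ n n₀ δ₀ * constN₀ n₀ δ₀ := by positivity
  refine ⟨min (1 / (10 ^ 4 * constN₀ n₀ δ₀ ^ 2)) (min (1 / (10 ^ 4 * constC₀ n n₀ δ₀ * constN₀ n₀ δ₀))
    (1 / (10 ^ 5 * (n : ℝ) ^ 2 * n₀ ^ n * constC₁ n n₀ δ₀ * constN₀ n₀ δ₀))), by positivity,
    fun ε hε E hE => ⟨hn, hN, h𝓑, h, hE, hE.pos, ?_, ?_, ?_⟩⟩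
  · rw [mul_comm, ← le_div_iff₀ h1]
    exact hε.le.trans (min_le_left _ _)
  · rw [mul_comm, ← le_div_iff₀ h2]
    exact hε.le.trans ((min_le_right _ _).trans (min_le_left _ _))
  · rw [mul_comm, ← le_div_iff₀ h3]
    exact hε.le.trans ((min_le_right _ _).trans (min_le_right _ _))

end ConeStrata

theorem mainTheorem4 {n N' N : ℕ} (hn : 0 < n) (hN' : n < N') (hN : N' + n ≤ N)
    (𝓑 : Set (Set (Euc N)))
    (h𝓑 : ∀ W ∈ 𝓑, ∃ m : ℕ, m ≤ n ∧ IsOfType n N' m W)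
    (hfin : FiniteModIsometry 𝓑) :
    (∃ n₀ δ₀ : ℝ, Admissible n N' 𝓑 n₀ δ₀) ∧
    ∀ n₀ δ₀ : ℝ, Admissible n N' 𝓑 n₀ δ₀ →
      ∃ ε₀ : ℝ, 0 < ε₀ ∧ ∀ ε : ℝ, ε < ε₀ → ∀ E : Set (Euc N), IsApproximable 𝓑 ε E →
        ∀ m : ℕ, m ≤ n → ∀ x ∈ stratum n N' 𝓑 n₀ δ₀ ε E m, ∀ r : ℝ, 0 < r →
          Metric.ball x (5 * n₀ ^ n * r / 2) ⊆ Metric.ball 0 2 →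
          (∀ k : ℕ, k < m →
            Metric.ball x (5 * n₀ ^ n * r / 2) ∩ stratum n N' 𝓑 n₀ δ₀ ε E k = ∅) →
          ∃ T ∈ limitsOfType n N' 𝓑 m,
            x ∈ spine n N' T m ∧
            localDist x r E T < ENNReal.ofReal (14 * constC₁ n n₀ δ₀ * ε) ∧
            ∀ k : ℕ, m ≤ k → k < n →
              0 < scale n k ∧
              (stratum n N' 𝓑 n₀ δ₀ ε E k ∩ Metric.ball x (scale n k * r)).Nonempty ∧
              localDist x (scale n k * r) (stratum n N' 𝓑 n₀ δ₀ ε E k) (spine n N' T k)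
                < ENNReal.ofReal (constC₅ n n₀ δ₀ * ε) := by
  refine ⟨exists_admissible (by omega) hN h𝓑 hfin, fun n₀ δ₀ hadm => ?_⟩
  obtain ⟨ε₀, hε₀, h⟩ := exists_isStandard hn hN h𝓑 hadm
  refine ⟨ε₀, hε₀, fun ε hε E hE m hmn x hx r hr hball hfree => ?_⟩
  have e : 5 * n₀ ^ n * r / 2 = 5 / 2 * (n₀ ^ n * r) := by ring
  rw [e] at hball
  refine (h ε hε E hE).exists_approximation hmn hx hr ⟨hball, fun k hk z hz => ?_⟩
  by_contra! hzx
  have hmem : z ∈ Metric.ball x (5 * n₀ ^ n * r / 2) ∩ stratum n N' 𝓑 n₀ δ₀ ε E k :=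
    ⟨by rwa [Metric.mem_ball, e], hz⟩
  rw [hfree k hk] at hmem
  exact hmem
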